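/- Let $d\ge 0$ and $s>1$. Write $\hat f(\xi)=\int_{\mathbb R^d}e^{-2\pi i x\cdot\xi}f(x)\,dx$, and $|\cdot|$ for the Euclidean norm. Definitions. For $h>0$ and a smooth $f:\mathbb R^d\to\mathbb C$ put $$\|f\|_{\mathcal S_{s,h}}=\sup_{\alpha,\beta\in\mathbb N^d}\ \sup_{x\in\mathbb R^d}\frac{|x^\alpha\partial^\beta f(x)|}{h^{|\alpha+\beta|}(\alpha!\,\beta!)^s}.$$ The Gelfand–Shilov space $\mathcal S_s(\mathbb R^d)$ (resp. $\Sigma_s(\mathbb R^d)$) consists of all $f\in C^\infty(\mathbb R^d)$ with $\|f\|_{\mathcal S_{s,h}}<\infty$ for some $h>0$ (resp. for every $h>0$). The space $\Sigma_1(\mathbb R^d)$ consists of all $f\in C^\infty(\mathbb R^d)$ such that $\sup_x|f(x)|e^{h|x|}<\infty$ and $\sup_\omega|\hat f(\omega)|e^{h|\omega|}<\infty$ for every $h>0$, with the topology given by the sums of these two suprema as seminorms, and $\Sigma_1'(\mathbb R^d)$ is its continuous dual. A locally integrable function $f$ is identified with the element $\varphi\mapsto\int f\varphi\,dx$ of $\Sigma_1'(\mathbb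 R^d)$ (when the integrals converge absolutely and this functional is continuous), and $\hat u(\varphi)=u(\hat\varphi)$ for $u\in\Sigma_1'(\mathbb R^d)$. Fix a window $\phi\in\Sigma_1(\mathbb R^d)\setminus\{0\}$. For $u\in\Sigma_1'(\mathbb R^d)$ let $V_\phi u(x,\xi)=u\big(e^{-2\pi i\xi\cdot(\,\cdot\,)}\,\overline{\phi(\,\cdot\,-x)}\big)$ be its short-time Fourier transform, and for $h\ge 0$ let $$\mathcal{C}oY^{h,s}(\mathbb R^d)=\Big\{u\in\Sigma_1'(\mathbb R^d):\int_{\mathbb R^d}\Big(\int_{\mathbb R^d}|V_\phi u(x,\xi)|^2dx\Big)e^{2h|\xi|^{1/s}}d\xi<\infty\Big\},$$ $$\mathscr F\mathcal{C}oY^{h,s}(\mathbb R^d)=\{u\in\Sigma_1'(\mathbb R^d):\hat u\in\mathcal{C}oY^{h,s}(\mathbb R^d)\}.$$ Theorem. For every such $d$, $s$, $\phi$ and every $f\in\Sigma_1'(\mathbb R^d)$ the following are equivalent: (a) $f\in\mathcal S_s(\mathbb R^d)$ (resp. $f\in\Sigma_s(\mathbb R^d)$), that is, $f$ is given by a function in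 this space; (b) $f$ is given by a function, and for some $h>0$ (resp. for every $h>0$) $$\sup_{x\in\mathbb R^d}|f(x)|e^{h|x|^{1/s}}<\infty\quad\text{and}\quad\sup_{\xi\in\mathbb R^d}|\hat f(\xi)|e^{h|\xi|^{1/s}}<\infty$$ (for a suitable representative of $f$); (c) for some $h>0$ (resp. for every $h>0$), $f\in\mathcal{C}oY^{h,s}(\mathbb R^d)\cap\mathscr F\mathcal{C}oY^{h,s}(\mathbb R^d)$. -/

import Mathlib

open MeasureTheory FourierTransform
open scoped Real ENNReal ContDiff InnerProductSpace

noncomputable section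

/-- The space `ℝ^d` with its Euclidean norm. -/
abbrev Rd (d : ℕ) : Type := EuclideanSpace ℝ (Fin d)

/-! ### The Gelfand-Shilov spaces of Roumieu and Beurling type -/

/-- The partial derivative `∂_i f`. -/
def partialDeriv {d : ℕ} (i : Fin d) (f : Rd d → ℂ) : Rd d → ℂ :=
  fun x => fderiv ℝ f x (EuclideanSpace.single i 1)

/-- The derivative `∂^β f = ∂_1^{β_1} ⋯ ∂_d^{β_d} f` for a multi-index `β`. -/
def multiDeriv {d : ℕ} (β : Fin d → ℕ) (f : Rd d → ℂ) : Rd d → ℂ :=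
  (List.finRange d).foldr (fun i g => (partialDeriv i)^[β i] g) f

/-- `sup_{α, β, x} |x^α ∂^β f(x)| / (h^{|α + β|} (α! β!)^s)`, as an extended real. -/
def gsNorm {d : ℕ} (s h : ℝ) (f : Rd d → ℂ) : ℝ≥0∞ :=
  ⨆ (α : Fin d → ℕ) (β : Fin d → ℕ) (x : Rd d),
    ENNReal.ofReal (‖((∏ i, x i ^ α i : ℝ) : ℂ) * multiDeriv β f x‖ /
      (h ^ (∑ i, (α i + β i)) * (((∏ i, (α i).factorial) * (∏ i, (β i).factorial) : ℕ) : ℝ) ^ s))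

/-- The Gelfand-Shilov space `S_s(ℝ^d)` of Roumieu type. -/
def roumieuGS (d : ℕ) (s : ℝ) : Set (Rd d → ℂ) :=
  {f | ContDiff ℝ ∞ f ∧ ∃ h : ℝ, 0 < h ∧ gsNorm s h f < ⊤}

/-- The Gelfand-Shilov space `Σ_s(ℝ^d)` of Beurling type. -/
def beurlingGS (d : ℕ) (s : ℝ) : Set (Rd d → ℂ) :=
  {f | ContDiff ℝ ∞ f ∧ ∀ h : ℝ, 0 < h → gsNorm s h f < ⊤}

/-! ### Bounds by the weights `e^{-h|x|^{1/s}}` -/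

/-- `sup_x |f(x)| e^{h |x|^{1/s}} < ∞`. -/
def WeightBound {d : ℕ} (s h : ℝ) (f : Rd d → ℂ) : Prop :=
  ∃ C : ℝ, ∀ x, ‖f x‖ * Real.exp (h * ‖x‖ ^ (1 / s)) ≤ C

/-! ### The space `Σ_1(ℝ^d)` and its dual -/

/-- `sup_x |f(x)| e^{h |x|} < ∞`. -/
def ExpBound {d : ℕ} (h : ℝ) (f : Rd d → ℂ) : Prop :=
  ∃ C : ℝ, ∀ x, ‖f x‖ * Real.exp (h * ‖x‖) ≤ C

/-- Membership in `Σ_1(ℝ^d)`: smooth functions that, together with their Fourier transforms,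
decay faster than every exponential. -/
def IsSigma1 {d : ℕ} (f : Rd d → ℂ) : Prop :=
  ContDiff ℝ ∞ f ∧ ∀ h : ℝ, 0 < h → ExpBound h f ∧ ExpBound h (𝓕 f)

theorem ExpBound.integrable_pow {d : ℕ} {f : Rd d → ℂ} (hf : Continuous f)
    (hb : ExpBound 1 f) (n : ℕ) : Integrable (fun v => ‖v‖ ^ n * ‖f v‖) := by
  obtain ⟨C, hC⟩ := hb
  have hint : Integrable (fun v : Rd d => (1 + ‖v‖) ^ (-((d + 1 : ℕ) : ℝ))) := by
    apply integrable_one_add_norm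
    simp
  refine (hint.const_mul (C * ((n + d + 1).factorial * Real.exp 1))).mono'
    (by fun_prop) (Filter.Eventually.of_forall fun v => ?_)
  have h0 : (0 : ℝ) < 1 + ‖v‖ := by positivity
  rw [Real.rpow_neg h0.le, Real.rpow_natCast, ← div_eq_mul_inv, le_div_iff₀ (by positivity)]
  have h1 : (1 + ‖v‖) ^ (n + d + 1) ≤ (n + d + 1).factorial * Real.exp 1 * Real.exp ‖v‖ := by
    have := Real.pow_div_factorial_le_exp (1 + ‖v‖) h0.le (n + d + 1)
    rw [div_le_iff₀ (by positivity), Real.exp_add] at this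
    linarith
  have h2 := hC v
  rw [one_mul] at h2
  rw [Real.norm_of_nonneg (by positivity)]
  calc ‖v‖ ^ n * ‖f v‖ * (1 + ‖v‖) ^ (d + 1)
      ≤ (1 + ‖v‖) ^ n * ‖f v‖ * (1 + ‖v‖) ^ (d + 1) := by
        gcongr
        linarith
    _ = ‖f v‖ * (1 + ‖v‖) ^ (n + d + 1) := by ring
    _ ≤ ‖f v‖ * ((n + d + 1).factorial * Real.exp 1 * Real.exp ‖v‖) := by gcongr
    _ = (‖f v‖ * Real.exp ‖v‖) * ((n + d + 1).factorial * Real.exp 1) := by ring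
    _ ≤ C * ((n + d + 1).factorial * Real.exp 1) := by gcongr

theorem ExpBound.integrable {d : ℕ} {f : Rd d → ℂ} (hf : Continuous f)
    (hb : ExpBound 1 f) : Integrable f := by
  have := hb.integrable_pow hf 0
  simp only [pow_zero, one_mul] at this
  exact (integrable_norm_iff hf.aestronglyMeasurable).1 this

theorem ExpBound.add {d : ℕ} {h : ℝ} {f g : Rd d → ℂ} (hf : ExpBound h f) (hg : ExpBound h g) :
    ExpBound h (f + g) := by
  obtain ⟨C, hC⟩ := hf
  obtain ⟨D, hD⟩ := hg
  refine ⟨C + D, fun x => ?_⟩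
  calc ‖(f + g) x‖ * Real.exp (h * ‖x‖) ≤ (‖f x‖ + ‖g x‖) * Real.exp (h * ‖x‖) := by
        gcongr; exact norm_add_le _ _
    _ ≤ C + D := by rw [add_mul]; exact add_le_add (hC x) (hD x)

theorem ExpBound.const_smul {d : ℕ} {h : ℝ} {f : Rd d → ℂ} (c : ℂ) (hf : ExpBound h f) :
    ExpBound h (c • f) := by
  obtain ⟨C, hC⟩ := hf
  refine ⟨‖c‖ * C, fun x => ?_⟩
  rw [Pi.smul_apply, norm_smul, mul_assoc]
  exact mul_le_mul_of_nonneg_left (hC x) (norm_nonneg c)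

/-- Passing to a function that is dominated by a translate preserves exponential bounds. -/
theorem ExpBound.translate {d : ℕ} {h : ℝ} (hh : 0 < h) {f g : Rd d → ℂ} (a : Rd d)
    (hfg : ∀ x, ‖g x‖ = ‖f (x - a)‖) (hf : ExpBound h f) : ExpBound h g := by
  obtain ⟨C, hC⟩ := hf
  refine ⟨C * Real.exp (h * ‖a‖), fun x => ?_⟩
  have h1 : ‖x‖ ≤ ‖x - a‖ + ‖a‖ := by simpa using norm_add_le (x - a) a
  calc ‖g x‖ * Real.exp (h * ‖x‖)
      ≤ ‖f (x - a)‖ * (Real.exp (h * ‖x - a‖) * Real.exp (h * ‖a‖)) := by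
        rw [hfg, ← Real.exp_add, ← mul_add]
        gcongr
    _ = (‖f (x - a)‖ * Real.exp (h * ‖x - a‖)) * Real.exp (h * ‖a‖) := by ring
    _ ≤ C * Real.exp (h * ‖a‖) := by gcongr; exact hC _

theorem ExpBound.reflect {d : ℕ} {h : ℝ} {f g : Rd d → ℂ}
    (hfg : ∀ x, ‖g x‖ = ‖f (-x)‖) (hf : ExpBound h f) : ExpBound h g := by
  obtain ⟨C, hC⟩ := hf
  refine ⟨C, fun x => ?_⟩
  rw [hfg, ← norm_neg x]
  exact hC (-x)

theorem IsSigma1.integrable {d : ℕ} {f : Rd d → ℂ} (hf : IsSigma1 f) : Integrable f :=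
  (hf.2 1 one_pos).1.integrable hf.1.continuous

theorem IsSigma1.contDiff_fourier {d : ℕ} {f : Rd d → ℂ} (hf : IsSigma1 f) :
    ContDiff ℝ ∞ (𝓕 f) :=
  Real.contDiff_fourier fun n _ => (hf.2 1 one_pos).1.integrable_pow hf.1.continuous n

theorem IsSigma1.fourier_fourier {d : ℕ} {f : Rd d → ℂ} (hf : IsSigma1 f) (x : Rd d) :
    𝓕 (𝓕 f) x = f (-x) := by
  have h := congrFun (hf.1.continuous.fourierInv_fourier_eq hf.integrable
    ((hf.2 1 one_pos).2.integrable hf.contDiff_fourier.continuous)) (-x)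
  rwa [Real.fourierInv_eq_fourier_neg, neg_neg] at h

theorem IsSigma1.fourier {d : ℕ} {f : Rd d → ℂ} (hf : IsSigma1 f) : IsSigma1 (𝓕 f) :=
  ⟨hf.contDiff_fourier, fun h hh => ⟨(hf.2 h hh).2,
    (hf.2 h hh).1.reflect fun x => by rw [hf.fourier_fourier]⟩⟩

theorem fourier_add_of_integrable {d : ℕ} {f g : Rd d → ℂ} (hf : Integrable f)
    (hg : Integrable g) : 𝓕 (f + g) = 𝓕 f + 𝓕 g := by
  ext w
  simp only [Real.fourier_eq, Pi.add_apply, smul_add]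
  exact integral_add ((Real.fourierIntegral_convergent_iff w).2 hf)
    ((Real.fourierIntegral_convergent_iff w).2 hg)

theorem fourier_const_smul' {d : ℕ} (c : ℂ) (f : Rd d → ℂ) : 𝓕 (c • f) = c • 𝓕 f := by
  ext w
  simp only [Real.fourier_eq, Pi.smul_apply]
  rw [← integral_smul]
  congr 1
  ext v
  rw [smul_comm]

theorem IsSigma1.add {d : ℕ} {f g : Rd d → ℂ} (hf : IsSigma1 f) (hg : IsSigma1 g) :
    IsSigma1 (f + g) := by
  refine ⟨hf.1.add hg.1, fun h hh => ⟨(hf.2 h hh).1.add (hg.2 h hh).1, ?_⟩⟩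
  rw [fourier_add_of_integrable hf.integrable hg.integrable]
  exact (hf.2 h hh).2.add (hg.2 h hh).2

theorem IsSigma1.const_smul {d : ℕ} {f : Rd d → ℂ} (c : ℂ) (hf : IsSigma1 f) :
    IsSigma1 (c • f) := by
  refine ⟨hf.1.const_smul c, fun h hh => ⟨(hf.2 h hh).1.const_smul c, ?_⟩⟩
  rw [fourier_const_smul']
  exact (hf.2 h hh).2.const_smul c

theorem IsSigma1.zero {d : ℕ} : IsSigma1 (0 : Rd d → ℂ) := by
  have h0 : 𝓕 (0 : Rd d → ℂ) = 0 := by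
    ext w
    simp [Real.fourier_eq]
  refine ⟨contDiff_const, fun h _ => ⟨⟨0, fun x => by simp⟩, ⟨0, fun x => ?_⟩⟩⟩
  rw [h0]
  simp

/-- `Σ_1(ℝ^d)` as a vector space of functions. -/
def sigma1Submodule (d : ℕ) : Submodule ℂ (Rd d → ℂ) where
  carrier := {f | IsSigma1 f}
  add_mem' hf hg := hf.add hg
  zero_mem' := IsSigma1.zero
  smul_mem' c _ hf := hf.const_smul c

/-- `Σ_1(ℝ^d)`. This is a new type, so that it carries the topology of its seminorms
and not that of pointwise convergence. -/
def Sigma1 (d : ℕ) : Type := sigma1Submodule d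

instance Sigma1.instAddCommGroup (d : ℕ) : AddCommGroup (Sigma1 d) := inferInstanceAs (AddCommGroup (sigma1Submodule d))

instance Sigma1.instModule (d : ℕ) : Module ℂ (Sigma1 d) := inferInstanceAs (Module ℂ (sigma1Submodule d))

/-- The function underlying an element of `Σ_1(ℝ^d)`. -/
def Sigma1.toFun {d : ℕ} (φ : Sigma1 d) : Rd d → ℂ := φ.1

theorem Sigma1.isSigma1 {d : ℕ} (φ : Sigma1 d) : IsSigma1 φ.toFun := φ.2

theorem Sigma1.toFun_add {d : ℕ} (φ ψ : Sigma1 d) : (φ + ψ).toFun = φ.toFun + ψ.toFun := rfl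

theorem Sigma1.toFun_smul {d : ℕ} (c : ℂ) (φ : Sigma1 d) : (c • φ).toFun = c • φ.toFun := rfl

/-- `sup_x |f(x)| e^{h |x|}`. -/
def expSup {d : ℕ} (h : ℝ) (f : Rd d → ℂ) : ℝ := ⨆ x, ‖f x‖ * Real.exp (h * ‖x‖)

theorem ExpBound.bddAbove {d : ℕ} {h : ℝ} {f : Rd d → ℂ} (hf : ExpBound h f) :
    BddAbove (Set.range fun x => ‖f x‖ * Real.exp (h * ‖x‖)) := by
  obtain ⟨C, hC⟩ := hf
  exact ⟨C, by rintro _ ⟨x, rfl⟩; exact hC x⟩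

theorem expSup_add_le {d : ℕ} {h : ℝ} {f g : Rd d → ℂ} (hf : ExpBound h f) (hg : ExpBound h g) :
    expSup h (f + g) ≤ expSup h f + expSup h g := by
  refine ciSup_le fun x => ?_
  calc ‖(f + g) x‖ * Real.exp (h * ‖x‖) ≤ (‖f x‖ + ‖g x‖) * Real.exp (h * ‖x‖) := by
        gcongr; exact norm_add_le _ _
    _ ≤ expSup h f + expSup h g := by
        rw [add_mul]
        exact add_le_add (le_ciSup hf.bddAbove x) (le_ciSup hg.bddAbove x)

theorem expSup_smul {d : ℕ} (h : ℝ) (c : ℂ) (f : Rd d → ℂ) :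
    expSup h (c • f) = ‖c‖ * expSup h f := by
  unfold expSup
  rw [Real.mul_iSup_of_nonneg (norm_nonneg c)]
  simp only [Pi.smul_apply, norm_smul, mul_assoc]

theorem expSup_reflect {d : ℕ} (h : ℝ) {f g : Rd d → ℂ} (hfg : ∀ x, g x = f (-x)) :
    expSup h g = expSup h f := by
  unfold expSup
  refine (Equiv.neg (Rd d)).iSup_congr fun x => ?_
  simp [hfg]

/-- The seminorms `sup_x |f(x)| e^{h |x|} + sup_ω |f̂(ω)| e^{h |ω|}`, `h > 0`, of `Σ_1(ℝ^d)`. -/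
def sigma1Seminorm (d : ℕ) : SeminormFamily ℂ (Sigma1 d) (Set.Ioi (0 : ℝ)) := fun h =>
  Seminorm.of (fun φ => expSup h.1 φ.toFun + expSup h.1 (𝓕 φ.toFun))
    (fun φ ψ => by
      have hφ := φ.isSigma1
      have hψ := ψ.isSigma1
      rw [Sigma1.toFun_add, fourier_add_of_integrable hφ.integrable hψ.integrable]
      have h1 := expSup_add_le (hφ.2 h.1 h.2).1 (hψ.2 h.1 h.2).1
      have h2 := expSup_add_le (hφ.2 h.1 h.2).2 (hψ.2 h.1 h.2).2
      linarith)
    (fun c φ => by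
      rw [Sigma1.toFun_smul, fourier_const_smul', expSup_smul, expSup_smul, mul_add])

/-- The projective limit (Fréchet) topology of `Σ_1(ℝ^d)`. -/
instance Sigma1.instTopologicalSpace (d : ℕ) : TopologicalSpace (Sigma1 d) := (sigma1Seminorm d).moduleFilterBasis.topology

theorem sigma1_withSeminorms (d : ℕ) : WithSeminorms (sigma1Seminorm d) := ⟨rfl⟩

/-- The space `Σ_1'(ℝ^d)`, the continuous dual of `Σ_1(ℝ^d)`. -/
abbrev Sigma1Dual (d : ℕ) : Type := Sigma1 d →L[ℂ] ℂ

/-! ### The Fourier transform on `Σ_1'` -/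

/-- The Fourier transform on `Σ_1(ℝ^d)`. -/
def Sigma1.fourier (d : ℕ) : Sigma1 d →L[ℂ] Sigma1 d where
  toFun φ := ⟨𝓕 φ.toFun, φ.isSigma1.fourier⟩
  map_add' φ ψ := Subtype.ext
    (fourier_add_of_integrable φ.isSigma1.integrable ψ.isSigma1.integrable)
  map_smul' c φ := Subtype.ext (fourier_const_smul' c φ.toFun)
  cont := by
    refine WithSeminorms.continuous_of_isBounded (sigma1_withSeminorms d) (sigma1_withSeminorms d)
      ({ toFun := fun φ => ⟨𝓕 φ.toFun, φ.isSigma1.fourier⟩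
         map_add' := fun φ ψ => Subtype.ext
          (fourier_add_of_integrable φ.isSigma1.integrable ψ.isSigma1.integrable)
         map_smul' := fun c φ => Subtype.ext (fourier_const_smul' c φ.toFun) } :
          Sigma1 d →ₗ[ℂ] Sigma1 d) fun h => ⟨{h}, 1, fun φ => ?_⟩
    rw [Finset.sup_singleton, one_smul]
    change expSup h.1 (𝓕 φ.toFun) + expSup h.1 (𝓕 (𝓕 φ.toFun))
      ≤ expSup h.1 φ.toFun + expSup h.1 (𝓕 φ.toFun)
    rw [expSup_reflect h.1 φ.isSigma1.fourier_fourier, add_comm]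

/-- The Fourier transform `û` of `u ∈ Σ_1'(ℝ^d)`, given by `û(φ) = u(φ̂)`. -/
def Sigma1Dual.fourier {d : ℕ} (u : Sigma1Dual d) : Sigma1Dual d := u.comp (Sigma1.fourier d)

/-! ### The short-time Fourier transform on `Σ_1'` -/

/-- Translation `T_x f(y) = f(y - x)`. -/
def translation {d : ℕ} (x : Rd d) (f : Rd d → ℂ) : Rd d → ℂ := fun y => f (y - x)

/-- Modulation `M_ξ f(y) = e^{2πi ξ·y} f(y)`. -/
def modulation {d : ℕ} (ξ : Rd d) (f : Rd d → ℂ) : Rd d → ℂ :=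
  fun y => Complex.exp (2 * π * Complex.I * (⟪ξ, y⟫_ℝ : ℝ)) * f y

theorem norm_exp_two_pi_I (t : ℝ) : ‖Complex.exp (2 * π * Complex.I * (t : ℝ))‖ = 1 := by
  rw [show (2 * π * Complex.I * (t : ℝ) : ℂ) = ((2 * π * t : ℝ) : ℂ) * Complex.I by
    push_cast; ring]
  exact Complex.norm_exp_ofReal_mul_I _

theorem norm_fourier_translation {d : ℕ} (x : Rd d) (f : Rd d → ℂ) (w : Rd d) :
    ‖𝓕 (translation x f) w‖ = ‖𝓕 f w‖ := by
  have h : 𝓕 (translation x f) w = Complex.exp (2 * π * Complex.I * (-⟪x, w⟫_ℝ : ℝ)) * 𝓕 f w := by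
    rw [Real.fourier_eq', Real.fourier_eq', ← integral_const_mul,
      ← integral_add_right_eq_self _ x]
    congr 1
    ext v
    simp only [translation, add_sub_cancel_right, smul_eq_mul]
    rw [← mul_assoc, ← Complex.exp_add]
    congr 2
    rw [inner_add_left]
    push_cast
    ring
  rw [h, norm_mul, norm_exp_two_pi_I, one_mul]

theorem fourier_modulation {d : ℕ} (ξ : Rd d) (f : Rd d → ℂ) (w : Rd d) :
    𝓕 (modulation ξ f) w = 𝓕 f (w - ξ) := by
  rw [Real.fourier_eq', Real.fourier_eq']
  congr 1
  ext v
  simp only [modulation, smul_eq_mul]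
  rw [← mul_assoc, ← Complex.exp_add]
  congr 2
  rw [inner_sub_right, real_inner_comm ξ v]
  push_cast
  ring

theorem norm_fourier_conj {d : ℕ} (f : Rd d → ℂ) (w : Rd d) :
    ‖𝓕 (fun y => starRingEnd ℂ (f y)) w‖ = ‖𝓕 f (-w)‖ := by
  have h : 𝓕 (fun y => starRingEnd ℂ (f y)) w = starRingEnd ℂ (𝓕 f (-w)) := by
    rw [Real.fourier_eq', Real.fourier_eq', ← integral_conj]
    congr 1
    ext v
    simp only [smul_eq_mul, map_mul, ← Complex.exp_conj, Complex.conj_I, Complex.conj_ofReal,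
      inner_neg_right]
    congr 2
    push_cast
    ring
  rw [h, RCLike.norm_conj]

theorem IsSigma1.translation {d : ℕ} {f : Rd d → ℂ} (x : Rd d) (hf : IsSigma1 f) :
    IsSigma1 (translation x f) :=
  ⟨hf.1.comp (contDiff_id.sub contDiff_const), fun h hh =>
    ⟨(hf.2 h hh).1.translate hh x fun _ => rfl,
      (hf.2 h hh).2.translate hh 0 fun w => by rw [norm_fourier_translation, sub_zero]⟩⟩

theorem IsSigma1.modulation {d : ℕ} {f : Rd d → ℂ} (ξ : Rd d) (hf : IsSigma1 f) :
    IsSigma1 (modulation ξ f) := by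
  refine ⟨ContDiff.mul ?_ hf.1, fun h hh => ⟨?_, ?_⟩⟩
  · refine ContDiff.cexp (contDiff_const.mul ?_)
    exact Complex.ofRealCLM.contDiff.comp (contDiff_const.inner ℝ contDiff_id)
  · refine (hf.2 h hh).1.translate hh 0 fun y => ?_
    simp only [_root_.modulation, norm_mul, norm_exp_two_pi_I, one_mul, sub_zero]
  · exact (hf.2 h hh).2.translate hh ξ fun w => by rw [fourier_modulation]

theorem IsSigma1.conj {d : ℕ} {f : Rd d → ℂ} (hf : IsSigma1 f) :
    IsSigma1 (fun y => starRingEnd ℂ (f y)) := by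
  refine ⟨Complex.conjCLE.contDiff.comp hf.1, fun h hh => ⟨?_, ?_⟩⟩
  · exact (hf.2 h hh).1.translate hh 0 fun y => by rw [RCLike.norm_conj, sub_zero]
  · exact (hf.2 h hh).2.reflect fun w => norm_fourier_conj f w

/-- The test function `conj (M_ξ T_x φ) ∈ Σ_1(ℝ^d)`. -/
def Sigma1.conjShift {d : ℕ} (x ξ : Rd d) (φ : Sigma1 d) : Sigma1 d :=
  ⟨fun y => starRingEnd ℂ (modulation ξ (translation x φ.toFun) y),
    ((φ.isSigma1.translation x).modulation ξ).conj⟩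

/-- The short-time Fourier transform `V_φ u(x, ξ) = ⟨u, M_ξ T_x φ⟩` of `u ∈ Σ_1'(ℝ^d)`. The
bracket is conjugate linear in its second argument, while `u` acts linearly. -/
def stft {d : ℕ} (φ : Sigma1 d) (u : Sigma1Dual d) (x ξ : Rd d) : ℂ :=
  u (φ.conjShift x ξ)

/-! ### Coorbit spaces -/

/-- The coorbit space `Co Y^{h,s}(ℝ^d)` with window `φ`. -/
def coorbit {d : ℕ} (φ : Sigma1 d) (h s : ℝ) : Set (Sigma1Dual d) :=
  {u | ∫⁻ ξ : Rd d, (∫⁻ x : Rd d, ‖stft φ u x ξ‖ₑ ^ 2) *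
    ENNReal.ofReal (Real.exp (2 * h * ‖ξ‖ ^ (1 / s))) < ⊤}

/-- The space `F Co Y^{h,s}(ℝ^d)` with window `φ`: all `u` with `û ∈ Co Y^{h,s}(ℝ^d)`. -/
def fourierCoorbit {d : ℕ} (φ : Sigma1 d) (h s : ℝ) : Set (Sigma1Dual d) :=
  {u | u.fourier ∈ coorbit φ h s}

/-! ### Functions as elements of `Σ_1'` -/

/-- `u ∈ Σ_1'(ℝ^d)` is the function `f`: the pairing with each test function is
`∫ f(x) φ(x) dx`, as an absolutely convergent integral. -/
def Represents {d : ℕ} (f : Rd d → ℂ) (u : Sigma1Dual d) : Prop :=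
  LocallyIntegrable f ∧ ∀ φ : Sigma1 d,
    Integrable (fun x => f x * φ.toFun x) ∧ u φ = ∫ x, f x * φ.toFun x

end

open scoped BoundedContinuousFunction

noncomputable section

/-! ### The weight `‖x‖ ^ (1 / s)` -/

/-! Both cases go through (b), with explicit control of the parameter `h` in each implication, so
the Roumieu and Beurling statements follow from the same estimates. In (b), `f` and its transform
are integrable, so `f` may be replaced by its continuous version `𝓕⁻ (𝓕 f)`; `GevreyDecay` is the
resulting condition. The weight `‖x‖ ^ (1 / s)` is subadditive, hence decay survives convolution.

(a) to (b): the bounds `‖x‖^m |f(x)| ≤ C H^m m!^s` for all `m` sum, after taking `s`-th roots, to an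
exponential bound (`mul_exp_rpow_le_of_forall_pow`). On the Fourier side the bounds on `∂_k^n f`,
integrated, play the role of the moments.

(b) to (a) and (c): for a window in `Σ_1`, the short-time Fourier transform of `f` decays in `x`
(estimate by the L¹ norm) and in `ξ` (convolution of transforms). The geometric mean of the two
bounds decays in both variables (`GevreyDecay.norm_fourier_mul_translate_le`). Integrating its
square gives (c). With a Gaussian window, Fourier inversion bounds all derivatives of the
localization of `f` at `x`. Dividing by the Gaussian costs `n! (2π)^n`, which `n!^s` absorbs because
`s > 1` (`GevreyDecay.norm_iteratedFDeriv_le`).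

(c) to (b): a functional in `Σ_1'` extends by Hahn-Banach to a Banach space in which the inversion
formula of the short-time Fourier transform is a Bochner integral, so the formula holds in the dual
(`integral_synthesisCoeff_mul_stft`). Weighted Cauchy-Schwarz then bounds `û(χ)` by the L² norm of
`e^{-h‖·‖^{1/s}} χ`, and Riesz gives `û = g e^{-h‖·‖^{1/s}}` with `g ∈ L²`. The same applies to the
transform of `û`. Finally, a Lipschitz function of this form decays pointwise, at the rate
`2h/(d+2)` (`weightBound_of_lipschitz_of_memLp`). -/

theorem norm_rpow_le_add {E : Type*} [NormedAddCommGroup E] {s : ℝ} (hs : 1 ≤ s) (x y : E) :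
    ‖x‖ ^ (1 / s) ≤ ‖x - y‖ ^ (1 / s) + ‖y‖ ^ (1 / s) := by
  have h0 : 0 ≤ 1 / s := by positivity
  have h1 : 1 / s ≤ 1 := by rw [div_le_one (by linarith)]; exact hs
  calc ‖x‖ ^ (1 / s) ≤ (‖x - y‖ + ‖y‖) ^ (1 / s) := by
        gcongr
        simpa using norm_add_le (x - y) y
    _ ≤ _ := Real.rpow_add_le_add_rpow (norm_nonneg _) (norm_nonneg _) h0 h1

theorem rpow_inv_le_one_add {s t : ℝ} (hs : 1 ≤ s) (ht : 0 ≤ t) : t ^ (1 / s) ≤ 1 + t := by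
  have h0 : 0 ≤ 1 / s := by positivity
  have h1 : 1 / s ≤ 1 := by rw [div_le_one (by linarith)]; exact hs
  calc t ^ (1 / s) ≤ (1 + t) ^ (1 / s) := by gcongr; linarith
    _ ≤ (1 + t) ^ (1 : ℝ) := Real.rpow_le_rpow_of_exponent_le (by linarith) h1
    _ = 1 + t := Real.rpow_one _

theorem continuous_norm_rpow {E : Type*} [NormedAddCommGroup E] {s : ℝ} (hs : 1 ≤ s) :
    Continuous fun x : E => ‖x‖ ^ (1 / s) :=
  continuous_norm.rpow_const fun _ => Or.inr (by positivity)

/-- This is `y^m ≤ m! e^y` at `y = k t^{1/s}`, raised to the power `s`. The free parameter `k`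
decides how much exponential decay is spent on a moment. -/
theorem pow_le_factorial_rpow_mul_exp {s t k : ℝ} (hs : 1 ≤ s) (ht : 0 ≤ t) (hk : 0 < k) (m : ℕ) :
    t ^ m ≤ (k ^ (-s)) ^ m * (m.factorial : ℝ) ^ s * Real.exp (s * k * t ^ (1 / s)) := by
  have hs0 : s ≠ 0 := by positivity
  have h0 : 0 ≤ t ^ (1 / s) := by positivity
  have h1 := Real.pow_div_factorial_le_exp (k * t ^ (1 / s)) (by positivity) m
  rw [div_le_iff₀ (by positivity)] at h1
  have h2 : ((k * t ^ (1 / s)) ^ m) ^ s ≤ (Real.exp (k * t ^ (1 / s)) * m.factorial) ^ s := by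
    gcongr
  rw [mul_pow, Real.mul_rpow (by positivity) (by positivity),
    Real.mul_rpow (by positivity) (by positivity), ← Real.exp_mul] at h2
  have h3 : ((t ^ (1 / s)) ^ m) ^ s = t ^ m := by
    rw [← Real.rpow_natCast, ← Real.rpow_mul h0, ← Real.rpow_mul ht, ← Real.rpow_natCast]
    congr 1
    field_simp
  have h4 : (k ^ (-s)) ^ m * (k ^ m) ^ s = 1 := by
    rw [← Real.rpow_natCast, ← Real.rpow_natCast, ← Real.rpow_mul hk.le, ← Real.rpow_mul hk.le,
      ← Real.rpow_add hk]
    ring_nf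
    exact Real.rpow_zero k
  rw [h3] at h2
  calc t ^ m = (k ^ (-s)) ^ m * ((k ^ m) ^ s * t ^ m) := by rw [← mul_assoc, h4, one_mul]
    _ ≤ (k ^ (-s)) ^ m * (Real.exp (k * t ^ (1 / s) * s) * (m.factorial : ℝ) ^ s) := by gcongr
    _ = _ := by ring_nf

theorem integrable_pow_mul_exp_neg_rpow {d : ℕ} {s h : ℝ} (hs : 1 ≤ s) (hh : 0 < h) (n : ℕ) :
    Integrable fun x : Rd d => ‖x‖ ^ n * Real.exp (-h * ‖x‖ ^ (1 / s)) := by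
  have hint : Integrable (fun v : Rd d => (1 + ‖v‖) ^ (-((d + 1 : ℕ) : ℝ))) := by
    apply integrable_one_add_norm
    simp
  have hc : Continuous fun x : Rd d => ‖x‖ ^ (1 / s) := continuous_norm_rpow hs
  set m := n + d + 1
  set k := h / s
  have hk : 0 < k := by positivity
  set A := (k ^ (-s)) ^ m * (m.factorial : ℝ) ^ s * Real.exp h
  refine (hint.const_mul A).mono' (by fun_prop) (Filter.Eventually.of_forall fun v => ?_)
  have h0 : (0 : ℝ) < 1 + ‖v‖ := by positivity
  rw [Real.rpow_neg h0.le, Real.rpow_natCast, ← div_eq_mul_inv, le_div_iff₀ (by positivity),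
    Real.norm_of_nonneg (by positivity)]
  have h1 := pow_le_factorial_rpow_mul_exp hs h0.le hk m
  -- The choice `k = h / s` makes the exponential factor from the moment bound cancel the weight
  -- exactly.
  have hsk : s * k = h := by simp only [k]; field_simp
  have h2 : (1 + ‖v‖) ^ (1 / s) ≤ 1 + ‖v‖ ^ (1 / s) := by
    have := Real.rpow_add_le_add_rpow (p := 1 / s) zero_le_one (norm_nonneg v) (by positivity)
      (by rw [div_le_one (by linarith)]; exact hs)
    simpa using this
  rw [hsk] at h1
  have hle : Real.exp (h * (1 + ‖v‖) ^ (1 / s)) ≤ Real.exp h * Real.exp (h * ‖v‖ ^ (1 / s)) := by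
    rw [← Real.exp_add]
    gcongr
    nlinarith
  have hone : Real.exp (h * ‖v‖ ^ (1 / s)) * Real.exp (-h * ‖v‖ ^ (1 / s)) = 1 := by
    rw [← Real.exp_add]; simp
  calc ‖v‖ ^ n * Real.exp (-h * ‖v‖ ^ (1 / s)) * (1 + ‖v‖) ^ (d + 1)
      ≤ (1 + ‖v‖) ^ n * Real.exp (-h * ‖v‖ ^ (1 / s)) * (1 + ‖v‖) ^ (d + 1) := by
        gcongr
        linarith
    _ = (1 + ‖v‖) ^ m * Real.exp (-h * ‖v‖ ^ (1 / s)) := by simp only [m]; ring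
    _ ≤ ((k ^ (-s)) ^ m * (m.factorial : ℝ) ^ s *
          (Real.exp h * Real.exp (h * ‖v‖ ^ (1 / s)))) * Real.exp (-h * ‖v‖ ^ (1 / s)) := by
        gcongr
        exact h1.trans (by gcongr)
    _ = A * (Real.exp (h * ‖v‖ ^ (1 / s)) * Real.exp (-h * ‖v‖ ^ (1 / s))) := by
        simp only [A]; ring
    _ = A := by rw [hone, mul_one]

theorem integrable_exp_neg_rpow {d : ℕ} {s h : ℝ} (hs : 1 ≤ s) (hh : 0 < h) :
    Integrable fun x : Rd d => Real.exp (-h * ‖x‖ ^ (1 / s)) := by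
  simpa using integrable_pow_mul_exp_neg_rpow (d := d) hs hh 0

theorem WeightBound.exists_norm_le {d : ℕ} {s h : ℝ} {f : Rd d → ℂ} (hf : WeightBound s h f) :
    ∃ C : ℝ, 0 < C ∧ ∀ x, ‖f x‖ ≤ C * Real.exp (-h * ‖x‖ ^ (1 / s)) := by
  obtain ⟨C, hC⟩ := hf
  refine ⟨max C 1, by positivity, fun x => ?_⟩
  rw [neg_mul, Real.exp_neg, ← div_eq_mul_inv, le_div_iff₀ (by positivity)]
  exact (hC x).trans (le_max_left _ _)

theorem WeightBound.of_norm_le {d : ℕ} {s h C : ℝ} {f : Rd d → ℂ}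
    (hf : ∀ x, ‖f x‖ ≤ C * Real.exp (-h * ‖x‖ ^ (1 / s))) : WeightBound s h f := by
  refine ⟨C, fun x => ?_⟩
  have := hf x
  rwa [neg_mul, Real.exp_neg, ← div_eq_mul_inv, le_div_iff₀ (by positivity)] at this

theorem ExpBound.exists_norm_le {d : ℕ} {h : ℝ} {f : Rd d → ℂ} (hf : ExpBound h f) :
    ∃ C : ℝ, 0 < C ∧ ∀ x, ‖f x‖ ≤ C * Real.exp (-h * ‖x‖) := by
  obtain ⟨C, hC⟩ := hf
  refine ⟨max C 1, by positivity, fun x => ?_⟩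
  rw [neg_mul, Real.exp_neg, ← div_eq_mul_inv, le_div_iff₀ (by positivity)]
  exact (hC x).trans (le_max_left _ _)

theorem ExpBound.weightBound {d : ℕ} {s h : ℝ} {f : Rd d → ℂ} (hs : 1 ≤ s) (hh : 0 < h)
    (hf : ExpBound h f) : WeightBound s h f := by
  obtain ⟨C, hC0, hC⟩ := hf.exists_norm_le
  refine WeightBound.of_norm_le (C := C * Real.exp h) fun x => (hC x).trans ?_
  rw [mul_assoc, ← Real.exp_add]
  gcongr
  have := rpow_inv_le_one_add hs (norm_nonneg x)
  nlinarith

theorem WeightBound.integrable_pow {d : ℕ} {s h : ℝ} {f : Rd d → ℂ} (hs : 1 ≤ s) (hh : 0 < h)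
    (hm : AEStronglyMeasurable f) (hf : WeightBound s h f) (n : ℕ) :
    Integrable fun v => ‖v‖ ^ n * ‖f v‖ := by
  obtain ⟨C, hC0, hC⟩ := hf.exists_norm_le
  refine ((integrable_pow_mul_exp_neg_rpow hs hh n).const_mul C).mono'
    ((by fun_prop : Continuous fun v : Rd d => ‖v‖ ^ n).aestronglyMeasurable.mul hm.norm)
    (Filter.Eventually.of_forall fun v => ?_)
  rw [Real.norm_of_nonneg (by positivity)]
  calc ‖v‖ ^ n * ‖f v‖ ≤ ‖v‖ ^ n * (C * Real.exp (-h * ‖v‖ ^ (1 / s))) := by gcongr; exact hC v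
    _ = _ := by ring

theorem WeightBound.integrable {d : ℕ} {s h : ℝ} {f : Rd d → ℂ} (hs : 1 ≤ s) (hh : 0 < h)
    (hm : AEStronglyMeasurable f) (hf : WeightBound s h f) : Integrable f := by
  have := hf.integrable_pow hs hh hm 0
  simp only [pow_zero, one_mul] at this
  exact (integrable_norm_iff hm).1 this

/-! ### Fourier analysis of integrable functions -/

theorem continuous_fourier_of_integrable {d : ℕ} {f : Rd d → ℂ} (hf : Integrable f) :
    Continuous (𝓕 f) :=
  VectorFourier.fourierIntegral_continuous (L := innerₗ (Rd d)) Real.continuous_fourierChar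
    continuous_inner hf

theorem continuous_fourierInv_of_integrable {d : ℕ} {f : Rd d → ℂ} (hf : Integrable f) :
    Continuous (𝓕⁻ f) := by
  rw [Real.fourierInv_eq_fourier_comp_neg]
  exact continuous_fourier_of_integrable hf.comp_neg

theorem integral_fourier_mul {d : ℕ} {f g : Rd d → ℂ} (hf : Integrable f) (hg : Integrable g) :
    ∫ ξ, 𝓕 f ξ * g ξ = ∫ x, f x * 𝓕 g x := by
  have := VectorFourier.integral_fourierIntegral_smul_eq_flip (L := innerₗ (Rd d))
      Real.continuous_fourierChar continuous_inner hf hg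
  rwa [flip_innerₗ] at this

theorem integral_fourierInv_mul {d : ℕ} {f g : Rd d → ℂ} (hf : Integrable f)
    (hg : Integrable g) : ∫ ξ, 𝓕⁻ f ξ * g ξ = ∫ x, f x * 𝓕⁻ g x := by
  rw [Real.fourierInv_eq_fourier_comp_neg f, integral_fourier_mul hf.comp_neg hg,
    ← integral_neg_eq_self]
  simp only [neg_neg, Real.fourierInv_eq_fourier_neg]

theorem norm_fourier_le_integral {d : ℕ} (f : Rd d → ℂ) (ξ : Rd d) : ‖𝓕 f ξ‖ ≤ ∫ x, ‖f x‖ :=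
  VectorFourier.norm_fourierIntegral_le_integral_norm _ _ _ f ξ

/-- A smooth compactly supported `g` is the Fourier transform of a Schwartz function, so moving the
transform across turns `∫ f g` into an integral against `𝓕 f = 0`. -/
theorem ae_eq_zero_of_fourier_eq_zero {d : ℕ} {f : Rd d → ℂ} (hf : Integrable f)
    (h : 𝓕 f = 0) : f =ᵐ[volume] 0 := by
  refine ae_eq_zero_of_integral_contDiff_smul_eq_zero hf.locallyIntegrable fun g hg hgs => ?_
  have hg' : ContDiff ℝ ∞ fun x => (g x : ℂ) := Complex.ofRealCLM.contDiff.comp hg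
  have hs' : HasCompactSupport fun x => (g x : ℂ) := hgs.comp_left (g := fun t : ℝ => (t : ℂ)) rfl
  set G : SchwartzMap (Rd d) ℂ := hs'.toSchwartzMap hg'
  have hG : (G : Rd d → ℂ) = 𝓕 ((𝓕⁻ G : SchwartzMap (Rd d) ℂ) : Rd d → ℂ) := by
    rw [← SchwartzMap.fourier_coe, FourierTransform.fourier_fourierInv_eq]
  have h1 := integral_fourier_mul hf (𝓕⁻ G : SchwartzMap (Rd d) ℂ).integrable
  rw [← hG, h] at h1
  simp only [Pi.zero_apply, zero_mul, integral_zero] at h1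
  rw [h1]
  congr 1
  ext x
  rw [mul_comm]
  simp [G]

/-! ### Test functions in `Σ_1` and uniqueness of representing functions -/

theorem IsSigma1.continuous {d : ℕ} {f : Rd d → ℂ} (hf : IsSigma1 f) : Continuous f :=
  hf.1.continuous

theorem Sigma1.continuous {d : ℕ} (φ : Sigma1 d) : Continuous φ.toFun := φ.isSigma1.continuous

theorem Sigma1.conjShift_apply {d : ℕ} (x ξ : Rd d) (φ : Sigma1 d) (y : Rd d) :
    (φ.conjShift x ξ).toFun y = Complex.exp ((-2 * π * ⟪y, ξ⟫_ℝ : ℝ) * Complex.I) *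
      starRingEnd ℂ (φ.toFun (y - x)) := by
  change starRingEnd ℂ (modulation ξ (_root_.translation x φ.toFun) y) = _
  simp only [modulation, _root_.translation, map_mul, ← Complex.exp_conj, Complex.conj_I,
    Complex.conj_ofReal, real_inner_comm ξ y]
  congr 2
  push_cast
  simp only [map_ofNat]
  ring

theorem integral_mul_conjShift {d : ℕ} (f : Rd d → ℂ) (x ξ : Rd d) (φ : Sigma1 d) :
    ∫ y, f y * (φ.conjShift x ξ).toFun y =
      𝓕 (fun y => f y * starRingEnd ℂ (φ.toFun (y - x))) ξ := by
  rw [Real.fourier_eq']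
  congr 1
  ext y
  rw [φ.conjShift_apply, smul_eq_mul]
  ring

theorem Sigma1.exists_ne_zero {d : ℕ} {φ : Sigma1 d} (hφ : φ ≠ 0) : ∃ y, φ.toFun y ≠ 0 := by
  by_contra! h
  exact hφ (Subtype.ext (funext h))

/-- For `d ≥ 1`, nonzero elements of `Σ_1` are never compactly supported, so bump functions cannot
serve as tests. Instead, pairing with all modulations of a translated window shows that `(f - g)`
times that window has zero Fourier transform. Translates of a nonzero window have no common zero. -/
theorem Represents.ae_eq {d : ℕ} {φ : Sigma1 d} (hφ : φ ≠ 0) {u : Sigma1Dual d}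
    {f g : Rd d → ℂ} (hf : Represents f u) (hg : Represents g u) : f =ᵐ[volume] g := by
  obtain ⟨y₀, hy₀⟩ := φ.exists_ne_zero hφ
  have key : ∀ x, ∀ᵐ y, (f y - g y) * starRingEnd ℂ (φ.toFun (y - x)) = 0 := by
    intro x
    have hrew : ∀ k : Rd d → ℂ, (fun y => k y * starRingEnd ℂ (φ.toFun (y - x))) =
        fun y => k y * (φ.conjShift x 0).toFun y := by
      intro k
      ext y
      simp [φ.conjShift_apply]
    refine ae_eq_zero_of_fourier_eq_zero ?_ ?_
    · rw [hrew fun y => f y - g y]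
      simp only [sub_mul]
      exact (hf.2 _).1.sub (hg.2 _).1
    · ext ξ
      rw [← integral_mul_conjShift]
      simp only [sub_mul]
      rw [integral_sub (hf.2 _).1 (hg.2 _).1, ← (hf.2 _).2, ← (hg.2 _).2, sub_self]
      rfl
  have hnull : volume {y | ¬ f y = g y} = 0 := by
    -- The translate by `z - y₀` moves the point `y₀`, where the window is nonzero, to `z`.
    refine measure_null_of_locally_null _ fun z _ => ?_
    have hc : ContinuousAt (fun y => φ.toFun (y - (z - y₀))) z :=
      (φ.continuous.comp (continuous_id.sub continuous_const)).continuousAt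
    have hne : ∀ᶠ y in nhds z, φ.toFun (y - (z - y₀)) ≠ 0 :=
      hc.eventually_ne (by simpa using hy₀)
    refine ⟨_, Filter.inter_mem (nhdsWithin_le_nhds hne) self_mem_nhdsWithin, ?_⟩
    refine measure_mono_null ?_ (key (z - y₀))
    rintro y ⟨hy1, hy2⟩ h0
    rcases mul_eq_zero.1 h0 with h | h
    · exact hy2 (sub_eq_zero.1 h)
    · exact hy1 (by simpa using h)
  exact hnull

theorem Sigma1.integrable {d : ℕ} (φ : Sigma1 d) : Integrable φ.toFun := φ.isSigma1.integrable

theorem Sigma1.integrable_bdd_mul {d : ℕ} (φ : Sigma1 d) {f : Rd d → ℂ} {C : ℝ}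
    (hf : Continuous f) (hC : ∀ x, ‖f x‖ ≤ C) : Integrable fun x => f x * φ.toFun x :=
  φ.integrable.bdd_mul (c := C) hf.aestronglyMeasurable (Filter.Eventually.of_forall hC)

/-- The inverse Fourier transform of a test function. -/
def Sigma1.fourierInv {d : ℕ} (φ : Sigma1 d) : Sigma1 d :=
  ⟨𝓕⁻ φ.toFun, by
    have h := φ.isSigma1.fourier
    have he : 𝓕⁻ φ.toFun = fun x => 𝓕 φ.toFun (-x) :=
      funext fun x => Real.fourierInv_eq_fourier_neg _ _
    have hF : 𝓕 (𝓕⁻ φ.toFun) = φ.toFun :=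
      φ.continuous.fourier_fourierInv_eq φ.integrable h.integrable
    refine ⟨?_, fun r hr => ⟨?_, ?_⟩⟩
    · rw [he]
      exact h.1.comp contDiff_neg
    · exact (h.2 r hr).1.reflect fun x => by rw [he]
    · rw [hF]
      exact (φ.isSigma1.2 r hr).1⟩

theorem Sigma1.toFun_fourierInv {d : ℕ} (φ : Sigma1 d) : φ.fourierInv.toFun = 𝓕⁻ φ.toFun := rfl

theorem Sigma1.fourier_fourierInv {d : ℕ} (φ : Sigma1 d) :
    Sigma1.fourier d φ.fourierInv = φ :=
  Subtype.ext (φ.continuous.fourier_fourierInv_eq φ.integrable φ.isSigma1.fourier.integrable)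

/-! ### Representing functions under the Fourier transform. -/

theorem represents_of_bounded {d : ℕ} {u : Sigma1Dual d} {f : Rd d → ℂ} {C : ℝ}
    (hf : Continuous f) (hC : ∀ x, ‖f x‖ ≤ C) (h : ∀ ψ : Sigma1 d, u ψ = ∫ x, f x * ψ.toFun x) :
    Represents f u :=
  ⟨hf.locallyIntegrable, fun ψ => ⟨ψ.integrable_bdd_mul hf hC, h ψ⟩⟩

/-- The Fourier transform of an integrable function represents the Fourier transform of the
dual element. -/
theorem Represents.fourier {d : ℕ} {u : Sigma1Dual d} {f : Rd d → ℂ} (hf : Represents f u)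
    (hi : Integrable f) : Represents (𝓕 f) u.fourier :=
  represents_of_bounded (continuous_fourier_of_integrable hi) (norm_fourier_le_integral f)
    fun ψ => by
      rw [integral_fourier_mul hi ψ.integrable]
      exact (hf.2 _).2

theorem Represents.fourierInv {d : ℕ} {u : Sigma1Dual d} {F : Rd d → ℂ}
    (hF : Represents F u.fourier) (hi : Integrable F) : Represents (𝓕⁻ F) u :=
  represents_of_bounded (continuous_fourierInv_of_integrable hi)
    (fun x => by
      rw [Real.fourierInv_eq_fourier_neg]
      exact norm_fourier_le_integral F (-x)) fun ψ => by
      rw [integral_fourierInv_mul hi ψ.integrable, ← ψ.toFun_fourierInv, ← (hF.2 _).2]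
      change u ψ = u (Sigma1.fourier d ψ.fourierInv)
      rw [ψ.fourier_fourierInv]

/-! ### Continuous representatives with decay on both sides. -/

theorem le_of_ae_le_of_continuous {d : ℕ} {f g : Rd d → ℝ} (hf : Continuous f)
    (hg : Continuous g) (h : ∀ᵐ x, f x ≤ g x) (x : Rd d) : f x ≤ g x := by
  have hd : Dense {x | f x ≤ g x} := by
    rw [← compl_compl {x | f x ≤ g x}, ← interior_eq_empty_iff_dense_compl]
    exact Measure.interior_eq_empty_of_null (μ := volume) h
  have hc : IsClosed {x | f x ≤ g x} := isClosed_le hf hg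
  have := hd.closure_eq
  rw [hc.closure_eq] at this
  exact (this.symm ▸ Set.mem_univ x : x ∈ {x | f x ≤ g x})

/-- A continuous function that, together with its Fourier transform, is bounded by a multiple
of `e^{-h ‖x‖ ^ (1 / s)}`. -/
structure GevreyDecay {d : ℕ} (s h : ℝ) (f : Rd d → ℂ) : Prop where
  continuous : Continuous f
  weightBound : WeightBound s h f
  weightBound_fourier : WeightBound s h (𝓕 f)

theorem Represents.fourierInv_fourier_ae_eq {d : ℕ} {φ : Sigma1 d} (hφ : φ ≠ 0)
    {u : Sigma1Dual d} {f : Rd d → ℂ} (hf : Represents f u) (hi : Integrable f)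
    (hi' : Integrable (𝓕 f)) : Represents (𝓕⁻ (𝓕 f)) u ∧ 𝓕⁻ (𝓕 f) =ᵐ[volume] f := by
  have h := (hf.fourier hi).fourierInv hi'
  exact ⟨h, h.ae_eq hφ hf⟩

/-- The witness `𝓕⁻ (𝓕 f)` does not depend on `h`; the Beurling case relies on this. -/
theorem Represents.gevreyDecay {d : ℕ} {φ : Sigma1 d} (hφ : φ ≠ 0) {s h : ℝ} (hs : 1 ≤ s)
    (hh : 0 < h) {u : Sigma1Dual d} {f : Rd d → ℂ} (hf : Represents f u)
    (hf1 : WeightBound s h f) (hf2 : WeightBound s h (𝓕 f)) :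
    Represents (𝓕⁻ (𝓕 f)) u ∧ GevreyDecay s h (𝓕⁻ (𝓕 f)) := by
  have hi : Integrable f := hf1.integrable hs hh hf.1.aestronglyMeasurable
  have hi' : Integrable (𝓕 f) :=
    hf2.integrable hs hh (continuous_fourier_of_integrable hi).aestronglyMeasurable
  obtain ⟨h1, h2⟩ := hf.fourierInv_fourier_ae_eq hφ hi hi'
  have hc := continuous_fourierInv_of_integrable hi'
  refine ⟨h1, hc, ?_, ?_⟩
  · obtain ⟨C, hC⟩ := hf1
    refine ⟨C, le_of_ae_le_of_continuous
      (hc.norm.mul (Real.continuous_exp.comp (continuous_const.mul (continuous_norm_rpow hs))))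
      continuous_const ?_⟩
    filter_upwards [h2] with x hx
    simpa [hx] using hC x
  · rwa [show 𝓕 (𝓕⁻ (𝓕 f)) = 𝓕 f from funext fun ξ => Real.fourier_congr_ae h2 ξ]

theorem GevreyDecay.integrable {d : ℕ} {s h : ℝ} (hs : 1 ≤ s) (hh : 0 < h) {f : Rd d → ℂ}
    (hf : GevreyDecay s h f) : Integrable f :=
  hf.weightBound.integrable hs hh hf.continuous.aestronglyMeasurable

theorem GevreyDecay.integrable_fourier {d : ℕ} {s h : ℝ} (hs : 1 ≤ s) (hh : 0 < h)
    {f : Rd d → ℂ} (hf : GevreyDecay s h f) : Integrable (𝓕 f) :=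
  hf.weightBound_fourier.integrable hs hh
    (continuous_fourier_of_integrable (hf.integrable hs hh)).aestronglyMeasurable

theorem GevreyDecay.fourierInv_fourier {d : ℕ} {s h : ℝ} (hs : 1 ≤ s) (hh : 0 < h)
    {f : Rd d → ℂ} (hf : GevreyDecay s h f) : 𝓕⁻ (𝓕 f) = f :=
  hf.continuous.fourierInv_fourier_eq (hf.integrable hs hh) (hf.integrable_fourier hs hh)

theorem GevreyDecay.fourier {d : ℕ} {s h : ℝ} (hs : 1 ≤ s) (hh : 0 < h)
    {f : Rd d → ℂ} (hf : GevreyDecay s h f) : GevreyDecay s h (𝓕 f) := by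
  refine ⟨continuous_fourier_of_integrable (hf.integrable hs hh), hf.weightBound_fourier, ?_⟩
  obtain ⟨C, hC⟩ := hf.weightBound
  refine ⟨C, fun x => ?_⟩
  have := congrFun (hf.fourierInv_fourier hs hh) (-x)
  rw [Real.fourierInv_eq_fourier_neg, neg_neg] at this
  rw [this, ← norm_neg x]
  exact hC _

/-! ### Decay of the short-time Fourier transform -/

/-- By subadditivity, `e^{-h‖y‖^{1/s}} e^{-h‖y-x‖^{1/s}} ≤ e^{-h‖x‖^{1/s}}`. The surplus 1 in the
rate of `G` leaves an integrable factor. -/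
theorem WeightBound.integral_mul_translate_le {d : ℕ} {s h : ℝ} (hs : 1 ≤ s) (hh : 0 < h)
    {F G : Rd d → ℂ} (hF : WeightBound s h F) (hG : WeightBound s (h + 1) G) :
    ∃ C : ℝ, 0 < C ∧ ∀ x, ∫ y, ‖F y‖ * ‖G (y - x)‖ ≤ C * Real.exp (-h * ‖x‖ ^ (1 / s)) := by
  obtain ⟨A, hA0, hA⟩ := hF.exists_norm_le
  obtain ⟨B, hB0, hB⟩ := hG.exists_norm_le
  have hi := integrable_exp_neg_rpow (d := d) hs one_pos
  set K := ∫ y : Rd d, Real.exp (-1 * ‖y‖ ^ (1 / s))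
  have hK : 0 ≤ K := integral_nonneg fun _ => (Real.exp_pos _).le
  refine ⟨A * B * (K + 1), by positivity, fun x => ?_⟩
  calc ∫ y, ‖F y‖ * ‖G (y - x)‖
      ≤ ∫ y, A * B * Real.exp (-h * ‖x‖ ^ (1 / s)) * Real.exp (-1 * ‖y - x‖ ^ (1 / s)) := by
        refine integral_mono_of_nonneg (Filter.Eventually.of_forall fun y => by positivity)
          ((hi.comp_sub_right x).const_mul _) (Filter.Eventually.of_forall fun y => ?_)
        have h1 := norm_rpow_le_add hs x y
        rw [norm_sub_rev] at h1
        calc ‖F y‖ * ‖G (y - x)‖ ≤ (A * Real.exp (-h * ‖y‖ ^ (1 / s))) *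
              (B * Real.exp (-(h + 1) * ‖y - x‖ ^ (1 / s))) :=
              mul_le_mul (hA y) (hB _) (norm_nonneg _) (by positivity)
          _ = A * B * Real.exp (-h * (‖y‖ ^ (1 / s) + ‖y - x‖ ^ (1 / s))) *
              Real.exp (-1 * ‖y - x‖ ^ (1 / s)) := by
              rw [mul_assoc (A * B), ← Real.exp_add, mul_mul_mul_comm, ← Real.exp_add]
              ring_nf
          _ ≤ _ := mul_le_mul_of_nonneg_right (mul_le_mul_of_nonneg_left
              (Real.exp_le_exp.2 (by nlinarith)) (by positivity)) (Real.exp_pos _).le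
    _ = A * B * K * Real.exp (-h * ‖x‖ ^ (1 / s)) := by
        rw [integral_const_mul, integral_sub_right_eq_self
          (fun y : Rd d => Real.exp (-1 * ‖y‖ ^ (1 / s)))]
        ring
    _ ≤ _ := by gcongr; linarith

theorem fourierInv_exp_mul {d : ℕ} (g : Rd d → ℂ) (ξ η : Rd d) :
    𝓕⁻ (fun y => Complex.exp ((-2 * π * ⟪y, ξ⟫_ℝ : ℝ) * Complex.I) * g y) η = 𝓕 g (ξ - η) := by
  rw [Real.fourierInv_eq', Real.fourier_eq']
  congr 1
  ext y
  rw [smul_eq_mul, smul_eq_mul, ← mul_assoc, ← Complex.exp_add, inner_sub_right]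
  congr 2
  push_cast
  ring

theorem fourier_fourierInv_mul {d : ℕ} {F g : Rd d → ℂ} (hF : Integrable F) (hg : Integrable g)
    (ξ : Rd d) : 𝓕 (fun y => 𝓕⁻ F y * g y) ξ = ∫ η, F η * 𝓕 g (ξ - η) := by
  have h1 : Integrable fun y =>
      Complex.exp ((-2 * π * ⟪y, ξ⟫_ℝ : ℝ) * Complex.I) * g y := by
    refine hg.bdd_mul (c := 1) (Continuous.aestronglyMeasurable (by fun_prop))
      (Filter.Eventually.of_forall fun y => (Complex.norm_exp_ofReal_mul_I _).le)
  have h2 := integral_fourierInv_mul hF h1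
  simp only [fourierInv_exp_mul] at h2
  rw [← h2, Real.fourier_eq']
  congr 1
  ext y
  rw [smul_eq_mul]
  ring

theorem IsSigma1.weightBound {d : ℕ} {s h : ℝ} (hs : 1 ≤ s) (hh : 0 < h) {g : Rd d → ℂ}
    (hg : IsSigma1 g) : WeightBound s h g := (hg.2 h hh).1.weightBound hs hh

theorem GevreyDecay.norm_fourier_mul_translate_le {d : ℕ} {s h : ℝ} (hs : 1 ≤ s) (hh : 0 < h)
    {f g : Rd d → ℂ} (hf : GevreyDecay s h f) (hg : IsSigma1 g) :
    ∃ C : ℝ, 0 < C ∧ ∀ x ξ, ‖𝓕 (fun y => f y * g (y - x)) ξ‖ ≤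
      C * Real.exp (-(h / 2) * ‖x‖ ^ (1 / s)) * Real.exp (-(h / 2) * ‖ξ‖ ^ (1 / s)) := by
  obtain ⟨A, hA0, hA⟩ := hf.weightBound.integral_mul_translate_le hs hh
    (hg.weightBound hs (by linarith : 0 < h + 1))
  obtain ⟨B, hB0, hB⟩ := hf.weightBound_fourier.integral_mul_translate_le hs hh
    (G := fun t => 𝓕 g (-t)) (by
      obtain ⟨C, hC⟩ := hg.fourier.weightBound hs (by linarith : 0 < h + 1)
      exact ⟨C, fun x => by simpa using hC (-x)⟩)
  refine ⟨max A B, by positivity, fun x ξ => ?_⟩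
  set V := ‖𝓕 (fun y => f y * g (y - x)) ξ‖
  have h1 : V ≤ max A B * Real.exp (-h * ‖x‖ ^ (1 / s)) := by
    refine (norm_fourier_le_integral _ _).trans ?_
    simp only [norm_mul]
    refine (hA x).trans ?_
    gcongr
    exact le_max_left _ _
  have h2 : V ≤ max A B * Real.exp (-h * ‖ξ‖ ^ (1 / s)) := by
    have hgx : Integrable fun y => g (y - x) := hg.integrable.comp_sub_right x
    have h3 := fourier_fourierInv_mul (hf.integrable_fourier hs hh) hgx ξ
    rw [hf.fourierInv_fourier hs hh] at h3
    have h4 : ∀ η, ‖𝓕 f η * 𝓕 (fun y => g (y - x)) (ξ - η)‖ = ‖𝓕 f η‖ * ‖𝓕 g (-(η - ξ))‖ := by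
      intro η
      rw [norm_mul, neg_sub]
      congr 1
      exact norm_fourier_translation x g _
    calc V = ‖∫ η, 𝓕 f η * 𝓕 (fun y => g (y - x)) (ξ - η)‖ := by rw [← h3]
      _ ≤ ∫ η, ‖𝓕 f η‖ * ‖𝓕 g (-(η - ξ))‖ := by
          simp only [← h4]
          exact norm_integral_le_integral_norm _
      _ ≤ B * Real.exp (-h * ‖ξ‖ ^ (1 / s)) := hB ξ
      _ ≤ _ := by gcongr; exact le_max_right _ _
  -- Multiplying the bound in `x` by the bound in `ξ` and taking the square root halves both rates.
  refine le_of_sq_le_sq ?_ (by positivity)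
  calc V ^ 2 = V * V := sq V
    _ ≤ (max A B * Real.exp (-h * ‖x‖ ^ (1 / s))) * (max A B * Real.exp (-h * ‖ξ‖ ^ (1 / s))) :=
        mul_le_mul h1 h2 (norm_nonneg _) (by positivity)
    _ = _ := by
        rw [mul_pow, mul_pow, ← Real.exp_nat_mul, ← Real.exp_nat_mul]
        push_cast
        ring_nf

theorem Represents.stft_eq {d : ℕ} {u : Sigma1Dual d} {f : Rd d → ℂ} (hf : Represents f u)
    (φ : Sigma1 d) (x ξ : Rd d) :
    stft φ u x ξ = 𝓕 (fun y => f y * starRingEnd ℂ (φ.toFun (y - x))) ξ := by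
  rw [← integral_mul_conjShift]
  exact (hf.2 _).2

/-- The squared transform decays at rate `h` in each variable. The weight with parameter `h / 4`
grows at rate `h / 2`, so `e^{-(h/2)‖ξ‖^{1/s}}` remains to be integrated. -/
theorem GevreyDecay.mem_coorbit {d : ℕ} {s h : ℝ} (hs : 1 ≤ s) (hh : 0 < h) {f : Rd d → ℂ}
    (hf : GevreyDecay s h f) {u : Sigma1Dual d} (hu : Represents f u) (φ : Sigma1 d) :
    u ∈ coorbit φ (h / 4) s := by
  obtain ⟨C, hC0, hC⟩ := hf.norm_fourier_mul_translate_le hs hh φ.isSigma1.conj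
  have hfin : ∀ r : ℝ, 0 < r →
      ∫⁻ x : Rd d, ENNReal.ofReal (Real.exp (-r * ‖x‖ ^ (1 / s))) < ⊤ := fun r hr =>
    (integrable_exp_neg_rpow hs hr).lintegral_lt_top
  have hx : ∀ ξ : Rd d, ∫⁻ x : Rd d, ‖stft φ u x ξ‖ₑ ^ 2 ≤
      ENNReal.ofReal (C ^ 2 * Real.exp (-h * ‖ξ‖ ^ (1 / s))) *
        ∫⁻ x : Rd d, ENNReal.ofReal (Real.exp (-h * ‖x‖ ^ (1 / s))) := by
    intro ξ
    rw [← lintegral_const_mul' _ _ ENNReal.ofReal_ne_top]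
    refine lintegral_mono fun x => ?_
    rw [hu.stft_eq, ← ofReal_norm, ← ENNReal.ofReal_pow (norm_nonneg _),
      ← ENNReal.ofReal_mul (by positivity)]
    refine ENNReal.ofReal_le_ofReal ?_
    calc _ ≤ (C * Real.exp (-(h / 2) * ‖x‖ ^ (1 / s)) * Real.exp (-(h / 2) * ‖ξ‖ ^ (1 / s))) ^ 2 :=
          pow_le_pow_left₀ (norm_nonneg _) (hC x ξ) 2
      _ = _ := by
          rw [mul_pow, mul_pow, ← Real.exp_nat_mul, ← Real.exp_nat_mul]
          push_cast
          ring_nf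
  change ∫⁻ ξ : Rd d, _ < ⊤
  calc ∫⁻ ξ : Rd d, (∫⁻ x : Rd d, ‖stft φ u x ξ‖ₑ ^ 2) *
        ENNReal.ofReal (Real.exp (2 * (h / 4) * ‖ξ‖ ^ (1 / s)))
      ≤ ∫⁻ ξ : Rd d, (ENNReal.ofReal (C ^ 2) *
          ∫⁻ x : Rd d, ENNReal.ofReal (Real.exp (-h * ‖x‖ ^ (1 / s)))) *
          ENNReal.ofReal (Real.exp (-(h / 2) * ‖ξ‖ ^ (1 / s))) := by
        refine lintegral_mono fun ξ => (mul_le_mul_left (hx ξ) _).trans (le_of_eq ?_)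
        rw [mul_right_comm, ← ENNReal.ofReal_mul (by positivity), mul_assoc, ← Real.exp_add,
          mul_right_comm (ENNReal.ofReal (C ^ 2)), ← ENNReal.ofReal_mul (by positivity)]
        congr 4
        ring
    _ < ⊤ := by
        rw [lintegral_const_mul' _ _ (ENNReal.mul_ne_top ENNReal.ofReal_ne_top (hfin h hh).ne)]
        exact ENNReal.mul_lt_top (ENNReal.mul_lt_top ENNReal.ofReal_lt_top (hfin h hh))
          (hfin _ (by positivity))

theorem GevreyDecay.mem_coorbit_inter {d : ℕ} {s h : ℝ} (hs : 1 ≤ s) (hh : 0 < h)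
    {f : Rd d → ℂ} (hf : GevreyDecay s h f) {u : Sigma1Dual d} (hu : Represents f u)
    (φ : Sigma1 d) : u ∈ coorbit φ (h / 4) s ∩ fourierCoorbit φ (h / 4) s :=
  ⟨hf.mem_coorbit hs hh hu φ,
    (hf.fourier hs hh).mem_coorbit hs hh (hu.fourier (hf.integrable hs hh)) φ⟩

/-! ### Mixed partial derivatives and `iteratedFDeriv` -/

theorem partialDeriv_of_eq_iteratedFDeriv {d n : ℕ} {f g : Rd d → ℂ} (hf : ContDiff ℝ ∞ f)
    {v : Fin n → Rd d} (hg : ∀ x, g x = iteratedFDeriv ℝ n f x v) (i : Fin d) (x : Rd d) :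
    partialDeriv i g x =
      iteratedFDeriv ℝ (n + 1) f x (Fin.cons (EuclideanSpace.single i 1) v) := by
  rw [iteratedFDeriv_succ_apply_left, partialDeriv, funext hg]
  have hd : DifferentiableAt ℝ (iteratedFDeriv ℝ n f) x :=
    (hf.differentiable_iteratedFDeriv (by exact_mod_cast ENat.natCast_lt_top n)) x
  rw [fderiv_continuousMultilinear_apply_const hd]
  simp

/-- `g` is an `n`-th derivative of `f` along unit vectors. -/
def IsUnitDeriv {d : ℕ} (f : Rd d → ℂ) (n : ℕ) (g : Rd d → ℂ) : Prop :=
  ∃ v : Fin n → Rd d, (∀ i, ‖v i‖ = 1) ∧ ∀ x, g x = iteratedFDeriv ℝ n f x v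

theorem IsUnitDeriv.zero {d : ℕ} (f : Rd d → ℂ) : IsUnitDeriv f 0 f :=
  ⟨0, fun i => i.elim0, fun x => by simp⟩

theorem IsUnitDeriv.partialDeriv {d n : ℕ} {f g : Rd d → ℂ} (hf : ContDiff ℝ ∞ f)
    (hg : IsUnitDeriv f n g) (i : Fin d) : IsUnitDeriv f (n + 1) (partialDeriv i g) := by
  obtain ⟨v, hv, h⟩ := hg
  refine ⟨Fin.cons (EuclideanSpace.single i 1) v, fun j => ?_,
    partialDeriv_of_eq_iteratedFDeriv hf h i⟩
  refine Fin.cases ?_ (fun j => ?_) j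
  · simp
  · simpa using hv j

theorem IsUnitDeriv.iterate_partialDeriv {d n : ℕ} {f g : Rd d → ℂ} (hf : ContDiff ℝ ∞ f)
    (hg : IsUnitDeriv f n g) (i : Fin d) (k : ℕ) :
    IsUnitDeriv f (n + k) ((_root_.partialDeriv i)^[k] g) := by
  induction k with
  | zero => exact hg
  | succ k ih =>
    rw [Function.iterate_succ_apply']
    exact ih.partialDeriv hf i

/-- Which vectors occur, and in which order, is irrelevant: unit length already bounds `∂^β f` by
the operator norm of the derivative of order `|β|`. -/
theorem isUnitDeriv_multiDeriv {d : ℕ} {f : Rd d → ℂ} (hf : ContDiff ℝ ∞ f) (β : Fin d → ℕ) :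
    IsUnitDeriv f (∑ i, β i) (multiDeriv β f) := by
  have key : ∀ l : List (Fin d), IsUnitDeriv f (l.map β).sum
      (l.foldr (fun i g => (partialDeriv i)^[β i] g) f) := by
    intro l
    induction l with
    | nil => exact IsUnitDeriv.zero f
    | cons i l ih =>
      rw [List.map_cons, List.sum_cons, add_comm, List.foldr_cons]
      exact ih.iterate_partialDeriv hf i (β i)
  have := key (List.finRange d)
  rwa [← List.ofFn_eq_map, List.sum_ofFn] at this

theorem IsUnitDeriv.norm_le {d n : ℕ} {f g : Rd d → ℂ} (hg : IsUnitDeriv f n g) (x : Rd d) :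
    ‖g x‖ ≤ ‖iteratedFDeriv ℝ n f x‖ := by
  obtain ⟨v, hv, h⟩ := hg
  rw [h]
  refine (ContinuousMultilinearMap.le_opNorm _ _).trans ?_
  simp [hv]

/-! ### The Gaussian -/

theorem isSigma1_gaussian (d : ℕ) :
    IsSigma1 fun y : Rd d => Complex.exp (-(π : ℂ) * (‖y‖ : ℂ) ^ 2) := by
  have hF : 𝓕 (fun y : Rd d => Complex.exp (-(π : ℂ) * (‖y‖ : ℂ) ^ 2)) =
      fun y : Rd d => Complex.exp (-(π : ℂ) * (‖y‖ : ℂ) ^ 2) := by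
    ext w
    have hpi : (π : ℂ) ≠ 0 := by exact_mod_cast Real.pi_ne_zero
    rw [fourier_gaussian_innerProductSpace (by simpa using Real.pi_pos), div_self hpi,
      Complex.one_cpow, one_mul]
    congr 1
    field_simp
  have hb : ∀ h : ℝ, ExpBound h fun y : Rd d => Complex.exp (-(π : ℂ) * (‖y‖ : ℂ) ^ 2) := by
    intro h
    refine ⟨Real.exp (h ^ 2), fun x => ?_⟩
    rw [Complex.norm_exp, ← Real.exp_add]
    have : (-(π : ℂ) * (‖x‖ : ℂ) ^ 2).re = -π * ‖x‖ ^ 2 := by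
      rw [← Complex.ofReal_pow, ← Complex.ofReal_neg, ← Complex.ofReal_mul, Complex.ofReal_re]
    rw [this]
    gcongr
    nlinarith [Real.pi_gt_three, sq_nonneg (‖x‖ - h / 2), sq_nonneg h, sq_nonneg ‖x‖]
  refine ⟨?_, fun h _ => ⟨hb h, by rw [hF]; exact hb h⟩⟩
  have : (fun y : Rd d => Complex.exp (-(π : ℂ) * (‖y‖ : ℂ) ^ 2)) =
      fun y : Rd d => Complex.exp (-(π : ℂ) * ((‖y‖ ^ 2 : ℝ) : ℂ)) := by
    ext y; push_cast; rfl
  rw [this]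
  exact ContDiff.cexp (contDiff_const.mul (Complex.ofRealCLM.contDiff.comp (contDiff_norm_sq ℝ)))

theorem contDiff_exp_pi_mul_norm_sq {d : ℕ} (x : Rd d) :
    ContDiff ℝ ∞ fun y : Rd d => Real.exp (π * ‖y - x‖ ^ 2) :=
  Real.contDiff_exp.comp
    (contDiff_const.mul ((contDiff_norm_sq ℝ).comp (contDiff_id.sub contDiff_const)))

/-- At 0 the first derivative vanishes, the second is `2π` times the inner product, and the higher
ones are zero. The bound `(2π)^i` is the geometric form needed for the estimate of derivatives of a
composition. -/
theorem norm_iteratedFDeriv_pi_mul_norm_sq_le {d : ℕ} (i : ℕ) (hi : 1 ≤ i) :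
    ‖iteratedFDeriv ℝ i (fun y : Rd d => π * ‖y‖ ^ 2) 0‖ ≤ (2 * π) ^ i := by
  set L : Rd d →L[ℝ] (Rd d →L[ℝ] ℝ) := (2 * π) • innerSL ℝ
  have hL : ‖L‖ ≤ 2 * π := by
    refine ContinuousLinearMap.opNorm_le_bound _ (by positivity) fun x => ?_
    simp only [L, _root_.smul_apply]
    rw [norm_smul, innerSL_apply_norm, Real.norm_of_nonneg (by positivity)]
  have h1 : fderiv ℝ (fun y : Rd d => π * ‖y‖ ^ 2) = L := by
    ext x v
    have := (((hasStrictFDerivAt_norm_sq x).hasFDerivAt).const_mul π).fderiv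
    rw [this]
    simp only [L, _root_.smul_apply, smul_eq_mul, nsmul_eq_mul]
    push_cast
    ring
  obtain ⟨j, rfl⟩ : ∃ j, i = j + 1 := ⟨i - 1, by omega⟩
  rw [← norm_iteratedFDeriv_fderiv, h1]
  cases j with
  | zero => simp; positivity
  | succ j =>
    rw [← norm_iteratedFDeriv_fderiv]
    have h2 : fderiv ℝ (L : Rd d → Rd d →L[ℝ] ℝ) = fun _ => L := by
      ext1 x
      exact L.fderiv
    rw [h2]
    cases j with
    | zero =>
      rw [norm_iteratedFDeriv_zero]
      refine hL.trans (le_self_pow₀ (by linarith [Real.pi_gt_three]) (by norm_num))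
    | succ j =>
      rw [iteratedFDeriv_succ_const]
      simp only [Pi.zero_apply, norm_zero]
      positivity

/-- Only the centre of the Gaussian matters: there every derivative of the outer exponential equals
1, so the bound is independent of `x`. -/
theorem norm_iteratedFDeriv_exp_pi_mul_norm_sq_le {d : ℕ} (x : Rd d) (n : ℕ) :
    ‖iteratedFDeriv ℝ n (fun y : Rd d => Real.exp (π * ‖y - x‖ ^ 2)) x‖ ≤
      n.factorial * (2 * π) ^ n := by
  have h0 := iteratedFDeriv_comp_sub (𝕜 := ℝ) (f := fun y : Rd d => Real.exp (π * ‖y‖ ^ 2)) n x x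
  rw [h0, sub_self]
  have h1 := norm_iteratedFDeriv_comp_le (𝕜 := ℝ) (g := Real.exp) (N := ∞)
    (f := fun y : Rd d => π * ‖y‖ ^ 2) (n := n) (C := 1) (D := 2 * π) Real.contDiff_exp
    (contDiff_const.mul (contDiff_norm_sq ℝ)) (by exact_mod_cast le_top) 0
    (fun i _ => by
      rw [norm_iteratedFDeriv_eq_norm_iteratedDeriv, iteratedDeriv_eq_iterate,
        Real.iter_deriv_exp]
      simp)
    (fun i hi _ => norm_iteratedFDeriv_pi_mul_norm_sq_le i hi)
  simpa [Function.comp_def] using h1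

/-! ### Derivatives of Fourier transforms -/

theorem norm_iteratedFDeriv_fourier_le_integral {d : ℕ} {f : Rd d → ℂ}
    (hm : AEStronglyMeasurable f) (hf : ∀ n : ℕ, Integrable fun v => ‖v‖ ^ n * ‖f v‖) (n : ℕ)
    (x : Rd d) : ‖iteratedFDeriv ℝ n (𝓕 f) x‖ ≤ (2 * π) ^ n * ∫ v, ‖v‖ ^ n * ‖f v‖ := by
  rw [Real.iteratedFDeriv_fourier (N := ⊤) (fun n _ => hf n) hm le_top]
  refine (VectorFourier.norm_fourierIntegral_le_integral_norm _ _ _ _ _).trans ?_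
  rw [← integral_const_mul]
  refine integral_mono_of_nonneg (Filter.Eventually.of_forall fun _ => norm_nonneg _)
    ((hf n).const_mul _) (Filter.Eventually.of_forall fun v => ?_)
  refine (VectorFourier.norm_fourierPowSMulRight_le _ _ _ _).trans ?_
  simp only [← mul_assoc]
  exact mul_le_mul_of_nonneg_right (mul_le_mul_of_nonneg_right (pow_le_pow_left₀ (by positivity)
    (mul_le_of_le_one_right (by positivity) (norm_innerSL_le ℝ)) n) (by positivity))
    (norm_nonneg _)

/-- `f` is the reflection of `𝓕 (𝓕 f)`, and all moments of `𝓕 f` are integrable. -/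
theorem GevreyDecay.contDiff {d : ℕ} {s h : ℝ} (hs : 1 ≤ s) (hh : 0 < h) {f : Rd d → ℂ}
    (hf : GevreyDecay s h f) : ContDiff ℝ ∞ f := by
  have h1 : ContDiff ℝ ∞ (𝓕 (𝓕 f)) := Real.contDiff_fourier fun n _ =>
    hf.weightBound_fourier.integrable_pow hs hh
      (hf.fourier hs hh).continuous.aestronglyMeasurable n
  have h2 : f = fun x => 𝓕 (𝓕 f) (-x) := by
    conv_lhs => rw [← hf.fourierInv_fourier hs hh]
    ext x
    rw [Real.fourierInv_eq_fourier_neg]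
  rw [h2]
  exact h1.comp contDiff_neg

/-- The transform of the localized function is a short-time Fourier transform with Gaussian window.
Its decay in `ξ` controls derivatives of every order, while its decay in `x` comes out as a factor.
-/
theorem norm_iteratedFDeriv_mul_gaussian_le {d : ℕ} {s h : ℝ} (hs : 1 ≤ s) (hh : 0 < h)
    {f : Rd d → ℂ} (hf : GevreyDecay s h f) :
    ∃ C : ℝ, 0 < C ∧ ∀ (x : Rd d), ContDiff ℝ ∞
        (fun y => f y * Complex.exp (-(π : ℂ) * (‖y - x‖ : ℂ) ^ 2)) ∧ ∀ (n : ℕ) (y : Rd d),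
      ‖iteratedFDeriv ℝ n (fun y => f y * Complex.exp (-(π : ℂ) * (‖y - x‖ : ℂ) ^ 2)) y‖ ≤
        C * (2 * π * (h / (4 * s)) ^ (-s)) ^ n * (n.factorial : ℝ) ^ s *
          Real.exp (-(h / 2) * ‖x‖ ^ (1 / s)) := by
  have hG := isSigma1_gaussian d
  obtain ⟨C, hC0, hC⟩ := hf.norm_fourier_mul_translate_le hs hh hG
  have hi4 := integrable_exp_neg_rpow (d := d) hs (show 0 < h / 4 by positivity)
  set K := ∫ ξ : Rd d, Real.exp (-(h / 4) * ‖ξ‖ ^ (1 / s))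
  have hK : 0 ≤ K := integral_nonneg fun _ => (Real.exp_pos _).le
  refine ⟨C * (K + 1), by positivity, fun x => ?_⟩
  set g : Rd d → ℂ := fun y => f y * Complex.exp (-(π : ℂ) * (‖y - x‖ : ℂ) ^ 2)
  have hgx : Continuous fun y : Rd d => Complex.exp (-(π : ℂ) * (‖y - x‖ : ℂ) ^ 2) := by fun_prop
  have hgc : Continuous g := hf.continuous.mul hgx
  have hgi : Integrable g := by
    refine (hf.integrable hs hh).mul_bdd (c := 1) hgx.aestronglyMeasurable
      (Filter.Eventually.of_forall fun y => ?_)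
    rw [Complex.norm_exp, ← Complex.ofReal_pow, ← Complex.ofReal_neg, ← Complex.ofReal_mul,
      Complex.ofReal_re]
    refine Real.exp_le_one_iff.2 ?_
    nlinarith [Real.pi_pos, sq_nonneg ‖y - x‖]
  have hVc : Continuous (𝓕 g) := continuous_fourier_of_integrable hgi
  have hVb : ∀ ξ, ‖𝓕 g ξ‖ ≤ C * Real.exp (-(h / 2) * ‖x‖ ^ (1 / s)) *
      Real.exp (-(h / 2) * ‖ξ‖ ^ (1 / s)) := hC x
  have hVw : WeightBound s (h / 2) (𝓕 g) := WeightBound.of_norm_le hVb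
  have hVi := hVw.integrable hs (by positivity) hVc.aestronglyMeasurable
  have hginv : g = 𝓕 fun ξ => 𝓕 g (-ξ) := by
    rw [← Real.fourierInv_eq_fourier_comp_neg, hgc.fourierInv_fourier_eq hgi hVi]
  have hVn : Continuous fun ξ => 𝓕 g (-ξ) := hVc.comp continuous_neg
  have hVwn : WeightBound s (h / 2) fun ξ => 𝓕 g (-ξ) :=
    WeightBound.of_norm_le fun ξ => by simpa using hVb (-ξ)
  have hpow := hVwn.integrable_pow hs (by positivity) hVn.aestronglyMeasurable
  refine ⟨?_, fun n y => ?_⟩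
  · rw [hginv]
    exact Real.contDiff_fourier fun n _ => hpow n
  rw [hginv]
  refine (norm_iteratedFDeriv_fourier_le_integral hVn.aestronglyMeasurable hpow n y).trans ?_
  set k := h / (4 * s)
  have hk : 0 < k := by positivity
  -- Half of the decay `e^{-(h/2)‖ξ‖^{1/s}}` absorbs the moment `‖ξ‖^n`; the other half makes the
  -- integral converge.
  have hsk : s * k = h / 4 := by simp only [k]; field_simp
  set A := C * Real.exp (-(h / 2) * ‖x‖ ^ (1 / s)) * ((k ^ (-s)) ^ n * (n.factorial : ℝ) ^ s)
  have hint : ∫ ξ, ‖ξ‖ ^ n * ‖𝓕 g (-ξ)‖ ≤ A * K := by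
    rw [← integral_const_mul]
    refine integral_mono_of_nonneg (Filter.Eventually.of_forall fun _ => by positivity)
      (hi4.const_mul _) (Filter.Eventually.of_forall fun ξ => ?_)
    have h1 := pow_le_factorial_rpow_mul_exp hs (norm_nonneg ξ) hk n
    have h2 := hVb (-ξ)
    rw [norm_neg] at h2
    rw [hsk] at h1
    calc ‖ξ‖ ^ n * ‖𝓕 g (-ξ)‖ ≤ ((k ^ (-s)) ^ n * (n.factorial : ℝ) ^ s *
          Real.exp (h / 4 * ‖ξ‖ ^ (1 / s))) * (C * Real.exp (-(h / 2) * ‖x‖ ^ (1 / s)) *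
          Real.exp (-(h / 2) * ‖ξ‖ ^ (1 / s))) :=
          mul_le_mul h1 h2 (norm_nonneg _) (by positivity)
      _ = A * (Real.exp (h / 4 * ‖ξ‖ ^ (1 / s)) * Real.exp (-(h / 2) * ‖ξ‖ ^ (1 / s))) := by
          simp only [A]; ring
      _ = A * Real.exp (-(h / 4) * ‖ξ‖ ^ (1 / s)) := by
          rw [← Real.exp_add]; ring_nf
  calc (2 * π) ^ n * ∫ ξ, ‖ξ‖ ^ n * ‖𝓕 g (-ξ)‖ ≤ (2 * π) ^ n * (A * (K + 1)) := by
        gcongr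
        refine hint.trans ?_
        have : 0 ≤ A := by positivity
        nlinarith
    _ = _ := by simp only [A]; rw [mul_pow]; ring

/-! ### Decay of all derivatives -/

theorem exists_pow_le_factorial_rpow {r t : ℝ} (hr : 0 < r) (ht : 0 ≤ t) :
    ∃ C : ℝ, 0 < C ∧ ∀ n : ℕ, t ^ n ≤ C * (n.factorial : ℝ) ^ r := by
  set τ := t ^ (1 / r)
  have hτ : 0 ≤ τ := by positivity
  refine ⟨Real.exp τ ^ r, by positivity, fun n => ?_⟩
  have h1 := Real.pow_div_factorial_le_exp τ hτ n
  rw [div_le_iff₀ (by positivity)] at h1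
  have h2 : (τ ^ n) ^ r ≤ (Real.exp τ * n.factorial) ^ r := by gcongr
  rw [Real.mul_rpow (by positivity) (by positivity)] at h2
  refine le_trans (le_of_eq ?_) h2
  rw [← Real.rpow_natCast τ, ← Real.rpow_mul hτ, ← Real.rpow_mul ht, ← Real.rpow_natCast]
  congr 1
  field_simp

/-- The spare factor `n!^{s-1}` outgrows every geometric sequence. The strict inequality `1 < s` is
essential here. -/
theorem exists_factorial_mul_pow_le {s A B : ℝ} (hs : 1 < s) (hA : 0 ≤ A) (hB : 0 < B) :
    ∃ C : ℝ, 0 < C ∧ ∀ n : ℕ, (n.factorial : ℝ) * A ^ n ≤ C * B ^ n * (n.factorial : ℝ) ^ s := by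
  obtain ⟨C, hC0, hC⟩ := exists_pow_le_factorial_rpow (sub_pos.2 hs) (div_nonneg hA hB.le)
  refine ⟨C, hC0, fun n => ?_⟩
  have hn : (0 : ℝ) < n.factorial := by positivity
  have h1 := hC n
  rw [div_pow, div_le_iff₀ (by positivity)] at h1
  calc (n.factorial : ℝ) * A ^ n ≤ n.factorial * (C * (n.factorial : ℝ) ^ (s - 1) * B ^ n) := by
        gcongr
    _ = C * B ^ n * ((n.factorial : ℝ) ^ (1 : ℝ) * (n.factorial : ℝ) ^ (s - 1)) := by
        rw [Real.rpow_one]; ring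
    _ = _ := by rw [← Real.rpow_add hn]; ring_nf

/-- Leibniz rule for `f = e^{π‖·-x‖²} g`, with `g` the localization at `x`, evaluated at the centre
`x` itself, where the growing factor has controlled derivatives. -/
theorem GevreyDecay.norm_iteratedFDeriv_le {d : ℕ} {s h : ℝ} (hs : 1 < s) (hh : 0 < h)
    {f : Rd d → ℂ} (hf : GevreyDecay s h f) :
    ∃ C : ℝ, 0 < C ∧ ∀ (n : ℕ) (x : Rd d), ‖iteratedFDeriv ℝ n f x‖ ≤
      C * (4 * π * (h / (4 * s)) ^ (-s)) ^ n * (n.factorial : ℝ) ^ s *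
        Real.exp (-(h / 2) * ‖x‖ ^ (1 / s)) := by
  obtain ⟨C, hC0, hC⟩ := norm_iteratedFDeriv_mul_gaussian_le hs.le hh hf
  -- The factor 2 pays for the binomial coefficients of the Leibniz rule, which sum to `2^n`.
  have hBeq : 4 * π * (h / (4 * s)) ^ (-s) = 2 * (2 * π * (h / (4 * s)) ^ (-s)) := by ring
  have hB : 0 < 2 * π * (h / (4 * s)) ^ (-s) := by positivity
  rw [hBeq]
  generalize 2 * π * (h / (4 * s)) ^ (-s) = B at hC hB
  -- The derivatives of the reciprocal Gaussian are measured with the same base `B` as those of `g`,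
  -- so the powers in each Leibniz term combine to `B^n`.
  obtain ⟨D, hD0, hD⟩ := exists_factorial_mul_pow_le hs (show 0 ≤ 2 * π by positivity) hB
  refine ⟨D * C, by positivity, fun n x => ?_⟩
  obtain ⟨hgs, hg⟩ := hC x
  set g : Rd d → ℂ := fun y => f y * Complex.exp (-(π : ℂ) * (‖y - x‖ : ℂ) ^ 2)
  have hfg : f = fun y => Real.exp (π * ‖y - x‖ ^ 2) • g y := by
    ext y
    simp only [g, Complex.real_smul]
    rw [mul_left_comm, Complex.ofReal_exp, ← Complex.exp_add]
    push_cast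
    ring_nf
    simp
  have hle := norm_iteratedFDeriv_smul_le (𝕜 := ℝ) (contDiff_exp_pi_mul_norm_sq x) hgs x
    (n := n) (by exact_mod_cast le_top)
  rw [← hfg] at hle
  set e := Real.exp (-(h / 2) * ‖x‖ ^ (1 / s))
  have he : 0 < e := Real.exp_pos _
  refine hle.trans ?_
  calc _ ≤ ∑ i ∈ Finset.range (n + 1), (n.choose i : ℝ) *
        (D * C * B ^ n * (n.factorial : ℝ) ^ s * e) := by
        refine Finset.sum_le_sum fun i hi => ?_
        have hin : i ≤ n := Nat.lt_succ_iff.1 (Finset.mem_range.1 hi)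
        have h1 := (norm_iteratedFDeriv_exp_pi_mul_norm_sq_le x i).trans (hD i)
        have h2 := hg (n - i) x
        rw [mul_assoc]
        refine mul_le_mul_of_nonneg_left ?_ (by positivity)
        have hfac : ((i.factorial : ℝ) ^ s * ((n - i).factorial : ℝ) ^ s) ≤
            (n.factorial : ℝ) ^ s := by
          rw [← Real.mul_rpow (by positivity) (by positivity)]
          gcongr
          exact_mod_cast Nat.le_of_dvd (Nat.factorial_pos n)
            (Nat.factorial_mul_factorial_dvd_factorial hin)
        have hpow : B ^ n = B ^ i * B ^ (n - i) := by rw [← pow_add, Nat.add_sub_cancel' hin]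
        calc _ ≤ (D * B ^ i * (i.factorial : ℝ) ^ s) *
              (C * B ^ (n - i) * ((n - i).factorial : ℝ) ^ s * e) :=
              mul_le_mul h1 h2 (norm_nonneg _) (by positivity)
          _ = D * C * B ^ n * ((i.factorial : ℝ) ^ s * ((n - i).factorial : ℝ) ^ s) * e := by
              rw [hpow]; ring
          _ ≤ _ := by gcongr
    _ = D * C * (2 * B) ^ n * (n.factorial : ℝ) ^ s * e := by
        rw [← Finset.sum_mul, ← Nat.cast_sum, Nat.sum_range_choose, mul_pow]
        push_cast
        ring

/-! ### From decay to the Gelfand-Shilov norms -/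

/-- The quotient is a multinomial coefficient, one term of the expansion of `(1 + ⋯ + 1)^{|α|} =
d^{|α|}`. -/
theorem factorial_sum_le_pow_mul_prod {d : ℕ} (α : Fin d → ℕ) :
    (∑ i, α i).factorial ≤ d ^ (∑ i, α i) * ∏ i, (α i).factorial := by
  have h1 := Nat.multinomial_spec Finset.univ α
  have h2 := Finset.sum_pow_eq_sum_piAntidiag (Finset.univ : Finset (Fin d)) (fun _ => (1 : ℕ))
    (∑ i, α i)
  simp only [Finset.sum_const, Finset.card_univ, Fintype.card_fin, smul_eq_mul, mul_one, one_pow,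
    Finset.prod_const_one] at h2
  have h3 : Nat.multinomial Finset.univ α ≤ d ^ (∑ i, α i) := by
    rw [h2]
    refine Finset.single_le_sum (f := fun k => ((Nat.multinomial Finset.univ k : ℕ) : ℕ))
      (fun _ _ => Nat.zero_le _) ?_
    simp [Finset.mem_piAntidiag]
  rw [← h1, mul_comm]
  gcongr

theorem norm_prod_pow_le {d : ℕ} (x : Rd d) (α : Fin d → ℕ) :
    ‖((∏ i, x i ^ α i : ℝ) : ℂ)‖ ≤ ‖x‖ ^ ∑ i, α i := by
  rw [Complex.norm_real, norm_prod, ← Finset.prod_pow_eq_pow_sum]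
  refine Finset.prod_le_prod (fun _ _ => norm_nonneg _) fun i _ => ?_
  rw [norm_pow]
  gcongr
  exact PiLp.norm_apply_le x i

theorem gsNorm_lt_top_of_le {d : ℕ} {s h C : ℝ} {f : Rd d → ℂ} (hh : 0 < h)
    (hC : ∀ (α β : Fin d → ℕ) (x : Rd d),
      ‖((∏ i, x i ^ α i : ℝ) : ℂ) * multiDeriv β f x‖ ≤ C * (h ^ (∑ i, (α i + β i)) *
        (((∏ i, (α i).factorial) * (∏ i, (β i).factorial) : ℕ) : ℝ) ^ s)) :
    gsNorm s h f < ⊤ := by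
  refine lt_of_le_of_lt (b := ENNReal.ofReal C) ?_ ENNReal.ofReal_lt_top
  refine iSup_le fun α => iSup_le fun β => iSup_le fun x => ENNReal.ofReal_le_ofReal ?_
  have hpos : (0 : ℝ) < (((∏ i, (α i).factorial) * (∏ i, (β i).factorial) : ℕ) : ℝ) := by
    exact_mod_cast Nat.mul_pos (Finset.prod_pos fun i _ => Nat.factorial_pos _)
      (Finset.prod_pos fun i _ => Nat.factorial_pos _)
  rw [div_le_iff₀ (by positivity)]
  exact hC α β x

/-- The constant relating the rate of decay to the Gelfand-Shilov norms. -/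
def decayConst (d : ℕ) (s : ℝ) : ℝ := 4 * π * (4 * s) ^ s * (d + 1) ^ s

theorem GevreyDecay.gsNorm_lt_top {d : ℕ} {s h : ℝ} (hs : 1 < s) (hh : 0 < h)
    {f : Rd d → ℂ} (hf : GevreyDecay s h f) : gsNorm s (decayConst d s * h ^ (-s)) f < ⊤ := by
  have hs0 : 0 < s := by linarith
  obtain ⟨C, hC0, hC⟩ := hf.norm_iteratedFDeriv_le hs hh
  set B := 4 * π * (h / (4 * s)) ^ (-s)
  have hB : 0 < B := by positivity
  have hBeq : decayConst d s * h ^ (-s) = B * ((d : ℝ) + 1) ^ s := by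
    simp only [B, decayConst]
    rw [Real.div_rpow hh.le (by positivity), Real.rpow_neg (show 0 ≤ 4 * s by positivity) s,
      div_inv_eq_mul]
    ring
  -- Lets one base `B` serve for the powers of `x` and for the derivatives.
  have hAB : (h / (2 * s)) ^ (-s) ≤ B := by
    have h1 : (h / (2 * s)) ^ (-s) ≤ (h / (4 * s)) ^ (-s) := by
      apply Real.rpow_le_rpow_of_nonpos (by positivity) ?_ (by linarith)
      gcongr
      norm_num
    have h2 : 0 < (h / (4 * s)) ^ (-s) := by positivity
    simp only [B]
    nlinarith [Real.pi_gt_three]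
  rw [hBeq]
  refine gsNorm_lt_top_of_le (C := C) (by positivity) fun α β x => ?_
  set m := ∑ i, α i
  set n := ∑ i, β i
  have hD := ((isUnitDeriv_multiDeriv (hf.contDiff hs.le hh) β).norm_le x).trans (hC n x)
  -- The monomial uses up the entire decay of the derivative; only boundedness is left to prove.
  have hsk : s * (h / (2 * s)) = h / 2 := by field_simp
  have hx := (norm_prod_pow_le x α).trans
    (pow_le_factorial_rpow_mul_exp hs.le (norm_nonneg x) (show 0 < h / (2 * s) by positivity) m)
  rw [hsk] at hx
  have hone : Real.exp (h / 2 * ‖x‖ ^ (1 / s)) * Real.exp (-(h / 2) * ‖x‖ ^ (1 / s)) = 1 := by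
    rw [← Real.exp_add]; simp
  have hfac : ∀ γ : Fin d → ℕ, ((∑ i, γ i).factorial : ℝ) ^ s ≤
      (((d : ℝ) + 1) ^ s) ^ (∑ i, γ i) * (((∏ i, (γ i).factorial : ℕ) : ℝ)) ^ s := by
    intro γ
    have h1 : ((∑ i, γ i).factorial : ℝ) ≤
        ((d : ℝ) + 1) ^ (∑ i, γ i) * ((∏ i, (γ i).factorial : ℕ) : ℝ) := by
      refine le_trans (by exact_mod_cast factorial_sum_le_pow_mul_prod γ :
        ((∑ i, γ i).factorial : ℝ) ≤ (d : ℝ) ^ (∑ i, γ i) * ((∏ i, (γ i).factorial : ℕ) : ℝ)) ?_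
      gcongr
      linarith
    calc ((∑ i, γ i).factorial : ℝ) ^ s ≤
          (((d : ℝ) + 1) ^ (∑ i, γ i) * ((∏ i, (γ i).factorial : ℕ) : ℝ)) ^ s := by gcongr
      _ = _ := by
          rw [Real.mul_rpow (by positivity) (by positivity), ← Real.rpow_natCast,
            ← Real.rpow_natCast, ← Real.rpow_mul (by positivity), ← Real.rpow_mul (by positivity),
            mul_comm s]
  rw [norm_mul]
  calc _ ≤ ((h / (2 * s)) ^ (-s)) ^ m * (m.factorial : ℝ) ^ s *
          Real.exp (h / 2 * ‖x‖ ^ (1 / s)) *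
        (C * B ^ n * (n.factorial : ℝ) ^ s * Real.exp (-(h / 2) * ‖x‖ ^ (1 / s))) :=
        mul_le_mul hx hD (norm_nonneg _) (by positivity)
    _ = C * (((h / (2 * s)) ^ (-s)) ^ m * B ^ n * ((m.factorial : ℝ) ^ s *
          (n.factorial : ℝ) ^ s)) *
        (Real.exp (h / 2 * ‖x‖ ^ (1 / s)) * Real.exp (-(h / 2) * ‖x‖ ^ (1 / s))) := by ring
    _ ≤ C * (B ^ m * B ^ n * (((((d : ℝ) + 1) ^ s) ^ m * ((∏ i, (α i).factorial : ℕ) : ℝ) ^ s) *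
          ((((d : ℝ) + 1) ^ s) ^ n * ((∏ i, (β i).factorial : ℕ) : ℝ) ^ s))) * 1 := by
        rw [hone]
        gcongr
        · exact hfac α
        · exact hfac β
    _ = _ := by
        rw [Finset.sum_add_distrib, pow_add, mul_pow, mul_pow, Nat.cast_mul,
          Real.mul_rpow (Nat.cast_nonneg _) (Nat.cast_nonneg _)]
        ring

/-! ### From the Gelfand-Shilov norms to decay -/

theorem exists_forall_le_of_gsNorm_lt_top {d : ℕ} {s h : ℝ} {f : Rd d → ℂ} (hh : 0 < h)
    (hf : gsNorm s h f < ⊤) : ∃ C : ℝ, 0 < C ∧ ∀ (α β : Fin d → ℕ) (x : Rd d),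
      ‖((∏ i, x i ^ α i : ℝ) : ℂ) * multiDeriv β f x‖ ≤ C * (h ^ (∑ i, (α i + β i)) *
        (((∏ i, (α i).factorial) * (∏ i, (β i).factorial) : ℕ) : ℝ) ^ s) := by
  refine ⟨(gsNorm s h f).toReal + 1, by positivity, fun α β x => ?_⟩
  have hpos : (0 : ℝ) < (((∏ i, (α i).factorial) * (∏ i, (β i).factorial) : ℕ) : ℝ) := by
    exact_mod_cast Nat.mul_pos (Finset.prod_pos fun i _ => Nat.factorial_pos _)
      (Finset.prod_pos fun i _ => Nat.factorial_pos _)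
  rw [← div_le_iff₀ (by positivity)]
  refine le_trans ?_ (lt_add_one _).le
  refine (ENNReal.ofReal_le_iff_le_toReal hf.ne).1 ?_
  exact le_iSup_of_le α (le_iSup_of_le β (le_iSup_of_le x le_rfl))

theorem exists_norm_le_mul_abs_apply {d : ℕ} {x : Rd d} (hx : x ≠ 0) :
    ∃ j, ‖x‖ ≤ (d + 1) * |x j| := by
  have hne : Nonempty (Fin d) := by
    by_contra h
    rw [not_nonempty_iff] at h
    exact hx (Subsingleton.elim _ _)
  obtain ⟨j, -, hj⟩ := Finset.exists_max_image Finset.univ (fun i => |x i|)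
    Finset.univ_nonempty
  refine ⟨j, ?_⟩
  have h1 : ‖x‖ ≤ ∑ i, |x i| := by
    have := norm_sum_le Finset.univ fun i => x i • EuclideanSpace.basisFun (Fin d) ℝ i
    have h2 : ∑ i, x i • EuclideanSpace.basisFun (Fin d) ℝ i = x :=
      (EuclideanSpace.basisFun (Fin d) ℝ).sum_repr x
    rw [h2] at this
    simpa [norm_smul] using this
  have h3 : ∑ i, |x i| ≤ ∑ _i : Fin d, |x j| := Finset.sum_le_sum fun i hi => hj i hi
  simp only [Finset.sum_const, Finset.card_univ, Fintype.card_fin, nsmul_eq_mul] at h3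
  nlinarith [abs_nonneg (x j)]

/-- Uses the largest coordinate. The case `m = 0` is a separate hypothesis because for `d = 0` no
coordinate can supply it. -/
theorem pow_norm_mul_le_of_apply {d : ℕ} {x : Rd d} {m : ℕ} {a M : ℝ} (ha : 0 ≤ a) (hM : 0 ≤ M)
    (h0 : m = 0 → a ≤ M) (h : ∀ j, |x j| ^ m * a ≤ M) : ‖x‖ ^ m * a ≤ ((d : ℝ) + 1) ^ m * M := by
  rcases eq_or_ne m 0 with rfl | hm
  · simpa using h0 rfl
  rcases eq_or_ne x 0 with rfl | hx
  · rw [norm_zero, zero_pow hm, zero_mul]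
    positivity
  obtain ⟨j, hj⟩ := exists_norm_le_mul_abs_apply hx
  calc ‖x‖ ^ m * a ≤ (((d : ℝ) + 1) * |x j|) ^ m * a := by gcongr
    _ = ((d : ℝ) + 1) ^ m * (|x j| ^ m * a) := by rw [mul_pow]; ring
    _ ≤ _ := by gcongr; exact h j

/-- The `1/s`-th power of the hypothesis bounds the `m`-th term of an exponential series. The factor
`1/2` in `y` turns these bounds into a geometric series with sum 2, and raising to the power `s`
gives `2^s`. -/
theorem mul_exp_rpow_le_of_forall_pow {s t a C H : ℝ} (hs : 1 < s) (ht : 0 ≤ t) (ha : 0 ≤ a)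
    (hC : 0 ≤ C) (hH : 0 < H) (h : ∀ m : ℕ, t ^ m * a ≤ C * H ^ m * (m.factorial : ℝ) ^ s) :
    a * Real.exp (s / 2 * H ^ (-(1 / s)) * t ^ (1 / s)) ≤ C * 2 ^ s := by
  have hs0 : 0 < s := by linarith
  set y := H ^ (-(1 / s)) / 2 * t ^ (1 / s)
  have hexp : HasSum (fun n : ℕ => y ^ n / n.factorial) (Real.exp y) := by
    rw [Real.exp_eq_exp_ℝ]
    exact NormedSpace.expSeries_div_hasSum_exp y
  have hterm : ∀ m : ℕ, a ^ (1 / s) * (y ^ m / m.factorial) ≤ C ^ (1 / s) * (1 / 2) ^ m := by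
    intro m
    have h1 : (t ^ m * a) ^ (1 / s) ≤ (C * H ^ m * (m.factorial : ℝ) ^ s) ^ (1 / s) :=
      Real.rpow_le_rpow (by positivity) (h m) (by positivity)
    rw [Real.mul_rpow (by positivity) ha, Real.mul_rpow (by positivity) (by positivity),
      Real.mul_rpow hC (by positivity), ← Real.rpow_mul (Nat.cast_nonneg _),
      mul_one_div_cancel hs0.ne', Real.rpow_one, ← Real.rpow_natCast, ← Real.rpow_natCast,
      ← Real.rpow_mul ht, ← Real.rpow_mul hH.le, mul_comm (m : ℝ), Real.rpow_mul ht,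
      Real.rpow_mul hH.le, Real.rpow_natCast, Real.rpow_natCast] at h1
    have h2 : (H ^ (-(1 / s))) ^ m * (H ^ (1 / s)) ^ m = 1 := by
      rw [← mul_pow, ← Real.rpow_add hH]
      simp
    rw [← mul_div_assoc, div_le_iff₀ (by positivity)]
    calc a ^ (1 / s) * y ^ m
        = (H ^ (-(1 / s))) ^ m * (1 / 2) ^ m * ((t ^ (1 / s)) ^ m * a ^ (1 / s)) := by
          simp only [y]; rw [mul_pow, div_pow, one_div_pow]; ring
      _ ≤ (H ^ (-(1 / s))) ^ m * (1 / 2) ^ m *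
            (C ^ (1 / s) * (H ^ (1 / s)) ^ m * m.factorial) := by gcongr
      _ = C ^ (1 / s) * (1 / 2) ^ m * m.factorial *
            ((H ^ (-(1 / s))) ^ m * (H ^ (1 / s)) ^ m) := by ring
      _ = _ := by rw [h2, mul_one]
  have hsum : a ^ (1 / s) * Real.exp y ≤ C ^ (1 / s) * 2 :=
    hasSum_le hterm (hexp.mul_left _) (hasSum_geometric_two.mul_left _)
  have h3 : (a ^ (1 / s) * Real.exp y) ^ s ≤ (C ^ (1 / s) * 2) ^ s := by gcongr
  rw [Real.mul_rpow (by positivity) (by positivity), Real.mul_rpow (by positivity) (by positivity),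
    ← Real.rpow_mul ha, ← Real.rpow_mul hC, one_div_mul_cancel hs0.ne', Real.rpow_one,
    Real.rpow_one, ← Real.exp_mul] at h3
  refine le_trans (le_of_eq ?_) h3
  congr 2
  simp only [y]
  ring

/-! ### Coordinate derivatives and their Fourier transforms. -/

theorem ContDiff.partialDeriv {d : ℕ} {f : Rd d → ℂ} (hf : ContDiff ℝ ∞ f) (i : Fin d) :
    ContDiff ℝ ∞ (partialDeriv i f) :=
  (hf.fderiv_right (m := ∞) (by simp)).clm_apply contDiff_const

theorem ContDiff.iterate_partialDeriv {d : ℕ} {f : Rd d → ℂ} (hf : ContDiff ℝ ∞ f) (i : Fin d)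
    (n : ℕ) : ContDiff ℝ ∞ ((_root_.partialDeriv i)^[n] f) := by
  induction n with
  | zero => exact hf
  | succ n ih =>
    rw [Function.iterate_succ_apply']
    exact ih.partialDeriv i

theorem multiDeriv_single {d : ℕ} (k : Fin d) (n : ℕ) (f : Rd d → ℂ) :
    multiDeriv (Pi.single k n) f = (partialDeriv k)^[n] f := by
  have key : ∀ l : List (Fin d), l.Nodup →
      l.foldr (fun i g => (partialDeriv i)^[(Pi.single k n : Fin d → ℕ) i] g) f =
        if k ∈ l then (partialDeriv k)^[n] f else f := by
    intro l
    induction l with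
    | nil => simp
    | cons i l ih =>
      intro hl
      rw [List.nodup_cons] at hl
      rw [List.foldr_cons, ih hl.2]
      rcases eq_or_ne i k with rfl | hik
      · simp [hl.1]
      · simp [hik, hik.symm]
  have := key (List.finRange d) (List.nodup_finRange d)
  simp only [List.mem_finRange, if_true] at this
  exact this

theorem multiDeriv_zero {d : ℕ} (f : Rd d → ℂ) : multiDeriv 0 f = f := by
  have key : ∀ l : List (Fin d),
      l.foldr (fun i g => (partialDeriv i)^[(0 : Fin d → ℕ) i] g) f = f := by
    intro l
    induction l with
    | nil => rfl
    | cons i l ih => rw [List.foldr_cons, ih]; rfl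
  exact key _

/-- Integration by parts along one coordinate direction; integrability of `f` and of its derivative
suffices. -/
theorem fourier_partialDeriv {d : ℕ} {f : Rd d → ℂ} (hf : ContDiff ℝ ∞ f) (hi : Integrable f)
    (k : Fin d) (hi' : Integrable (partialDeriv k f)) (ξ : Rd d) :
    𝓕 (partialDeriv k f) ξ = (2 * π * Complex.I * ξ k) * 𝓕 f ξ := by
  set e : Rd d → ℂ := fun x => Complex.exp ((-2 * π * ⟪x, ξ⟫_ℝ : ℝ) * Complex.I)
  have hec : Continuous e := by fun_prop
  have heb : ∀ x, ‖e x‖ ≤ 1 := fun x => (Complex.norm_exp_ofReal_mul_I _).le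
  have hed : ∀ x, HasLineDerivAt ℝ e (-(2 * π * Complex.I * ξ k) * e x) x
      (EuclideanSpace.single k 1) := by
    intro x
    have h1 : HasDerivAt (fun t : ℝ => (-2 * π * ⟪x + t • EuclideanSpace.single k (1 : ℝ), ξ⟫_ℝ))
        (-2 * π * ξ k) 0 := by
      simp only [inner_add_left, inner_smul_left, EuclideanSpace.inner_single_left]
      have := ((((hasDerivAt_id (0 : ℝ)).mul_const (ξ k)).const_add ⟪x, ξ⟫_ℝ).const_mul (-2 * π))
      simpa using this
    have h2 := (h1.ofReal_comp.mul_const Complex.I).cexp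
    refine h2.congr_deriv ?_
    simp only [e, zero_smul, add_zero]
    push_cast
    ring
  have hfd : ∀ x, HasLineDerivAt ℝ f (partialDeriv k f x) x (EuclideanSpace.single k 1) := fun x =>
    ((hf.differentiable (by simp)) x).hasFDerivAt.hasLineDerivAt _
  have hbi : ∀ g : Rd d → ℂ, Integrable g → Integrable fun x => e x * g x := fun g hg =>
    hg.bdd_mul (c := 1) hec.aestronglyMeasurable (Filter.Eventually.of_forall heb)
  have h := integral_bilinear_hasLineDerivAt_right_eq_neg_left_of_integrable (μ := volume)
    (B := ContinuousLinearMap.mul ℝ ℂ) (f := e) (g := f)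
    (f' := fun x => -(2 * π * Complex.I * ξ k) * e x) (g' := partialDeriv k f)
    (v := EuclideanSpace.single k (1 : ℝ))
    (by simpa [mul_assoc] using (hbi f hi).const_mul (-(2 * π * Complex.I * ξ k)))
    (by simpa using hbi _ hi') (by simpa using hbi _ hi) (fun x _ => hed x) (fun x _ => hfd x)
  rw [Real.fourier_eq', Real.fourier_eq', ← integral_const_mul]
  simp only [ContinuousLinearMap.mul_apply'] at h
  simp only [smul_eq_mul]
  rw [← integral_neg] at h
  rw [h]
  congr 1
  ext x
  ring

theorem norm_fourier_iterate_partialDeriv {d : ℕ} {f : Rd d → ℂ} (hf : ContDiff ℝ ∞ f)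
    (k : Fin d) (hi : ∀ n : ℕ, Integrable ((partialDeriv k)^[n] f)) (ξ : Rd d) (n : ℕ) :
    ‖𝓕 ((partialDeriv k)^[n] f) ξ‖ = (2 * π * |ξ k|) ^ n * ‖𝓕 f ξ‖ := by
  induction n with
  | zero => simp
  | succ n ih =>
    have h1 := hi (n + 1)
    rw [Function.iterate_succ_apply'] at h1 ⊢
    rw [fourier_partialDeriv (hf.iterate_partialDeriv k n) (hi n) k h1, norm_mul, ih, pow_succ]
    simp only [norm_mul, Complex.norm_ofNat, Complex.norm_real, Complex.norm_I,
      Real.norm_eq_abs, abs_of_pos Real.pi_pos]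
    ring

/-- The rate of decay obtained from a Gelfand-Shilov norm. -/
def decayRate (d : ℕ) (s H : ℝ) : ℝ := s / 2 * (((d : ℝ) + 1) * H) ^ (-(1 / s))

theorem weightBound_of_gsNorm_lt_top {d : ℕ} {s H : ℝ} (hs : 1 < s) (hH : 0 < H) {f : Rd d → ℂ}
    (hf : ContDiff ℝ ∞ f) (hgs : gsNorm s H f < ⊤) :
    WeightBound s (decayRate d s H) f ∧ WeightBound s (decayRate d s H) (𝓕 f) := by
  obtain ⟨C, hC0, hC⟩ := exists_forall_le_of_gsNorm_lt_top hH hgs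
  have hmom : ∀ (β : Fin d → ℕ) (m : ℕ) (x : Rd d), ‖x‖ ^ m * ‖multiDeriv β f x‖ ≤
      ((d : ℝ) + 1) ^ m * (C * H ^ m * (m.factorial : ℝ) ^ s *
        (H ^ (∑ i, β i) * ((∏ i, (β i).factorial : ℕ) : ℝ) ^ s)) := by
    intro β m x
    refine pow_norm_mul_le_of_apply (norm_nonneg _) (by positivity) (fun hm => ?_) fun j => ?_
    · subst hm
      have := hC 0 β x
      simp at this
      simpa [mul_assoc] using this
    · have := hC (Pi.single j m) β x
      have e1 : (∏ i, x i ^ (Pi.single j m : Fin d → ℕ) i : ℝ) = x j ^ m := by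
        rw [Finset.prod_eq_single j (by intro i _ hij; simp [hij]) (by simp)]
        simp
      have e2 : ∏ i, ((Pi.single j m : Fin d → ℕ) i).factorial = m.factorial := by
        rw [Finset.prod_eq_single j (by intro i _ hij; simp [hij]) (by simp)]
        simp
      have e3 : ∑ i, (Pi.single j m : Fin d → ℕ) i = m := by simp
      rw [e1, e2, Finset.sum_add_distrib, e3, norm_mul, Complex.norm_real, norm_pow,
        Real.norm_eq_abs, pow_add, Nat.cast_mul, Real.mul_rpow (Nat.cast_nonneg _)
        (Nat.cast_nonneg _)] at this
      refine this.trans (le_of_eq ?_)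
      ring
  have hrate : ∀ (g : Rd d → ℂ) (M : ℝ), 0 ≤ M → (∀ (m : ℕ) (x : Rd d), ‖x‖ ^ m * ‖g x‖ ≤
      ((d : ℝ) + 1) ^ m * (M * H ^ m * (m.factorial : ℝ) ^ s)) →
      WeightBound s (decayRate d s H) g := fun g M hM hg =>
    ⟨M * 2 ^ s, fun x => mul_exp_rpow_le_of_forall_pow hs (norm_nonneg x) (norm_nonneg _) hM
      (by positivity) fun m => (hg m x).trans (le_of_eq (by rw [mul_pow]; ring))⟩
  refine ⟨hrate f C hC0.le fun m x => ?_, ?_⟩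
  · have := hmom 0 m x
    simpa [multiDeriv_zero] using this
  have hint : Integrable (fun v : Rd d => (1 + ‖v‖) ^ (-((d + 1 : ℕ) : ℝ))) := by
    apply integrable_one_add_norm
    simp
  set I := ∫ v : Rd d, (1 + ‖v‖) ^ (-((d + 1 : ℕ) : ℝ))
  have hI : 0 ≤ I := integral_nonneg fun v => by positivity
  -- Combines the moments of order 0 and `d + 1` through `(1 + t)^{d+1} ≤ 2^d (1 + t^{d+1})`, giving
  -- an integrable majorant for every derivative.
  set D := 2 ^ d * (C + ((d : ℝ) + 1) ^ (d + 1) *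
    (C * H ^ (d + 1) * ((d + 1).factorial : ℝ) ^ s))
  have hD : 0 ≤ D := by positivity
  have hdec : ∀ (β : Fin d → ℕ) (x : Rd d), ‖multiDeriv β f x‖ ≤
      D * (H ^ (∑ i, β i) * ((∏ i, (β i).factorial : ℕ) : ℝ) ^ s) *
        (1 + ‖x‖) ^ (-((d + 1 : ℕ) : ℝ)) := by
    intro β x
    have h0 : (0 : ℝ) < 1 + ‖x‖ := by positivity
    rw [Real.rpow_neg h0.le, Real.rpow_natCast, ← div_eq_mul_inv, le_div_iff₀ (by positivity)]
    have h1 := hmom β 0 x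
    have h2 := hmom β (d + 1) x
    have h3 := add_pow_le zero_le_one (norm_nonneg x) (d + 1)
    simp only [pow_zero, one_mul, mul_one, Nat.factorial_zero, Nat.cast_one,
      Real.one_rpow] at h1
    simp only [one_pow, Nat.add_sub_cancel] at h3
    calc ‖multiDeriv β f x‖ * (1 + ‖x‖) ^ (d + 1)
        ≤ ‖multiDeriv β f x‖ * (2 ^ d * (1 + ‖x‖ ^ (d + 1))) := by gcongr
      _ = 2 ^ d * (‖multiDeriv β f x‖ + ‖x‖ ^ (d + 1) * ‖multiDeriv β f x‖) := by ring
      _ ≤ 2 ^ d * (C * (H ^ (∑ i, β i) * ((∏ i, (β i).factorial : ℕ) : ℝ) ^ s) +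
          ((d : ℝ) + 1) ^ (d + 1) * (C * H ^ (d + 1) * ((d + 1).factorial : ℝ) ^ s *
          (H ^ (∑ i, β i) * ((∏ i, (β i).factorial : ℕ) : ℝ) ^ s))) := by gcongr
      _ = _ := by simp only [D]; ring
  have hmd : ∀ (k : Fin d) (n : ℕ) (x : Rd d), ‖(partialDeriv k)^[n] f x‖ ≤
      D * (H ^ n * (n.factorial : ℝ) ^ s) * (1 + ‖x‖) ^ (-((d + 1 : ℕ) : ℝ)) := by
    intro k n x
    have := hdec (Pi.single k n) x
    have e2 : ∏ i, ((Pi.single k n : Fin d → ℕ) i).factorial = n.factorial := by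
      rw [Finset.prod_eq_single k (by intro i _ hij; simp [hij]) (by simp)]
      simp
    have e3 : ∑ i, (Pi.single k n : Fin d → ℕ) i = n := by simp
    rwa [multiDeriv_single, e2, e3] at this
  have hnorm : ∀ (g : Rd d → ℂ) (M : ℝ),
      (∀ x, ‖g x‖ ≤ M * (1 + ‖x‖) ^ (-((d + 1 : ℕ) : ℝ))) → ∀ ξ, ‖𝓕 g ξ‖ ≤ M * I := by
    intro g M hg ξ
    refine (norm_fourier_le_integral g ξ).trans ?_
    rw [← integral_const_mul]
    exact integral_mono_of_nonneg (Filter.Eventually.of_forall fun _ => norm_nonneg _)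
      (hint.const_mul _) (Filter.Eventually.of_forall hg)
  refine hrate (𝓕 f) (D * I) (by positivity) fun m ξ => ?_
  refine pow_norm_mul_le_of_apply (norm_nonneg _) (by positivity) (fun hm => ?_) fun k => ?_
  · subst hm
    have := hnorm f D (fun x => by simpa [multiDeriv_zero] using hdec 0 x) ξ
    simpa using this
  · have h1 := hnorm _ _ (hmd k m) ξ
    rw [norm_fourier_iterate_partialDeriv hf k (fun n => (hint.const_mul _).mono'
      (hf.iterate_partialDeriv k n).continuous.aestronglyMeasurable
      (Filter.Eventually.of_forall (hmd k n)))] at h1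
    -- Discarding `2π ≥ 1` gives `𝓕 f` the same rate of decay as `f`.
    have h2 : |ξ k| ^ m ≤ (2 * π * |ξ k|) ^ m := by
      gcongr
      nlinarith [Real.pi_gt_three, abs_nonneg (ξ k)]
    calc |ξ k| ^ m * ‖𝓕 f ξ‖ ≤ (2 * π * |ξ k|) ^ m * ‖𝓕 f ξ‖ := by gcongr
      _ ≤ _ := h1.trans (le_of_eq (by ring))

/-! ### Extension of functionals -/

/-- The estimate makes `l` vanish on the kernel of `J`, so it descends to a bounded functional on
the range of `J`; Hahn-Banach extends that. -/
theorem exists_continuousLinearMap_comp_eq {V H : Type*} [AddCommGroup V] [Module ℂ V]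
    [NormedAddCommGroup H] [NormedSpace ℂ H] (J : V →ₗ[ℂ] H) (l : V →ₗ[ℂ] ℂ) {C : ℝ}
    (h : ∀ v, ‖l v‖ ≤ C * ‖J v‖) : ∃ L : H →L[ℂ] ℂ, ∀ v, L (J v) = l v := by
  have hker : LinearMap.ker J ≤ LinearMap.ker l := by
    intro v hv
    rw [LinearMap.mem_ker] at hv ⊢
    have := h v
    rw [hv, norm_zero, mul_zero] at this
    exact norm_le_zero_iff.1 this
  set l' : LinearMap.range J →ₗ[ℂ] ℂ :=
    ((LinearMap.ker J).liftQ l hker).comp J.quotKerEquivRange.symm.toLinearMap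
  have hl' : ∀ v, l' ⟨J v, LinearMap.mem_range_self J v⟩ = l v := by
    intro v
    simp only [l', LinearMap.comp_apply, LinearEquiv.coe_coe]
    rw [LinearMap.quotKerEquivRange_symm_apply_image J v]
    simp
  have hb : ∀ w, ‖l' w‖ ≤ C * ‖w‖ := by
    rintro ⟨_, v, rfl⟩
    rw [hl']
    exact h v
  obtain ⟨L, hL, -⟩ := exists_extension_norm_eq (LinearMap.range J) (l'.mkContinuous C hb)
  refine ⟨L, fun v => ?_⟩
  rw [← hl' v]
  exact hL ⟨J v, _⟩

/-! ### A Banach space containing `Σ_1` -/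

/-- Sup-norm continuity needs uniformity in `y`: joint continuity gives it on a closed ball, the
locally uniform exponential bound outside. -/
theorem continuous_boundedContinuousFunction_of_decay {P : Type*} [TopologicalSpace P] {d : ℕ}
    (G : P → (Rd d →ᵇ ℂ)) (hG : Continuous fun q : P × Rd d => G q.1 q.2)
    (hdec : ∀ p₀, ∃ C : ℝ, ∀ᶠ p in nhds p₀, ∀ y, ‖G p y‖ ≤ C * Real.exp (-‖y‖)) :
    Continuous G := by
  rw [continuous_iff_continuousAt]
  intro p₀
  rw [ContinuousAt, BoundedContinuousFunction.tendsto_iff_tendstoUniformly,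
    Metric.tendstoUniformly_iff]
  intro ε hε
  obtain ⟨C, hC⟩ := hdec p₀
  have htail : ∀ᶠ R : ℝ in Filter.atTop, C * Real.exp (-R) < ε / 2 := by
    have := (Real.tendsto_exp_neg_atTop_nhds_zero.const_mul C)
    rw [mul_zero] at this
    exact this.eventually (gt_mem_nhds (by positivity))
  obtain ⟨R, hR⟩ := htail.exists
  -- Currying yields continuity for the compact-open topology, that is, uniform convergence on the
  -- ball.
  let Gc : C(P, C(Rd d, ℂ)) := ContinuousMap.curry ⟨fun q : P × Rd d => G q.1 q.2, hG⟩
  have hGc := (ContinuousMap.tendsto_iff_forall_isCompact_tendstoUniformlyOn.1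
    (Gc.continuous.tendsto p₀)) (Metric.closedBall 0 R) (isCompact_closedBall 0 R)
  rw [Metric.tendstoUniformlyOn_iff] at hGc
  filter_upwards [hGc ε hε, hC] with p h1 h2 y
  by_cases hy : ‖y‖ ≤ R
  · exact h1 y (by simpa using hy)
  · push Not at hy
    have hC0 : 0 ≤ C := by
      have := (norm_nonneg _).trans (h2 0)
      simpa using this
    have h3 : C * Real.exp (-‖y‖) ≤ C * Real.exp (-R) := by gcongr
    have h4 := hC.self_of_nhds y
    calc dist (G p₀ y) (G p y) ≤ ‖G p₀ y‖ + ‖G p y‖ := by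
          rw [dist_eq_norm]; exact norm_sub_le _ _
      _ < ε := by linarith [h2 y]

/-- A continuous function with exponential decay, multiplied by `e^{h ‖x‖}`. -/
def expWeighted {d : ℕ} (h : ℝ) (f : Rd d → ℂ) (hf : Continuous f) (hb : ExpBound h f) :
    Rd d →ᵇ ℂ :=
  BoundedContinuousFunction.ofNormedAddCommGroup (fun x => f x * (Real.exp (h * ‖x‖) : ℂ))
    (by fun_prop) hb.choose fun x => by
      rw [norm_mul, Complex.norm_real, Real.norm_of_nonneg (Real.exp_pos _).le]
      exact hb.choose_spec x

theorem expWeighted_apply {d : ℕ} (h : ℝ) (f : Rd d → ℂ) (hf : Continuous f)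
    (hb : ExpBound h f) (x : Rd d) :
    expWeighted h f hf hb x = f x * (Real.exp (h * ‖x‖) : ℂ) := rfl

theorem expSup_le_norm_expWeighted {d : ℕ} (h : ℝ) (f : Rd d → ℂ) (hf : Continuous f)
    (hb : ExpBound h f) : expSup h f ≤ ‖expWeighted h f hf hb‖ := by
  refine ciSup_le fun x => ?_
  have := (expWeighted h f hf hb).norm_coe_le_norm x
  rwa [expWeighted_apply, norm_mul, Complex.norm_real,
    Real.norm_of_nonneg (Real.exp_pos _).le] at this

/-- The embedding of `Σ_1` into a Banach space given by one of its seminorms. -/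
def Sigma1.embed (d : ℕ) {h : ℝ} (hh : 0 < h) :
    Sigma1 d →ₗ[ℂ] (Rd d →ᵇ ℂ) × (Rd d →ᵇ ℂ) where
  toFun ψ := (expWeighted h ψ.toFun ψ.continuous (ψ.isSigma1.2 h hh).1,
    expWeighted h (𝓕 ψ.toFun) ψ.isSigma1.fourier.continuous (ψ.isSigma1.2 h hh).2)
  map_add' ψ χ := by
    refine Prod.ext ?_ ?_ <;> ext x
    · exact add_mul _ _ _
    · change 𝓕 (ψ.toFun + χ.toFun) x * _ = _
      rw [fourier_add_of_integrable ψ.integrable χ.integrable]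
      exact add_mul _ _ _
  map_smul' c ψ := by
    refine Prod.ext ?_ ?_ <;> ext x
    · exact mul_assoc _ _ _
    · change 𝓕 (c • ψ.toFun) x * _ = _
      rw [fourier_const_smul']
      exact mul_assoc _ _ _

theorem Sigma1.embed_fst_apply {d : ℕ} {h : ℝ} (hh : 0 < h) (ψ : Sigma1 d) (x : Rd d) :
    (Sigma1.embed d hh ψ).1 x = ψ.toFun x * (Real.exp (h * ‖x‖) : ℂ) := rfl

theorem Sigma1.embed_snd_apply {d : ℕ} {h : ℝ} (hh : 0 < h) (ψ : Sigma1 d) (x : Rd d) :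
    (Sigma1.embed d hh ψ).2 x = 𝓕 ψ.toFun x * (Real.exp (h * ‖x‖) : ℂ) := rfl

theorem expSup_mono {d : ℕ} {h h' : ℝ} (hh : h ≤ h') {f : Rd d → ℂ} (hf : ExpBound h' f) :
    expSup h f ≤ expSup h' f := by
  refine ciSup_le fun x => le_trans ?_ (le_ciSup hf.bddAbove x)
  gcongr

/-- Continuity involves finitely many seminorms, and they increase with `h`, so one large parameter
dominates them all. The factor 2 compares a sum with the maximum norm of the product. -/
theorem Sigma1Dual.exists_norm_le {d : ℕ} (u : Sigma1Dual d) :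
    ∃ h : ℝ, ∃ hh : 0 < h, ∃ C : ℝ, ∀ ψ, ‖u ψ‖ ≤ C * ‖Sigma1.embed d hh ψ‖ := by
  obtain ⟨S, C, -, hC⟩ := Seminorm.bound_of_continuous (sigma1_withSeminorms d)
    ((normSeminorm ℂ ℂ).comp u.toLinearMap) (continuous_norm.comp u.continuous)
  obtain ⟨h₀, hh₀, hS⟩ : ∃ h₀ : ℝ, 0 < h₀ ∧ ∀ h ∈ S, (h : ℝ) ≤ h₀ := by
    refine ⟨1 + ∑ h ∈ S, (h : ℝ), ?_, fun h hh => ?_⟩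
    · have : 0 ≤ ∑ h ∈ S, (h : ℝ) := Finset.sum_nonneg fun h _ => h.2.le
      linarith
    · have := Finset.single_le_sum (f := fun h : Set.Ioi (0 : ℝ) => (h : ℝ))
        (fun h _ => h.2.le) hh
      linarith
  refine ⟨h₀, hh₀, C * 2, fun ψ => ?_⟩
  have h1 : ‖u ψ‖ ≤ C * (S.sup (sigma1Seminorm d)) ψ := hC ψ
  refine h1.trans ?_
  rw [mul_assoc]
  refine mul_le_mul_of_nonneg_left ?_ C.2
  refine Seminorm.finset_sup_apply_le (by positivity) fun h hh => ?_
  have h2 := expSup_mono (hS h hh) (ψ.isSigma1.2 h₀ hh₀).1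
  have h3 := expSup_mono (hS h hh) (ψ.isSigma1.2 h₀ hh₀).2
  have h4 := expSup_le_norm_expWeighted h₀ ψ.toFun ψ.continuous (ψ.isSigma1.2 h₀ hh₀).1
  have h5 := expSup_le_norm_expWeighted h₀ (𝓕 ψ.toFun) ψ.isSigma1.fourier.continuous
    (ψ.isSigma1.2 h₀ hh₀).2
  have h6 := norm_fst_le (Sigma1.embed d hh₀ ψ)
  have h7 := norm_snd_le (Sigma1.embed d hh₀ ψ)
  calc sigma1Seminorm d h ψ = expSup h.1 ψ.toFun + expSup h.1 (𝓕 ψ.toFun) := rfl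
    _ ≤ ‖(Sigma1.embed d hh₀ ψ).1‖ + ‖(Sigma1.embed d hh₀ ψ).2‖ :=
        add_le_add (h2.trans h4) (h3.trans h5)
    _ ≤ 2 * ‖Sigma1.embed d hh₀ ψ‖ := by linarith

/-! ### Time-frequency shifts in the Banach space -/

theorem Sigma1.fourier_conjShift {d : ℕ} (x ξ : Rd d) (φ : Sigma1 d) (η : Rd d) :
    𝓕 (φ.conjShift x ξ).toFun η = Complex.exp ((-2 * π * ⟪x, η + ξ⟫_ℝ : ℝ) * Complex.I) *
      starRingEnd ℂ (𝓕 φ.toFun (-(η + ξ))) := by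
  rw [Real.fourier_eq', Real.fourier_eq', ← integral_conj, ← integral_const_mul,
    ← integral_add_right_eq_self _ x]
  congr 1
  ext y
  simp only [φ.conjShift_apply, add_sub_cancel_right, smul_eq_mul, map_mul, ← Complex.exp_conj,
    Complex.conj_I, Complex.conj_ofReal]
  rw [← mul_assoc, ← mul_assoc, ← Complex.exp_add, ← Complex.exp_add]
  congr 2
  simp only [inner_add_left, inner_add_right, inner_neg_right]
  push_cast
  ring

/-- The window and its transform decay at rate `h + 1`; after the weight `e^{h‖y‖}`, a factor
`e^{-‖y‖}` is left. A shift costs `e^{(h+1)‖x‖}` in time or `e^{(h+1)‖ξ‖}` in frequency. -/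
theorem Sigma1.exists_norm_conjShift_le {d : ℕ} {h : ℝ} (hh : 0 < h) (φ : Sigma1 d) :
    ∃ C : ℝ, 0 < C ∧ ∀ x ξ y : Rd d,
      ‖(φ.conjShift x ξ).toFun y * (Real.exp (h * ‖y‖) : ℂ)‖ ≤
        C * Real.exp ((h + 1) * ‖x‖) * Real.exp (-‖y‖) ∧
      ‖𝓕 (φ.conjShift x ξ).toFun y * (Real.exp (h * ‖y‖) : ℂ)‖ ≤
        C * Real.exp ((h + 1) * ‖ξ‖) * Real.exp (-‖y‖) := by
  have hh1 : 0 < h + 1 := by linarith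
  obtain ⟨A, hA0, hA⟩ := (φ.isSigma1.2 (h + 1) hh1).1.exists_norm_le
  obtain ⟨B, hB0, hB⟩ := (φ.isSigma1.2 (h + 1) hh1).2.exists_norm_le
  have key : ∀ (D a : ℝ) (z y x : Rd d), 0 ≤ D → a ≤ D * Real.exp (-(h + 1) * ‖z‖) →
      ‖y‖ ≤ ‖z‖ + ‖x‖ →
      a * Real.exp (h * ‖y‖) ≤ D * Real.exp ((h + 1) * ‖x‖) * Real.exp (-‖y‖) := by
    intro D a z y x hD ha hzy
    calc a * Real.exp (h * ‖y‖) ≤ D * Real.exp (-(h + 1) * ‖z‖) * Real.exp (h * ‖y‖) := by gcongr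
      _ = D * Real.exp (-(h + 1) * ‖z‖ + h * ‖y‖) := by rw [mul_assoc, ← Real.exp_add]
      _ ≤ D * Real.exp ((h + 1) * ‖x‖ + -‖y‖) := by
          refine mul_le_mul_of_nonneg_left (Real.exp_le_exp.2 ?_) hD
          nlinarith
      _ = _ := by rw [Real.exp_add, mul_assoc]
  refine ⟨max A B, by positivity, fun x ξ y => ⟨?_, ?_⟩⟩
  · rw [norm_mul, Complex.norm_real, Real.norm_of_nonneg (Real.exp_pos _).le,
      φ.conjShift_apply, norm_mul, Complex.norm_exp_ofReal_mul_I, one_mul, RCLike.norm_conj]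
    refine key _ _ (y - x) y x (by positivity) ((hA _).trans ?_) ?_
    · gcongr
      exact le_max_left _ _
    · simpa using norm_add_le (y - x) x
  · rw [norm_mul, Complex.norm_real, Real.norm_of_nonneg (Real.exp_pos _).le,
      φ.fourier_conjShift, norm_mul, Complex.norm_exp_ofReal_mul_I, one_mul, RCLike.norm_conj]
    refine key _ _ (-(y + ξ)) y ξ (by positivity) ((hB _).trans ?_) ?_
    · gcongr
      exact le_max_right _ _
    · rw [norm_neg]
      simpa using norm_add_le (y + ξ) (-ξ)

theorem Sigma1.norm_embed_conjShift_le {d : ℕ} {h : ℝ} (hh : 0 < h) (φ : Sigma1 d) :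
    ∃ C : ℝ, 0 < C ∧ ∀ x ξ : Rd d, ‖Sigma1.embed d hh (φ.conjShift x ξ)‖ ≤
      C * Real.exp ((h + 1) * ‖x‖) * Real.exp ((h + 1) * ‖ξ‖) := by
  obtain ⟨C, hC0, hC⟩ := φ.exists_norm_conjShift_le hh
  refine ⟨C, hC0, fun x ξ => ?_⟩
  have h1 : ∀ z : Rd d, 1 ≤ Real.exp ((h + 1) * ‖z‖) := fun z => Real.one_le_exp (by positivity)
  have h2 : ∀ z : Rd d, Real.exp (-‖z‖) ≤ 1 := fun z => Real.exp_le_one_iff.2 (by simp)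
  rw [Prod.norm_def]
  refine max_le ?_ ?_
  · refine (BoundedContinuousFunction.norm_le (by positivity)).2 fun y => ?_
    refine ((hC x ξ y).1).trans ?_
    exact mul_le_mul_of_nonneg_left ((h2 y).trans (h1 ξ)) (by positivity)
  · refine (BoundedContinuousFunction.norm_le (by positivity)).2 fun y => ?_
    refine ((hC x ξ y).2).trans ?_
    calc C * Real.exp ((h + 1) * ‖ξ‖) * Real.exp (-‖y‖)
        ≤ C * Real.exp ((h + 1) * ‖ξ‖) * Real.exp ((h + 1) * ‖x‖) :=
          mul_le_mul_of_nonneg_left ((h2 y).trans (h1 x)) (by positivity)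
      _ = _ := by ring

theorem Sigma1.continuous_embed_conjShift {d : ℕ} {h : ℝ} (hh : 0 < h) (φ : Sigma1 d) :
    Continuous fun p : Rd d × Rd d => Sigma1.embed d hh (φ.conjShift p.1 p.2) := by
  obtain ⟨C, hC0, hC⟩ := φ.exists_norm_conjShift_le hh
  have hloc : ∀ (g : Rd d × Rd d → ℝ), Continuous g → ∀ p₀, ∀ᶠ p in nhds p₀, g p ≤ g p₀ + 1 :=
    fun g hg p₀ => (hg.continuousAt.eventually (gt_mem_nhds (lt_add_one _))).mono fun _ h => h.le
  refine Continuous.prodMk (continuous_boundedContinuousFunction_of_decay _ ?_ fun p₀ => ?_)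
    (continuous_boundedContinuousFunction_of_decay _ ?_ fun p₀ => ?_)
  · have hc := φ.continuous
    have : (fun q : (Rd d × Rd d) × Rd d => (Sigma1.embed d hh (φ.conjShift q.1.1 q.1.2)).1 q.2) =
        fun q => Complex.exp ((-2 * π * ⟪q.2, q.1.2⟫_ℝ : ℝ) * Complex.I) *
          starRingEnd ℂ (φ.toFun (q.2 - q.1.1)) * (Real.exp (h * ‖q.2‖) : ℂ) := by
      ext q
      rw [Sigma1.embed_fst_apply, φ.conjShift_apply]
    change Continuous fun q : (Rd d × Rd d) × Rd d =>
      (Sigma1.embed d hh (φ.conjShift q.1.1 q.1.2)).1 q.2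
    rw [this]
    fun_prop
  · refine ⟨C * (Real.exp ((h + 1) * ‖p₀.1‖) + 1), ?_⟩
    filter_upwards [hloc (fun p => Real.exp ((h + 1) * ‖p.1‖)) (by fun_prop) p₀] with p hp y
    refine ((hC p.1 p.2 y).1).trans ?_
    gcongr
  · have hc := φ.isSigma1.fourier.continuous
    have : (fun q : (Rd d × Rd d) × Rd d => (Sigma1.embed d hh (φ.conjShift q.1.1 q.1.2)).2 q.2) =
        fun q => Complex.exp ((-2 * π * ⟪q.1.1, q.2 + q.1.2⟫_ℝ : ℝ) * Complex.I) *
          starRingEnd ℂ (𝓕 φ.toFun (-(q.2 + q.1.2))) * (Real.exp (h * ‖q.2‖) : ℂ) := by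
      ext q
      rw [Sigma1.embed_snd_apply, φ.fourier_conjShift]
    change Continuous fun q : (Rd d × Rd d) × Rd d =>
      (Sigma1.embed d hh (φ.conjShift q.1.1 q.1.2)).2 q.2
    rw [this]
    fun_prop
  · refine ⟨C * (Real.exp ((h + 1) * ‖p₀.2‖) + 1), ?_⟩
    filter_upwards [hloc (fun p => Real.exp ((h + 1) * ‖p.2‖)) (by fun_prop) p₀] with p hp y
    refine ((hC p.1 p.2 y).2).trans ?_
    gcongr

/-! ### Plancherel's theorem -/

theorem conj_fourier {d : ℕ} (f : Rd d → ℂ) (x : Rd d) :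
    𝓕 (fun y => starRingEnd ℂ (f y)) x = starRingEnd ℂ (𝓕⁻ f x) := by
  rw [Real.fourier_eq', Real.fourierInv_eq', ← integral_conj]
  congr 1
  ext v
  simp only [smul_eq_mul, map_mul, ← Complex.exp_conj, Complex.conj_I, Complex.conj_ofReal]
  congr 2
  push_cast
  ring

/-- The identity `∫ 𝓕 f · g = ∫ f · 𝓕 g` with `g` the conjugate of `𝓕 f`, followed by Fourier
inversion. -/
theorem integral_norm_sq_fourier {d : ℕ} {f : Rd d → ℂ} (hc : Continuous f) (hf : Integrable f)
    (hf' : Integrable (𝓕 f)) : ∫ ξ, ‖𝓕 f ξ‖ ^ 2 = ∫ x, ‖f x‖ ^ 2 := by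
  have h1 : Integrable fun ξ => starRingEnd ℂ (𝓕 f ξ) :=
    (Complex.conjCLE : ℂ →L[ℝ] ℂ).integrable_comp hf'
  have h := integral_fourier_mul hf h1
  simp only [conj_fourier, hc.fourierInv_fourier_eq hf hf', Complex.mul_conj'] at h
  have h2 := integral_ofReal (𝕜 := ℂ) (μ := (volume : Measure (Rd d)))
    (f := fun ξ => ‖𝓕 f ξ‖ ^ 2)
  have h3 := integral_ofReal (𝕜 := ℂ) (μ := (volume : Measure (Rd d))) (f := fun ξ => ‖f ξ‖ ^ 2)
  push_cast at h2 h3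
  apply Complex.ofReal_injective
  exact h2.symm.trans (h.trans h3)

theorem integrable_norm_sq_of_bounded {d : ℕ} {f : Rd d → ℂ} {C : ℝ} (hf : Integrable f)
    (hC : ∀ x, ‖f x‖ ≤ C) : Integrable fun x => ‖f x‖ ^ 2 := by
  simp only [sq]
  exact hf.norm.mul_bdd (c := C) hf.aestronglyMeasurable.norm
    (Filter.Eventually.of_forall fun x => by simpa using hC x)

theorem lintegral_enorm_sq_eq {d : ℕ} {f : Rd d → ℂ} (hf : Integrable fun x => ‖f x‖ ^ 2) :
    ∫⁻ x, ‖f x‖ₑ ^ 2 = ENNReal.ofReal (∫ x, ‖f x‖ ^ 2) := by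
  rw [ofReal_integral_eq_lintegral_ofReal hf (Filter.Eventually.of_forall fun x => by positivity)]
  simp only [ENNReal.ofReal_pow (norm_nonneg _), ofReal_norm]

theorem lintegral_enorm_sq_fourier {d : ℕ} {f : Rd d → ℂ} {C : ℝ} (hc : Continuous f)
    (hf : Integrable f) (hf' : Integrable (𝓕 f)) (hC : ∀ x, ‖f x‖ ≤ C) :
    ∫⁻ ξ, ‖𝓕 f ξ‖ₑ ^ 2 = ∫⁻ x, ‖f x‖ₑ ^ 2 := by
  rw [lintegral_enorm_sq_eq (integrable_norm_sq_of_bounded hf hC),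
    lintegral_enorm_sq_eq (integrable_norm_sq_of_bounded hf' (norm_fourier_le_integral f)),
    integral_norm_sq_fourier hc hf hf']

/-! ### The coefficients of the inversion formula -/

theorem fourier_translate {d : ℕ} (x : Rd d) (f : Rd d → ℂ) (w : Rd d) :
    𝓕 (fun y => f (y - x)) w = Complex.exp ((-2 * π * ⟪x, w⟫_ℝ : ℝ) * Complex.I) * 𝓕 f w := by
  rw [Real.fourier_eq', Real.fourier_eq', ← integral_const_mul, ← integral_add_right_eq_self _ x]
  congr 1
  ext v
  simp only [add_sub_cancel_right, smul_eq_mul]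
  rw [← mul_assoc, ← Complex.exp_add]
  congr 2
  rw [inner_add_left]
  push_cast
  ring

/-- The coefficient of `conj (M_ξ T_x φ)` in the inversion formula for `𝓕 χ`. -/
def synthesisCoeff {d : ℕ} (φ χ : Sigma1 d) (x ξ : Rd d) : ℂ :=
  𝓕⁻ (fun y => 𝓕 χ.toFun y * φ.toFun (y - x)) ξ

/-- The transform of a product is a convolution of transforms. Up to a unimodular factor, the
coefficient is thus a Fourier transform in `x` involving `χ` itself, which makes Plancherel in `x`
applicable. -/
theorem synthesisCoeff_eq {d : ℕ} (φ χ : Sigma1 d) (x ξ : Rd d) :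
    synthesisCoeff φ χ x ξ = Complex.exp ((2 * π * ⟪x, ξ⟫_ℝ : ℝ) * Complex.I) *
      𝓕 (fun η => χ.toFun η * 𝓕 φ.toFun (η - ξ)) x := by
  have h1 := fourier_fourierInv_mul χ.integrable.comp_neg (φ.integrable.comp_sub_right x) (-ξ)
  have h2 : 𝓕⁻ (fun y => χ.toFun (-y)) = 𝓕 χ.toFun := by
    rw [Real.fourierInv_eq_fourier_comp_neg]
    simp only [neg_neg]
  rw [h2] at h1
  rw [synthesisCoeff, Real.fourierInv_eq_fourier_neg, h1, ← integral_neg_eq_self,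
    Real.fourier_eq', ← integral_const_mul]
  congr 1
  ext η
  simp only [fourier_translate, neg_neg, smul_eq_mul]
  rw [show -ξ - -η = η - ξ by abel]
  rw [mul_left_comm, ← mul_assoc (Complex.exp _) (Complex.exp _), ← Complex.exp_add]
  rw [mul_comm (χ.toFun η)]
  congr 2
  rw [inner_sub_right, real_inner_comm η x]
  push_cast
  ring

theorem IsSigma1.gevreyDecay {d : ℕ} {h : ℝ} (hh : 0 < h) {f : Rd d → ℂ} (hf : IsSigma1 f) :
    GevreyDecay 1 h f :=
  ⟨hf.continuous, hf.weightBound le_rfl hh, hf.fourier.weightBound le_rfl hh⟩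

/-- Elements of `Σ_1` satisfy the `s = 1` decay condition at every rate, so the earlier estimate
applies; rate `2 * N` compensates its halving. -/
theorem exists_norm_synthesisCoeff_le {d : ℕ} {N : ℝ} (hN : 0 < N) (φ χ : Sigma1 d) :
    ∃ C : ℝ, 0 < C ∧ ∀ x ξ : Rd d, ‖synthesisCoeff φ χ x ξ‖ ≤
      C * Real.exp (-N * ‖x‖) * Real.exp (-N * ‖ξ‖) := by
  obtain ⟨C, hC0, hC⟩ := (χ.isSigma1.fourier.gevreyDecay
    (show 0 < 2 * N by linarith)).norm_fourier_mul_translate_le le_rfl (by linarith) φ.isSigma1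
  refine ⟨C, hC0, fun x ξ => ?_⟩
  rw [synthesisCoeff, Real.fourierInv_eq_fourier_neg]
  have := hC x (-ξ)
  simpa using this

theorem Sigma1.exists_norm_le {d : ℕ} (φ : Sigma1 d) : ∃ C : ℝ, 0 < C ∧ ∀ x, ‖φ.toFun x‖ ≤ C := by
  obtain ⟨C, hC0, hC⟩ := (φ.isSigma1.2 1 one_pos).1.exists_norm_le
  refine ⟨C, hC0, fun x => (hC x).trans ?_⟩
  refine mul_le_of_le_one_right hC0.le (Real.exp_le_one_iff.2 ?_)
  simp

theorem continuous_synthesisCoeff {d : ℕ} (φ χ : Sigma1 d) :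
    Continuous fun p : Rd d × Rd d => synthesisCoeff φ χ p.1 p.2 := by
  obtain ⟨C, hC0, hC⟩ := φ.exists_norm_le
  have h1 := φ.continuous
  have h2 := χ.isSigma1.fourier.continuous
  simp only [synthesisCoeff, Real.fourierInv_eq']
  refine continuous_of_dominated (bound := fun y => ‖𝓕 χ.toFun y‖ * C) (fun p => ?_)
    (fun p => Filter.Eventually.of_forall fun y => ?_)
    (χ.isSigma1.fourier.integrable.norm.mul_const C)
    (Filter.Eventually.of_forall fun y => ?_)
  · exact Continuous.aestronglyMeasurable (by fun_prop)
  · rw [norm_smul, Complex.norm_exp_ofReal_mul_I, one_mul, norm_mul]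
    gcongr
    exact hC _
  · fun_prop

theorem integrable_exp_neg_mul_norm {d : ℕ} {N : ℝ} (hN : 0 < N) :
    Integrable fun x : Rd d => Real.exp (-N * ‖x‖) := by
  simpa using integrable_exp_neg_rpow (d := d) le_rfl hN

theorem integrable_of_norm_le_exp_prod {d : ℕ} {E : Type*} [NormedAddCommGroup E]
    {F : Rd d × Rd d → E} {C N : ℝ} (hN : 0 < N) (hF : Continuous F)
    (h : ∀ x ξ, ‖F (x, ξ)‖ ≤ C * Real.exp (-N * ‖x‖) * Real.exp (-N * ‖ξ‖)) :
    Integrable F := by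
  have hi := (integrable_exp_neg_mul_norm (d := d) hN)
  refine ((hi.mul_prod hi).const_mul C).mono' hF.aestronglyMeasurable
    (Filter.Eventually.of_forall fun p => ?_)
  rw [← mul_assoc]
  exact h p.1 p.2

/-- Coefficients of rate `h + 2` beat the growth `e^{(h+1)(‖x‖+‖ξ‖)}` of the shifted windows in the
Banach space. -/
theorem integrable_synthesis {d : ℕ} {h : ℝ} (hh : 0 < h) (φ χ : Sigma1 d) :
    Integrable fun p : Rd d × Rd d =>
      synthesisCoeff φ χ p.1 p.2 • Sigma1.embed d hh (φ.conjShift p.1 p.2) := by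
  obtain ⟨C, hC0, hC⟩ := exists_norm_synthesisCoeff_le (show 0 < h + 2 by linarith) φ χ
  obtain ⟨D, hD0, hD⟩ := φ.norm_embed_conjShift_le hh
  refine integrable_of_norm_le_exp_prod (C := C * D) one_pos
    ((continuous_synthesisCoeff φ χ).smul (φ.continuous_embed_conjShift hh)) fun x ξ => ?_
  rw [norm_smul]
  have he : ∀ z : Rd d, Real.exp (-(h + 2) * ‖z‖) * Real.exp ((h + 1) * ‖z‖) =
      Real.exp (-1 * ‖z‖) := fun z => by
    rw [← Real.exp_add]
    ring_nf
  calc _ ≤ (C * Real.exp (-(h + 2) * ‖x‖) * Real.exp (-(h + 2) * ‖ξ‖)) *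
        (D * Real.exp ((h + 1) * ‖x‖) * Real.exp ((h + 1) * ‖ξ‖)) :=
        mul_le_mul (hC x ξ) (hD x ξ) (norm_nonneg _) (by positivity)
    _ = C * D * (Real.exp (-(h + 2) * ‖x‖) * Real.exp ((h + 1) * ‖x‖)) *
        (Real.exp (-(h + 2) * ‖ξ‖) * Real.exp ((h + 1) * ‖ξ‖)) := by ring
    _ = _ := by rw [he, he]

theorem fourier_fourierInv_windowed {d : ℕ} (φ χ : Sigma1 d) (x y : Rd d) :
    𝓕 (fun ξ => synthesisCoeff φ χ x ξ) y = 𝓕 χ.toFun y * φ.toFun (y - x) := by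
  obtain ⟨C, hC0, hC⟩ := exists_norm_synthesisCoeff_le one_pos φ χ
  obtain ⟨D, hD0, hD⟩ := φ.exists_norm_le
  set m : Rd d → ℂ := fun y => 𝓕 χ.toFun y * φ.toFun (y - x)
  have hφ := φ.continuous
  have hχ := χ.isSigma1.fourier.continuous
  have hm : Continuous m := by fun_prop
  have hmi : Integrable m := χ.isSigma1.fourier.integrable.mul_bdd (c := D)
    (Continuous.aestronglyMeasurable (by fun_prop)) (Filter.Eventually.of_forall fun y => hD _)
  have hFi : Integrable (𝓕 m) := by
    refine ((integrable_exp_neg_mul_norm (d := d) one_pos).const_mul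
      (C * Real.exp (-1 * ‖x‖))).mono'
      (continuous_fourier_of_integrable hmi).aestronglyMeasurable
      (Filter.Eventually.of_forall fun ξ => ?_)
    have := hC x (-ξ)
    rwa [synthesisCoeff, Real.fourierInv_eq_fourier_neg, neg_neg, norm_neg] at this
  exact congrFun (hm.fourier_fourierInv_eq hmi hFi) y

theorem integrable_fourier_windowed {d : ℕ} (φ χ : Sigma1 d) (ξ : Rd d) :
    Integrable (fun η => χ.toFun η * 𝓕 φ.toFun (η - ξ)) ∧
      Integrable (𝓕 fun η => χ.toFun η * 𝓕 φ.toFun (η - ξ)) := by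
  obtain ⟨C, hC0, hC⟩ := exists_norm_synthesisCoeff_le one_pos φ χ
  have hφ := φ.isSigma1.fourier.continuous
  have hmi : Integrable fun η => χ.toFun η * 𝓕 φ.toFun (η - ξ) :=
    χ.integrable.mul_bdd (c := ∫ y, ‖φ.toFun y‖)
    (Continuous.aestronglyMeasurable (by fun_prop))
    (Filter.Eventually.of_forall fun y => norm_fourier_le_integral _ _)
  refine ⟨hmi, ?_⟩
  refine ((integrable_exp_neg_mul_norm (d := d) one_pos).const_mul
      (C * Real.exp (-1 * ‖ξ‖))).mono'
      (continuous_fourier_of_integrable hmi).aestronglyMeasurable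
      (Filter.Eventually.of_forall fun x => ?_)
  have := hC x ξ
  rw [synthesisCoeff_eq, norm_mul, Complex.norm_exp_ofReal_mul_I, one_mul] at this
  exact this.trans (le_of_eq (by ring))

theorem integral_mul_conj_self {d : ℕ} (f : Rd d → ℂ) :
    ∫ x, f x * starRingEnd ℂ (f x) = ((∫ x, ‖f x‖ ^ 2 : ℝ) : ℂ) := by
  have h3 := integral_ofReal (𝕜 := ℂ) (μ := (volume : Measure (Rd d))) (f := fun ξ => ‖f ξ‖ ^ 2)
  push_cast at h3
  simp only [Complex.mul_conj']
  exact h3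

/-- Integration in `ξ` first is Fourier inversion and returns `𝓕 χ(y) |φ(y - x)|²`; integration in
`x` then gives the L² norm of the window. -/
theorem integral_synthesisCoeff_mul_conjShift {d : ℕ} (φ χ : Sigma1 d) (y : Rd d)
    (hi : Integrable fun p : Rd d × Rd d =>
      synthesisCoeff φ χ p.1 p.2 * (φ.conjShift p.1 p.2).toFun y) :
    ∫ p : Rd d × Rd d, synthesisCoeff φ χ p.1 p.2 * (φ.conjShift p.1 p.2).toFun y =
      ((∫ x, ‖φ.toFun x‖ ^ 2 : ℝ) : ℂ) * 𝓕 χ.toFun y := by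
  rw [Measure.volume_eq_prod, integral_prod _ hi]
  have hinner : ∀ x, ∫ ξ, synthesisCoeff φ χ x ξ * (φ.conjShift x ξ).toFun y =
      φ.toFun (y - x) * starRingEnd ℂ (φ.toFun (y - x)) * 𝓕 χ.toFun y := by
    intro x
    have h1 := fourier_fourierInv_windowed φ χ x y
    rw [Real.fourier_eq'] at h1
    calc _ = ∫ ξ, (Complex.exp ((-2 * π * ⟪ξ, y⟫_ℝ : ℝ) * Complex.I) • synthesisCoeff φ χ x ξ) *
          starRingEnd ℂ (φ.toFun (y - x)) := by
          congr 1
          ext ξ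
          rw [φ.conjShift_apply, smul_eq_mul, real_inner_comm]
          ring
      _ = _ := by
          rw [integral_mul_const, h1]
          ring
  simp only [hinner]
  rw [integral_mul_const, integral_sub_left_eq_self
    (fun x => φ.toFun x * starRingEnd ℂ (φ.toFun x)) volume y, integral_mul_conj_self]

/-- Here `x` is integrated first: the phases from `synthesisCoeff_eq` and `Sigma1.fourier_conjShift`
combine to `e^{-2πi x·η}`, so inversion applies again. Plancherel identifies the constant. -/
theorem integral_synthesisCoeff_mul_fourier_conjShift {d : ℕ} (φ χ : Sigma1 d) (η : Rd d)
    (hi : Integrable fun p : Rd d × Rd d =>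
      synthesisCoeff φ χ p.1 p.2 * 𝓕 (φ.conjShift p.1 p.2).toFun η) :
    ∫ p : Rd d × Rd d, synthesisCoeff φ χ p.1 p.2 * 𝓕 (φ.conjShift p.1 p.2).toFun η =
      ((∫ x, ‖φ.toFun x‖ ^ 2 : ℝ) : ℂ) * 𝓕 (𝓕 χ.toFun) η := by
  rw [Measure.volume_eq_prod, integral_prod_symm _ hi]
  have hinner : ∀ ξ, ∫ x, synthesisCoeff φ χ x ξ * 𝓕 (φ.conjShift x ξ).toFun η =
      𝓕 φ.toFun (-η - ξ) * starRingEnd ℂ (𝓕 φ.toFun (-η - ξ)) * χ.toFun (-η) := by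
    intro ξ
    obtain ⟨h1, h2⟩ := integrable_fourier_windowed φ χ ξ
    have hφ := φ.isSigma1.fourier.continuous
    have hχ := χ.continuous
    have h3 := congrFun (Continuous.fourierInv_fourier_eq (by fun_prop) h1 h2) (-η)
    rw [Real.fourierInv_eq_fourier_neg, neg_neg, Real.fourier_eq'] at h3
    calc _ = ∫ x, (Complex.exp ((-2 * π * ⟪x, η⟫_ℝ : ℝ) * Complex.I) •
            𝓕 (fun η => χ.toFun η * 𝓕 φ.toFun (η - ξ)) x) *
          starRingEnd ℂ (𝓕 φ.toFun (-η - ξ)) := by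
          congr 1
          ext x
          rw [φ.fourier_conjShift, synthesisCoeff_eq, smul_eq_mul,
            show -(η + ξ) = -η - ξ by abel, mul_mul_mul_comm, ← mul_assoc, mul_assoc,
            mul_comm (𝓕 (fun η => χ.toFun η * 𝓕 φ.toFun (η - ξ)) x), ← mul_assoc, ← Complex.exp_add,
            mul_right_comm]
          congr 3
          rw [inner_add_right]
          push_cast
          ring
      _ = _ := by
          rw [integral_mul_const, h3]
          ring
  simp only [hinner]
  rw [integral_mul_const, integral_sub_left_eq_self
    (fun x => 𝓕 φ.toFun x * starRingEnd ℂ (𝓕 φ.toFun x)) volume (-η),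
    integral_mul_conj_self, χ.isSigma1.fourier_fourier,
    integral_norm_sq_fourier φ.continuous φ.integrable φ.isSigma1.fourier.integrable]

/-! ### The inversion formula in the dual -/

theorem integral_synthesis_eq {d : ℕ} {h : ℝ} (hh : 0 < h) (φ χ : Sigma1 d) :
    ∫ p : Rd d × Rd d, synthesisCoeff φ χ p.1 p.2 • Sigma1.embed d hh (φ.conjShift p.1 p.2) =
      ((∫ x, ‖φ.toFun x‖ ^ 2 : ℝ) : ℂ) • Sigma1.embed d hh (Sigma1.fourier d χ) := by
  have hI := integrable_synthesis hh φ χ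
  -- Evaluation at `y` in either component is continuous and linear, so it commutes with the Bochner
  -- integral; the nonzero weight `e^{h‖y‖}` can be divided out.
  refine Prod.ext ?_ ?_ <;> ext y
  · set L : ((Rd d →ᵇ ℂ) × (Rd d →ᵇ ℂ)) →L[ℂ] ℂ :=
      (BoundedContinuousFunction.evalCLM ℂ y).comp (ContinuousLinearMap.fst ℂ _ _)
    have h1 := L.integral_comp_comm hI
    have hLi := L.integrable_comp hI
    have hL : ∀ p : Rd d × Rd d,
        L (synthesisCoeff φ χ p.1 p.2 • Sigma1.embed d hh (φ.conjShift p.1 p.2)) =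
        synthesisCoeff φ χ p.1 p.2 * (φ.conjShift p.1 p.2).toFun y *
          (Real.exp (h * ‖y‖) : ℂ) := fun p => by
      rw [map_smul, smul_eq_mul, mul_assoc]
      rfl
    simp only [hL] at h1 hLi
    have hne : (Real.exp (h * ‖y‖) : ℂ) ≠ 0 := by exact_mod_cast (Real.exp_pos _).ne'
    have hLi' : Integrable fun p : Rd d × Rd d =>
        synthesisCoeff φ χ p.1 p.2 * (φ.conjShift p.1 p.2).toFun y := by
      have := hLi.mul_const (Real.exp (h * ‖y‖) : ℂ)⁻¹
      simpa only [mul_assoc, mul_inv_cancel₀ hne, mul_one] using this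
    rw [integral_mul_const, integral_synthesisCoeff_mul_conjShift φ χ y hLi', mul_assoc] at h1
    exact h1.symm
  · set L : ((Rd d →ᵇ ℂ) × (Rd d →ᵇ ℂ)) →L[ℂ] ℂ :=
      (BoundedContinuousFunction.evalCLM ℂ y).comp (ContinuousLinearMap.snd ℂ _ _)
    have h1 := L.integral_comp_comm hI
    have hLi := L.integrable_comp hI
    have hL : ∀ p : Rd d × Rd d,
        L (synthesisCoeff φ χ p.1 p.2 • Sigma1.embed d hh (φ.conjShift p.1 p.2)) =
        synthesisCoeff φ χ p.1 p.2 * 𝓕 (φ.conjShift p.1 p.2).toFun y *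
          (Real.exp (h * ‖y‖) : ℂ) := fun p => by
      rw [map_smul, smul_eq_mul, mul_assoc]
      rfl
    simp only [hL] at h1 hLi
    have hne : (Real.exp (h * ‖y‖) : ℂ) ≠ 0 := by exact_mod_cast (Real.exp_pos _).ne'
    have hLi' : Integrable fun p : Rd d × Rd d =>
        synthesisCoeff φ χ p.1 p.2 * 𝓕 (φ.conjShift p.1 p.2).toFun y := by
      have := hLi.mul_const (Real.exp (h * ‖y‖) : ℂ)⁻¹
      simpa only [mul_assoc, mul_inv_cancel₀ hne, mul_one] using this
    rw [integral_mul_const, integral_synthesisCoeff_mul_fourier_conjShift φ χ y hLi',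
      mul_assoc] at h1
    exact h1.symm

theorem Sigma1Dual.exists_continuousLinearMap {d : ℕ} (u : Sigma1Dual d) :
    ∃ h : ℝ, ∃ hh : 0 < h, ∃ L : ((Rd d →ᵇ ℂ) × (Rd d →ᵇ ℂ)) →L[ℂ] ℂ,
      ∀ ψ, L (Sigma1.embed d hh ψ) = u ψ := by
  obtain ⟨h, hh, C, hC⟩ := u.exists_norm_le
  exact ⟨h, hh, exists_continuousLinearMap_comp_eq (Sigma1.embed d hh) u.toLinearMap hC⟩

theorem continuous_stft {d : ℕ} (φ : Sigma1 d) (u : Sigma1Dual d) :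
    Continuous fun p : Rd d × Rd d => stft φ u p.1 p.2 := by
  obtain ⟨h, hh, L, hL⟩ := u.exists_continuousLinearMap
  simp only [stft, ← hL]
  exact L.continuous.comp (φ.continuous_embed_conjShift hh)

/-- The extension of `u` to the Banach space passes under the vector-valued integral. Expanding `𝓕
χ` rather than `χ` makes `û(χ) = u(𝓕 χ)` appear directly. -/
theorem integral_synthesisCoeff_mul_stft {d : ℕ} (φ χ : Sigma1 d) (u : Sigma1Dual d) :
    ∫ p : Rd d × Rd d, synthesisCoeff φ χ p.1 p.2 * stft φ u p.1 p.2 =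
      ((∫ x, ‖φ.toFun x‖ ^ 2 : ℝ) : ℂ) * u.fourier χ := by
  obtain ⟨h, hh, L, hL⟩ := u.exists_continuousLinearMap
  have h1 := L.integral_comp_comm (integrable_synthesis hh φ χ)
  rw [integral_synthesis_eq] at h1
  simp only [map_smul, hL, smul_eq_mul] at h1
  exact h1

/-! ### Weighted square integrability -/

theorem integral_norm_sq_pos {d : ℕ} {φ : Sigma1 d} (hφ : φ ≠ 0) : 0 < ∫ x, ‖φ.toFun x‖ ^ 2 := by
  obtain ⟨y, hy⟩ := φ.exists_ne_zero hφ
  obtain ⟨C, hC0, hC⟩ := φ.exists_norm_le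
  have hi := integrable_norm_sq_of_bounded φ.integrable hC
  refine lt_of_le_of_ne (integral_nonneg fun x => by positivity) fun h0 => ?_
  have h1 := (integral_eq_zero_iff_of_nonneg (fun x => by positivity) hi).1 h0.symm
  have h2 := (Continuous.ae_eq_iff_eq volume (φ.continuous.norm.pow 2) continuous_zero).1 h1
  have h3 := congrFun h2 y
  simp only [Pi.zero_apply] at h3
  exact hy (norm_eq_zero.1 (pow_eq_zero_iff two_ne_zero |>.1 h3))

theorem ofReal_exp_mul_ofReal_exp_neg (a : ℝ) :
    ENNReal.ofReal (Real.exp a) * ENNReal.ofReal (Real.exp (-a)) = 1 := by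
  rw [← ENNReal.ofReal_mul (Real.exp_pos _).le, ← Real.exp_add]
  simp

/-- Plancherel in `x` replaces the coefficient by `χ(η) 𝓕 φ(η - ξ)`. Subadditivity moves the weight
from `ξ` to `η` at the cost of `e^{2h‖η-ξ‖^{1/s}}`, which the decay of `𝓕 φ` absorbs into `K`. -/
theorem lintegral_synthesisCoeff_sq_le {d : ℕ} {s h : ℝ} (hs : 1 < s) (hh : 0 < h)
    (φ : Sigma1 d) : ∃ K : ℝ≥0∞, K < ⊤ ∧ ∀ χ : Sigma1 d,
      ∫⁻ ξ : Rd d, ∫⁻ x : Rd d, ‖synthesisCoeff φ χ x ξ‖ₑ ^ 2 *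
        ENNReal.ofReal (Real.exp (-(2 * h) * ‖ξ‖ ^ (1 / s))) ≤
      K * ∫⁻ η : Rd d, ‖χ.toFun η‖ₑ ^ 2 *
        ENNReal.ofReal (Real.exp (-(2 * h) * ‖η‖ ^ (1 / s))) := by
  have hwc : Continuous fun x : Rd d => ‖x‖ ^ (1 / s) := continuous_norm_rpow hs.le
  have hφc := φ.isSigma1.fourier.continuous
  refine ⟨∫⁻ t : Rd d, ‖𝓕 φ.toFun t‖ₑ ^ 2 * ENNReal.ofReal (Real.exp (2 * h * ‖t‖ ^ (1 / s))),
    ?_, fun χ => ?_⟩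
  · obtain ⟨C, hC0, hC⟩ := (φ.isSigma1.fourier.weightBound hs.le
      (show 0 < 2 * h by linarith)).exists_norm_le
    have hi := (integrable_exp_neg_rpow (d := d) hs.le (show 0 < 2 * h by linarith)).const_mul
      (C ^ 2)
    refine lt_of_le_of_lt (lintegral_mono fun t => ?_) hi.lintegral_lt_top
    rw [← ofReal_norm, ← ENNReal.ofReal_pow (norm_nonneg _),
      ← ENNReal.ofReal_mul (by positivity)]
    refine ENNReal.ofReal_le_ofReal ?_
    calc ‖𝓕 φ.toFun t‖ ^ 2 * Real.exp (2 * h * ‖t‖ ^ (1 / s)) ≤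
          (C * Real.exp (-(2 * h) * ‖t‖ ^ (1 / s))) ^ 2 * Real.exp (2 * h * ‖t‖ ^ (1 / s)) := by
          gcongr
          exact hC t
      _ = C ^ 2 * Real.exp (-(2 * h) * ‖t‖ ^ (1 / s)) := by
          rw [mul_pow, ← Real.exp_nat_mul, mul_assoc, ← Real.exp_add]
          push_cast
          ring_nf
  have hχc := χ.continuous
  obtain ⟨C, hC0, hC⟩ := χ.exists_norm_le
  have hx : ∀ ξ : Rd d, ∫⁻ x : Rd d, ‖synthesisCoeff φ χ x ξ‖ₑ ^ 2 *
        ENNReal.ofReal (Real.exp (-(2 * h) * ‖ξ‖ ^ (1 / s))) =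
      ∫⁻ η : Rd d, ‖χ.toFun η‖ₑ ^ 2 * ‖𝓕 φ.toFun (η - ξ)‖ₑ ^ 2 *
        ENNReal.ofReal (Real.exp (-(2 * h) * ‖ξ‖ ^ (1 / s))) := by
    intro ξ
    obtain ⟨h1, h2⟩ := integrable_fourier_windowed φ χ ξ
    rw [lintegral_mul_const' _ _ ENNReal.ofReal_ne_top,
      lintegral_mul_const' _ _ ENNReal.ofReal_ne_top]
    congr 1
    have he : ∀ x, ‖synthesisCoeff φ χ x ξ‖ₑ =
        ‖𝓕 (fun η => χ.toFun η * 𝓕 φ.toFun (η - ξ)) x‖ₑ := fun x => by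
      rw [synthesisCoeff_eq, ← ofReal_norm, norm_mul, Complex.norm_exp_ofReal_mul_I, one_mul,
        ofReal_norm]
    simp only [he]
    rw [lintegral_enorm_sq_fourier (C := C * ∫ y, ‖φ.toFun y‖) (by fun_prop) h1 h2 fun x => ?_]
    · simp only [enorm_mul, mul_pow]
    · rw [norm_mul]
      exact mul_le_mul (hC x) (norm_fourier_le_integral _ _) (norm_nonneg _) hC0.le
  simp only [hx]
  rw [lintegral_lintegral_swap (Measurable.aemeasurable (by
    simp only [Function.uncurry_def]
    fun_prop)), ← lintegral_const_mul _ (by fun_prop)]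
  refine lintegral_mono fun η => ?_
  have hpt : ∀ ξ : Rd d, ‖χ.toFun η‖ₑ ^ 2 * ‖𝓕 φ.toFun (η - ξ)‖ₑ ^ 2 *
        ENNReal.ofReal (Real.exp (-(2 * h) * ‖ξ‖ ^ (1 / s))) ≤
      (‖χ.toFun η‖ₑ ^ 2 * ENNReal.ofReal (Real.exp (-(2 * h) * ‖η‖ ^ (1 / s)))) *
        (‖𝓕 φ.toFun (η - ξ)‖ₑ ^ 2 *
          ENNReal.ofReal (Real.exp (2 * h * ‖η - ξ‖ ^ (1 / s)))) := by
    intro ξ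
    rw [mul_mul_mul_comm, ← ENNReal.ofReal_mul (Real.exp_pos _).le, ← Real.exp_add]
    gcongr
    nlinarith [norm_rpow_le_add hs.le η ξ]
  refine (lintegral_mono hpt).trans (le_of_eq ?_)
  rw [lintegral_const_mul' _ _
      (ENNReal.mul_ne_top (ENNReal.pow_ne_top enorm_ne_top) ENNReal.ofReal_ne_top),
    lintegral_sub_left_eq_self (fun t : Rd d =>
    ‖𝓕 φ.toFun t‖ₑ ^ 2 * ENNReal.ofReal (Real.exp (2 * h * ‖t‖ ^ (1 / s)))) η, mul_comm]

/-- Cauchy-Schwarz in the inversion formula, with `e^{h‖ξ‖^{1/s}}` put on the short-time Fourier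
transform and its inverse on the coefficients. -/
theorem enorm_fourier_dual_le {d : ℕ} {s h : ℝ} (hs : 1 < s) (hh : 0 < h) {φ : Sigma1 d}
    (hφ : φ ≠ 0) {u : Sigma1Dual d} (hu : u ∈ coorbit φ h s) :
    ∃ K : ℝ≥0∞, K < ⊤ ∧ ∀ χ : Sigma1 d, ‖u.fourier χ‖ₑ ≤ K * (∫⁻ η : Rd d, ‖χ.toFun η‖ₑ ^ 2 *
        ENNReal.ofReal (Real.exp (-(2 * h) * ‖η‖ ^ (1 / s)))) ^ (1 / 2 : ℝ) := by
  obtain ⟨K, hK, hKχ⟩ := lintegral_synthesisCoeff_sq_le hs hh φ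
  have hwc : Continuous fun x : Rd d => ‖x‖ ^ (1 / s) := continuous_norm_rpow hs.le
  have hA := integral_norm_sq_pos hφ
  set A := ∫ x, ‖φ.toFun x‖ ^ 2
  set N := ∫⁻ ξ : Rd d, (∫⁻ x : Rd d, ‖stft φ u x ξ‖ₑ ^ 2) *
    ENNReal.ofReal (Real.exp (2 * h * ‖ξ‖ ^ (1 / s)))
  have hN : N < ⊤ := hu
  have hVc := continuous_stft φ u
  refine ⟨ENNReal.ofReal A⁻¹ * (N ^ (1 / 2 : ℝ) * K ^ (1 / 2 : ℝ)), ?_, fun χ => ?_⟩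
  · exact ENNReal.mul_lt_top ENNReal.ofReal_lt_top (ENNReal.mul_lt_top
      (ENNReal.rpow_lt_top_of_nonneg (by norm_num) hN.ne)
      (ENNReal.rpow_lt_top_of_nonneg (by norm_num) hK.ne))
  have hWc := continuous_synthesisCoeff φ χ
  have h1 := integral_synthesisCoeff_mul_stft φ χ u
  have h2 : u.fourier χ = (A⁻¹ : ℝ) *
      ∫ p : Rd d × Rd d, synthesisCoeff φ χ p.1 p.2 * stft φ u p.1 p.2 := by
    rw [h1, ← mul_assoc, ← Complex.ofReal_mul, inv_mul_cancel₀ hA.ne', Complex.ofReal_one, one_mul]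
  have h3 : ‖((A⁻¹ : ℝ) : ℂ)‖ₑ = ENNReal.ofReal A⁻¹ := by
    rw [← ofReal_norm, Complex.norm_real, Real.norm_of_nonneg (inv_nonneg.2 hA.le)]
  rw [h2, enorm_mul, h3, mul_assoc]
  refine mul_le_mul_right ((enorm_integral_le_lintegral_enorm _).trans ?_) _
  set F : Rd d × Rd d → ℝ≥0∞ := fun p =>
    ‖stft φ u p.1 p.2‖ₑ * ENNReal.ofReal (Real.exp (h * ‖p.2‖ ^ (1 / s)))
  set G : Rd d × Rd d → ℝ≥0∞ := fun p =>
    ‖synthesisCoeff φ χ p.1 p.2‖ₑ * ENNReal.ofReal (Real.exp (-(h * ‖p.2‖ ^ (1 / s))))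
  have hwc2 : Continuous fun p : Rd d × Rd d => ‖p.2‖ ^ (1 / s) := hwc.comp continuous_snd
  have hF : Measurable F := hVc.measurable.enorm.mul (by fun_prop)
  have hG : Measurable G := hWc.measurable.enorm.mul (by fun_prop)
  have hsq : ∀ a b : ℝ, (ENNReal.ofReal (Real.exp (a * b))) ^ (2 : ℝ) =
      ENNReal.ofReal (Real.exp (2 * a * b)) := by
    intro a b
    rw [ENNReal.rpow_two, ← ENNReal.ofReal_pow (Real.exp_pos _).le, ← Real.exp_nat_mul]
    push_cast
    ring_nf
  have hFG := ENNReal.lintegral_mul_le_Lp_mul_Lq volume (Real.HolderConjugate.two_two)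
    hF.aemeasurable hG.aemeasurable
  have hFN : ∫⁻ p, F p ^ (2 : ℝ) = N := by
    rw [Measure.volume_eq_prod, lintegral_prod_symm' _ (by fun_prop)]
    refine lintegral_congr fun ξ => ?_
    rw [← lintegral_mul_const' _ _ ENNReal.ofReal_ne_top]
    refine lintegral_congr fun x => ?_
    simp only [F]
    rw [ENNReal.mul_rpow_of_nonneg _ _ (by norm_num), hsq, ENNReal.rpow_two]
  have hGN : ∫⁻ p, G p ^ (2 : ℝ) ≤ K * ∫⁻ η : Rd d, ‖χ.toFun η‖ₑ ^ 2 *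
        ENNReal.ofReal (Real.exp (-(2 * h) * ‖η‖ ^ (1 / s))) := by
    refine le_trans (le_of_eq ?_) (hKχ χ)
    rw [Measure.volume_eq_prod, lintegral_prod_symm' _ (by fun_prop)]
    refine lintegral_congr fun ξ => lintegral_congr fun x => ?_
    simp only [G]
    rw [ENNReal.mul_rpow_of_nonneg _ _ (by norm_num), ← neg_mul, hsq, ENNReal.rpow_two]
    ring_nf
  calc ∫⁻ p : Rd d × Rd d, ‖synthesisCoeff φ χ p.1 p.2 * stft φ u p.1 p.2‖ₑ
      = ∫⁻ p, (F * G) p := by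
        refine lintegral_congr fun p => ?_
        simp only [F, G, Pi.mul_apply, enorm_mul]
        rw [mul_mul_mul_comm, ofReal_exp_mul_ofReal_exp_neg, mul_one, mul_comm]
    _ ≤ _ := hFG
    _ ≤ N ^ (1 / 2 : ℝ) * (K * ∫⁻ η : Rd d, ‖χ.toFun η‖ₑ ^ 2 *
        ENNReal.ofReal (Real.exp (-(2 * h) * ‖η‖ ^ (1 / s)))) ^ (1 / 2 : ℝ) := by
        rw [hFN]
        gcongr
    _ = _ := by
        rw [ENNReal.mul_rpow_of_nonneg _ _ (by norm_num), mul_assoc]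

/-! ### Representation by weighted square integrable functions -/

theorem memLp_two_pow_mul_exp_neg_rpow {d : ℕ} {s h : ℝ} (hs : 1 ≤ s) (hh : 0 < h) (n : ℕ) :
    MemLp (fun x : Rd d => ‖x‖ ^ n * Real.exp (-h * ‖x‖ ^ (1 / s))) 2 := by
  have hc : Continuous fun x : Rd d => ‖x‖ ^ (1 / s) := continuous_norm_rpow hs
  rw [memLp_two_iff_integrable_sq (Continuous.aestronglyMeasurable (by fun_prop))]
  refine (integrable_pow_mul_exp_neg_rpow (d := d) hs (show 0 < 2 * h by linarith)
    (n * 2)).congr (Filter.Eventually.of_forall fun x => ?_)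
  simp only
  rw [mul_pow, ← pow_mul, ← Real.exp_nat_mul]
  push_cast
  ring_nf

theorem MemLp.integrable_pow_mul_exp_neg_rpow {d : ℕ} {s h : ℝ} (hs : 1 ≤ s) (hh : 0 < h)
    {g : Rd d → ℂ} (hg : MemLp g 2) (n : ℕ) :
    Integrable fun x => ‖x‖ ^ n * ‖g x * (Real.exp (-h * ‖x‖ ^ (1 / s)) : ℂ)‖ := by
  refine (hg.norm.integrable_mul (memLp_two_pow_mul_exp_neg_rpow hs hh n)).congr
    (Filter.Eventually.of_forall fun x => ?_)
  simp only [Pi.mul_apply]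
  rw [norm_mul, Complex.norm_real, Real.norm_of_nonneg (Real.exp_pos _).le]
  ring

theorem MemLp.aestronglyMeasurable_mul_exp_neg_rpow {d : ℕ} {s h : ℝ} (hs : 1 ≤ s)
    {g : Rd d → ℂ} (hg : MemLp g 2) :
    AEStronglyMeasurable fun x => g x * (Real.exp (-h * ‖x‖ ^ (1 / s)) : ℂ) := by
  have hc : Continuous fun x : Rd d => ‖x‖ ^ (1 / s) := continuous_norm_rpow hs
  exact hg.aestronglyMeasurable.mul (Continuous.aestronglyMeasurable (by fun_prop))

theorem MemLp.integrable_mul_exp_neg_rpow {d : ℕ} {s h : ℝ} (hs : 1 ≤ s) (hh : 0 < h)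
    {g : Rd d → ℂ} (hg : MemLp g 2) :
    Integrable fun x => g x * (Real.exp (-h * ‖x‖ ^ (1 / s)) : ℂ) := by
  have := MemLp.integrable_pow_mul_exp_neg_rpow hs hh hg 0
  simp only [pow_zero, one_mul] at this
  exact (integrable_norm_iff (MemLp.aestronglyMeasurable_mul_exp_neg_rpow hs hg)).1 this

theorem Sigma1.memLp_weighted {d : ℕ} {s h : ℝ} (hs : 1 ≤ s) (hh : 0 < h) (χ : Sigma1 d) :
    MemLp (fun x => χ.toFun x * (Real.exp (-h * ‖x‖ ^ (1 / s)) : ℂ)) 2 := by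
  have hc : Continuous fun x : Rd d => ‖x‖ ^ (1 / s) := continuous_norm_rpow hs
  have hχ := χ.continuous
  obtain ⟨C, hC0, hC⟩ := χ.exists_norm_le
  rw [memLp_two_iff_integrable_sq_norm (Continuous.aestronglyMeasurable (by fun_prop))]
  have hb : ∀ x : Rd d, ‖(Real.exp (-h * ‖x‖ ^ (1 / s)) : ℂ)‖ ≤ 1 := fun x => by
    rw [Complex.norm_real, Real.norm_of_nonneg (Real.exp_pos _).le, Real.exp_le_one_iff, neg_mul,
      neg_nonpos]
    positivity
  refine integrable_norm_sq_of_bounded (C := C)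
    (χ.integrable.mul_bdd (c := 1) (Continuous.aestronglyMeasurable (by fun_prop))
      (Filter.Eventually.of_forall hb)) fun x => ?_
  rw [norm_mul]
  exact (mul_le_mul (hC x) (hb x) (norm_nonneg _) hC0.le).trans (mul_one C).le

/-- The map `χ ↦ e^{-h ‖x‖ ^ (1 / s)} χ` from `Σ_1` to `L²`. -/
def Sigma1.weightedL2 (d : ℕ) {s h : ℝ} (hs : 1 ≤ s) (hh : 0 < h) :
    Sigma1 d →ₗ[ℂ] Lp ℂ 2 (volume : Measure (Rd d)) where
  toFun χ := (χ.memLp_weighted hs hh).toLp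
  map_add' χ ψ := by
    rw [← MemLp.toLp_add]
    exact MemLp.toLp_congr _ _ (Filter.Eventually.of_forall fun x => add_mul _ _ _)
  map_smul' c χ := by
    rw [RingHom.id_apply, ← MemLp.toLp_const_smul]
    exact MemLp.toLp_congr _ _ (Filter.Eventually.of_forall fun x => mul_assoc _ _ _)

theorem Sigma1.enorm_weightedL2 {d : ℕ} {s h : ℝ} (hs : 1 ≤ s) (hh : 0 < h) (χ : Sigma1 d) :
    ‖Sigma1.weightedL2 d hs hh χ‖ₑ = (∫⁻ η : Rd d, ‖χ.toFun η‖ₑ ^ 2 *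
        ENNReal.ofReal (Real.exp (-(2 * h) * ‖η‖ ^ (1 / s)))) ^ (1 / 2 : ℝ) := by
  change ‖(χ.memLp_weighted hs hh).toLp‖ₑ = _
  rw [Lp.enorm_toLp, eLpNorm_eq_lintegral_rpow_enorm_toReal two_ne_zero ENNReal.ofNat_ne_top]
  simp only [ENNReal.toReal_ofNat, ENNReal.rpow_two]
  congr 1
  refine lintegral_congr fun η => ?_
  rw [enorm_mul, mul_pow]
  congr 1
  rw [← ofReal_norm, Complex.norm_real, Real.norm_of_nonneg (Real.exp_pos _).le,
    ← ENNReal.ofReal_pow (Real.exp_pos _).le, ← Real.exp_nat_mul]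
  push_cast
  ring_nf

theorem exists_memLp_represents_of_mem_coorbit {d : ℕ} {s h : ℝ} (hs : 1 < s) (hh : 0 < h)
    {φ : Sigma1 d} (hφ : φ ≠ 0) {u : Sigma1Dual d} (hu : u ∈ coorbit φ h s) :
    ∃ g : Rd d → ℂ, MemLp g 2 ∧
      Represents (fun x => g x * (Real.exp (-h * ‖x‖ ^ (1 / s)) : ℂ)) u.fourier := by
  obtain ⟨K, hK, hKχ⟩ := enorm_fourier_dual_le hs hh hφ hu
  obtain ⟨L, hL⟩ := exists_continuousLinearMap_comp_eq (Sigma1.weightedL2 d hs.le hh)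
    u.fourier.toLinearMap (C := K.toReal) fun χ => by
      have h1 := hKχ χ
      rw [← Sigma1.enorm_weightedL2 hs.le hh] at h1
      have h2 := ENNReal.toReal_mono (ENNReal.mul_lt_top hK enorm_lt_top).ne h1
      rwa [ENNReal.toReal_mul, toReal_enorm, toReal_enorm] at h2
  -- The Riesz vector enters the inner product conjugated, so its conjugate is the required `g`.
  set g₀ := (InnerProductSpace.toDual ℂ (Lp ℂ 2 (volume : Measure (Rd d)))).symm L
  have hg : MemLp (fun x => starRingEnd ℂ (g₀ x)) 2 := (Lp.memLp g₀).star
  have hgi := MemLp.integrable_mul_exp_neg_rpow hs.le hh hg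
  refine ⟨_, hg, hgi.locallyIntegrable, fun χ => ?_⟩
  obtain ⟨C, hC0, hC⟩ := χ.exists_norm_le
  refine ⟨hgi.mul_bdd (c := C) χ.continuous.aestronglyMeasurable
    (Filter.Eventually.of_forall hC), ?_⟩
  have h1 : L (Sigma1.weightedL2 d hs.le hh χ) = u.fourier χ := hL χ
  rw [← h1, ← InnerProductSpace.toDual_symm_apply, L2.inner_def]
  refine integral_congr_ae ?_
  filter_upwards [(χ.memLp_weighted hs.le hh).coeFn_toLp] with x hx
  change inner ℂ (g₀ x) ((χ.memLp_weighted hs.le hh).toLp _ x) = _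
  rw [hx, RCLike.inner_apply]
  ring

/-! ### Pointwise bounds -/

theorem norm_fourier_sub_le {d : ℕ} {f : Rd d → ℂ} (hf : Integrable f)
    (hf' : Integrable fun v => ‖v‖ * ‖f v‖) (x y : Rd d) :
    ‖𝓕 f x - 𝓕 f y‖ ≤ (2 * π * ∫ v, ‖v‖ * ‖f v‖) * ‖x - y‖ := by
  refine Convex.norm_image_sub_le_of_norm_fderiv_le (𝕜 := ℝ) (s := Set.univ)
    (fun z _ => (Real.differentiable_fourier hf hf') z) (fun z _ => ?_) convex_univ
    (Set.mem_univ y) (Set.mem_univ x)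
  rw [Real.fderiv_fourier hf hf', ← integral_const_mul]
  refine (VectorFourier.norm_fourierIntegral_le_integral_norm _ _ _ _ _).trans ?_
  refine integral_mono_of_nonneg (Filter.Eventually.of_forall fun _ => norm_nonneg _)
    (hf'.const_mul _) (Filter.Eventually.of_forall fun v => ?_)
  refine (VectorFourier.norm_fourierSMulRight_le _ _ _).trans ?_
  simp only [← mul_assoc]
  exact mul_le_mul_of_nonneg_right (mul_le_mul_of_nonneg_right
    (mul_le_of_le_one_right (by positivity) (norm_innerSL_le ℝ)) (norm_nonneg _)) (norm_nonneg _)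

/-- If `|k(x)| = a > 0`, then `|k| ≥ a/2` on a ball of radius proportional to `a`, where the weight
changes by a bounded factor. The L² norm of `g` there forces `a^{d+2} e^{2h‖x‖^{1/s}}` to be
bounded: `a²` from the integrand, `a^d` from the volume. -/
theorem weightBound_of_lipschitz_of_memLp {d : ℕ} {s h : ℝ} (hs : 1 ≤ s) (hh : 0 < h)
    {k g : Rd d → ℂ} {L M : ℝ} (hL : ∀ x y, ‖k x - k y‖ ≤ L * ‖x - y‖) (hM : ∀ x, ‖k x‖ ≤ M)
    (hg : MemLp g 2) (hkg : ∀ᵐ x, k x = g x * (Real.exp (-h * ‖x‖ ^ (1 / s)) : ℂ)) :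
    WeightBound s (2 * h / (d + 2)) k := by
  have hs0 : 0 < s := by linarith
  have hM0 : 0 ≤ M := (norm_nonneg _).trans (hM 0)
  -- `Λ ≥ L` gives the lower bound `a/2` on the ball, `Λ ≥ M` keeps its radius at most 1, and the
  -- summand 1 makes `Λ` positive.
  set Λ := |L| + M + 1
  have hΛ : 0 < Λ := by positivity
  have hLΛ : L ≤ Λ := (le_abs_self L).trans (by simp only [Λ]; linarith)
  have hMΛ : M ≤ Λ := by simp only [Λ]; linarith [abs_nonneg L]
  set N := ∫ x, ‖g x‖ ^ 2
  have hgi : Integrable fun x => ‖g x‖ ^ 2 :=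
    (memLp_two_iff_integrable_sq_norm hg.aestronglyMeasurable).1 hg
  set β := volume.real (Metric.ball (0 : Rd d) 1)
  have hβ : 0 < β := ENNReal.toReal_pos (Metric.measure_ball_pos volume _ one_pos).ne'
    measure_ball_lt_top.ne
  have hN : 0 ≤ N := integral_nonneg fun x => by positivity
  set C₀ := N * (2 * Λ) ^ d * 4 * Real.exp (2 * h) / β
  have key : ∀ x, ‖k x‖ ^ (d + 2) * Real.exp (2 * h * ‖x‖ ^ (1 / s)) ≤ C₀ := by
    intro x
    rcases (norm_nonneg (k x)).eq_or_lt with ha0 | ha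
    · rw [← ha0, zero_pow (by omega), zero_mul]
      positivity
    set a := ‖k x‖
    set r := a / (2 * Λ)
    have hr : 0 < r := by positivity
    have hr1 : r ≤ 1 := by
      rw [div_le_one (by positivity)]
      linarith [hM x]
    set c := (a / 2) ^ 2 * Real.exp (2 * h * ‖x‖ ^ (1 / s) - 2 * h)
    have hball : ∀ᵐ y, y ∈ Metric.ball x r → c ≤ ‖g y‖ ^ 2 := by
      filter_upwards [hkg] with y hy hyr
      rw [mem_ball_iff_norm, norm_sub_rev] at hyr
      have h1 : a / 2 ≤ ‖k y‖ := by
        have h2 := hL x y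
        have h3 : L * ‖x - y‖ ≤ Λ * r := by gcongr
        have h4 : Λ * r = a / 2 := by simp only [r]; field_simp
        have h5 : a ≤ ‖k x - k y‖ + ‖k y‖ := by simpa using norm_add_le (k x - k y) (k y)
        linarith
      have hw : ‖x‖ ^ (1 / s) ≤ 1 + ‖y‖ ^ (1 / s) := by
        refine (norm_rpow_le_add hs x y).trans ?_
        gcongr
        exact Real.rpow_le_one (norm_nonneg _) (hyr.le.trans hr1) (by positivity)
      have hgy : ‖g y‖ = ‖k y‖ * Real.exp (h * ‖y‖ ^ (1 / s)) := by
        rw [hy, norm_mul, Complex.norm_real, Real.norm_of_nonneg (Real.exp_pos _).le, mul_assoc,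
          ← Real.exp_add]
        simp
      rw [hgy, mul_pow, ← Real.exp_nat_mul]
      refine mul_le_mul (pow_le_pow_left₀ (by positivity) h1 2) (Real.exp_le_exp.2 ?_)
        (Real.exp_pos _).le (by positivity)
      push_cast
      nlinarith
    have hint : c * volume.real (Metric.ball x r) ≤ N := by
      have h1 : ∫ _y in Metric.ball x r, c ≤ ∫ y in Metric.ball x r, ‖g y‖ ^ 2 := by
        refine integral_mono_ae (integrableOn_const measure_ball_lt_top.ne) hgi.integrableOn ?_
        exact (ae_restrict_iff' measurableSet_ball).2 hball
      rw [setIntegral_const, smul_eq_mul] at h1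
      have h2 : ∫ y in Metric.ball x r, ‖g y‖ ^ 2 ≤ N :=
        setIntegral_le_integral hgi (Filter.Eventually.of_forall fun y => by positivity)
      linarith
    have hvol : volume.real (Metric.ball x r) = r ^ d * β := by
      rw [Measure.real, Measure.addHaar_ball_of_pos _ _ hr, ENNReal.toReal_mul,
        ENNReal.toReal_ofReal (by positivity)]
      simp [β, Measure.real]
    rw [hvol] at hint
    rw [le_div_iff₀ hβ]
    have hexp : Real.exp (2 * h * ‖x‖ ^ (1 / s)) =
        Real.exp (2 * h * ‖x‖ ^ (1 / s) - 2 * h) * Real.exp (2 * h) := by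
      rw [← Real.exp_add]
      ring_nf
    have har : a ^ d = r ^ d * (2 * Λ) ^ d := by
      rw [← mul_pow]
      congr 1
      simp only [r]
      field_simp
    calc a ^ (d + 2) * Real.exp (2 * h * ‖x‖ ^ (1 / s)) * β
        = (c * (r ^ d * β)) * ((2 * Λ) ^ d * 4 * Real.exp (2 * h)) := by
          rw [pow_add, har, hexp]
          simp only [c]
          ring
      _ ≤ N * ((2 * Λ) ^ d * 4 * Real.exp (2 * h)) := by gcongr
      _ = _ := by ring
  -- A constant at least 1 is bounded by its own power of order `d + 2`, so no root is needed.
  refine ⟨max 1 C₀, fun x => ?_⟩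
  have h1 := key x
  refine le_of_pow_le_pow_left₀ (n := d + 2) (by omega) (by positivity) ?_
  calc (‖k x‖ * Real.exp (2 * h / (d + 2) * ‖x‖ ^ (1 / s))) ^ (d + 2)
      = ‖k x‖ ^ (d + 2) * Real.exp (2 * h * ‖x‖ ^ (1 / s)) := by
        rw [mul_pow, ← Real.exp_nat_mul]
        congr 2
        push_cast
        field_simp
    _ ≤ max 1 C₀ := h1.trans (le_max_right _ _)
    _ ≤ max 1 C₀ ^ (d + 2) := le_self_pow₀ (le_max_left _ _) (by omega)

theorem exists_gevreyDecay_of_mem_coorbit {d : ℕ} {s h : ℝ} (hs : 1 < s) (hh : 0 < h)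
    {φ : Sigma1 d} (hφ : φ ≠ 0) {u : Sigma1Dual d} (hu : u ∈ coorbit φ h s)
    (hu' : u ∈ fourierCoorbit φ h s) :
    ∃ f : Rd d → ℂ, Represents f u ∧ GevreyDecay s (2 * h / (d + 2)) f := by
  have hr : 0 < 2 * h / ((d : ℝ) + 2) := by positivity
  obtain ⟨g₁, hg₁, hF⟩ := exists_memLp_represents_of_mem_coorbit hs hh hφ hu
  obtain ⟨g₂, hg₂, hG⟩ := exists_memLp_represents_of_mem_coorbit hs hh hφ hu'
  set F : Rd d → ℂ := fun x => g₁ x * (Real.exp (-h * ‖x‖ ^ (1 / s)) : ℂ)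
  have hFi : Integrable F := MemLp.integrable_mul_exp_neg_rpow hs.le hh hg₁
  have hFi1 : Integrable fun v => ‖v‖ * ‖F v‖ := by
    simpa only [pow_one] using MemLp.integrable_pow_mul_exp_neg_rpow hs.le hh hg₁ 1
  -- Both functions represent the second transform of `u`. The left one is Lipschitz and bounded,
  -- the right one carries the L² weight.
  have hk := (hF.fourier hFi).ae_eq hφ hG
  have hkw : WeightBound s (2 * h / (d + 2)) (𝓕 F) :=
    weightBound_of_lipschitz_of_memLp hs.le hh (norm_fourier_sub_le hFi hFi1)
      (norm_fourier_le_integral F) hg₂ hk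
  have hfu := hF.fourierInv hFi
  have hfc := continuous_fourierInv_of_integrable hFi
  have hfw : WeightBound s (2 * h / (d + 2)) (𝓕⁻ F) := by
    obtain ⟨C, hC⟩ := hkw
    refine ⟨C, fun x => ?_⟩
    rw [Real.fourierInv_eq_fourier_neg, ← norm_neg x]
    exact hC (-x)
  have hfi := hfw.integrable hs.le hr hfc.aestronglyMeasurable
  have hfi1 : Integrable fun v => ‖v‖ * ‖𝓕⁻ F v‖ := by
    simpa using hfw.integrable_pow hs.le hr hfc.aestronglyMeasurable 1
  refine ⟨_, hfu, hfc, hfw, ?_⟩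
  -- The decay just obtained for `𝓕⁻ F` makes its transform Lipschitz, so the same argument applies
  -- to `𝓕 (𝓕⁻ F)`, equal to `F` almost everywhere.
  exact weightBound_of_lipschitz_of_memLp hs.le hh (norm_fourier_sub_le hfi hfi1)
    (norm_fourier_le_integral _) hg₁ ((hfu.fourier hfi).ae_eq hφ hF)

/-! ### The main theorem -/

theorem decayConst_pos (d : ℕ) {s : ℝ} (hs : 1 < s) : 0 < decayConst d s := by
  have : 0 < s := by linarith
  unfold decayConst
  positivity

/-- For the Beurling case: every norm parameter is reached by some rate of decay. -/
theorem exists_decayConst_mul_eq (d : ℕ) {s H : ℝ} (hs : 1 < s) (hH : 0 < H) :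
    ∃ h : ℝ, 0 < h ∧ decayConst d s * h ^ (-s) = H := by
  have hK := decayConst_pos d hs
  have hs0 : s ≠ 0 := by linarith
  refine ⟨(H / decayConst d s) ^ (-(1 / s)), by positivity, ?_⟩
  rw [← Real.rpow_mul (by positivity), neg_mul_neg, one_div_mul_cancel hs0, Real.rpow_one]
  field_simp

theorem exists_decayRate_eq (d : ℕ) {s h : ℝ} (hs : 1 < s) (hh : 0 < h) :
    ∃ H : ℝ, 0 < H ∧ decayRate d s H = h := by
  have hs0 : s ≠ 0 := by linarith
  have hs1 : 0 < s := by linarith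
  refine ⟨(h / (s / 2)) ^ (-s) / (d + 1), by positivity, ?_⟩
  unfold decayRate
  rw [mul_div_cancel₀ _ (by positivity), ← Real.rpow_mul (by positivity), neg_mul_neg,
    mul_one_div_cancel hs0, Real.rpow_one]
  field_simp

theorem GevreyDecay.eq_of_represents {d : ℕ} {φ : Sigma1 d} (hφ : φ ≠ 0) {u : Sigma1Dual d}
    {s h h' : ℝ} {f g : Rd d → ℂ} (hf : GevreyDecay s h f) (hg : GevreyDecay s h' g)
    (hfu : Represents f u) (hgu : Represents g u) : f = g :=
  (Continuous.ae_eq_iff_eq volume hf.continuous hg.continuous).1 (hfu.ae_eq hφ hgu)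

end

theorem theorem2p5 (d : ℕ) (s : ℝ) (hs : 1 < s) (φ : Sigma1 d) (hφ : φ ≠ 0)
    (u : Sigma1Dual d) :
    -- the Roumieu case
    [ ∃ f : Rd d → ℂ, Represents f u ∧ f ∈ roumieuGS d s,
      ∃ f : Rd d → ℂ, Represents f u ∧
        ∃ h : ℝ, 0 < h ∧ WeightBound s h f ∧ WeightBound s h (𝓕 f),
      ∃ h : ℝ, 0 < h ∧ u ∈ coorbit φ h s ∩ fourierCoorbit φ h s ].TFAE ∧
    -- the Beurling case
    [ ∃ f : Rd d → ℂ, Represents f u ∧ f ∈ beurlingGS d s,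
      ∃ f : Rd d → ℂ, Represents f u ∧
        ∀ h : ℝ, 0 < h → WeightBound s h f ∧ WeightBound s h (𝓕 f),
      ∀ h : ℝ, 0 < h → u ∈ coorbit φ h s ∩ fourierCoorbit φ h s ].TFAE := by
  constructor
  · tfae_have 1 → 2 := by
      rintro ⟨f, hfu, hf, H, hH, hgs⟩
      have : 0 < s := by linarith
      exact ⟨f, hfu, decayRate d s H, by unfold decayRate; positivity,
        weightBound_of_gsNorm_lt_top hs hH hf hgs⟩
    tfae_have 2 → 1 := by
      rintro ⟨f, hfu, h, hh, hf1, hf2⟩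
      obtain ⟨hgu, hg⟩ := hfu.gevreyDecay hφ hs.le hh hf1 hf2
      have := decayConst_pos d hs
      exact ⟨_, hgu, hg.contDiff hs.le hh, _, by positivity, hg.gsNorm_lt_top hs hh⟩
    tfae_have 2 → 3 := by
      rintro ⟨f, hfu, h, hh, hf1, hf2⟩
      obtain ⟨hgu, hg⟩ := hfu.gevreyDecay hφ hs.le hh hf1 hf2
      exact ⟨h / 4, by positivity, hg.mem_coorbit_inter hs.le hh hgu φ⟩
    tfae_have 3 → 2 := by
      rintro ⟨h, hh, hu1, hu2⟩
      obtain ⟨f, hfu, hf⟩ := exists_gevreyDecay_of_mem_coorbit hs hh hφ hu1 hu2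
      exact ⟨f, hfu, _, by positivity, hf.weightBound, hf.weightBound_fourier⟩
    tfae_finish
  · tfae_have 1 → 2 := by
      rintro ⟨f, hfu, hf, hgs⟩
      refine ⟨f, hfu, fun h hh => ?_⟩
      obtain ⟨H, hH, rfl⟩ := exists_decayRate_eq d hs hh
      exact weightBound_of_gsNorm_lt_top hs hH hf (hgs H hH)
    tfae_have 2 → 1 := by
      rintro ⟨f, hfu, hf⟩
      have hg := fun (h : ℝ) (hh : 0 < h) => hfu.gevreyDecay hφ hs.le hh (hf h hh).1 (hf h hh).2
      refine ⟨_, (hg 1 one_pos).1, (hg 1 one_pos).2.contDiff hs.le one_pos, fun H hH => ?_⟩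
      obtain ⟨h, hh, rfl⟩ := exists_decayConst_mul_eq d hs hH
      exact (hg h hh).2.gsNorm_lt_top hs hh
    tfae_have 2 → 3 := by
      rintro ⟨f, hfu, hf⟩ h hh
      -- Starting from `4 * h` offsets the loss of a factor 4 in `GevreyDecay.mem_coorbit`.
      obtain ⟨hgu, hg⟩ := hfu.gevreyDecay hφ hs.le (show 0 < 4 * h by linarith)
        (hf _ (by linarith)).1 (hf _ (by linarith)).2
      have := hg.mem_coorbit_inter hs.le (by linarith) hgu φ
      rwa [mul_div_cancel_left₀ h (by norm_num : (4 : ℝ) ≠ 0)] at this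
    tfae_have 3 → 2 := by
      intro hu
      have hex : ∀ h : ℝ, 0 < h → ∃ f : Rd d → ℂ, Represents f u ∧ GevreyDecay s h f := by
        intro h hh
        -- Offsets the factor `2 / (d + 2)` lost in the pointwise bound. The functions obtained for
        -- different `h` coincide, being continuous and representing the same `u`.
        have hpos : 0 < h * (d + 2) / 2 := by positivity
        have := exists_gevreyDecay_of_mem_coorbit hs hpos hφ (hu _ hpos).1 (hu _ hpos).2
        rwa [show 2 * (h * (d + 2) / 2) / ((d : ℝ) + 2) = h by field_simp] at this
      obtain ⟨f, hfu, hf⟩ := hex 1 one_pos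
      refine ⟨f, hfu, fun h hh => ?_⟩
      obtain ⟨g, hgu, hg⟩ := hex h hh
      obtain rfl := hf.eq_of_represents hφ hg hfu hgu
      exact ⟨hg.weightBound, hg.weightBound_fourier⟩
    tfae_finish
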